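/- **Theorem (Spectral stability of weak relaxation shock profiles).** Write $w=(u,v)\in\mathbb R^n\times\mathbb R^r=\mathbb R^N$ and consider $w_t+F(w)_x=Q(w)$, $F=(f,g)$, $Q=(0_n,q)$, where $F$ and $q$ are $C^3$ on an open set $\mathcal W\subset\mathbb R^N$. Let $\mathcal U^*\subset\mathbb R^n$ be open and $v^*:\mathcal U^*\to\mathbb R^r$ be $C^1$ with graph contained in $\mathcal W$, such that for $u\in\mathcal U^*$, $(u,v)\in\mathcal W$ one has $q(u,v)=0$ if and only if $v=v^*(u)$, and all eigenvalues of $d_vq(u,v^*(u))$ have negative real part. Put $f^*(u)=f(u,v^*(u))$. At $(u,v^*(u))$ let $A_{ij}$ be the blocks of $dF$, let $(q_1,q_2)=dq$, and set $a=A_{11}-A_{12}q_2^{-1}q_1$, $c=A_{21}-A_{22}q_2^{-1}q_1$, and $b_0(u)=-A_{12}q_2^{-1}(c+q_2^{-1}q_1a)$ (the Chapman–Enskog viscosity). For a real square matrix, $\mathrm{Re}\,M=\frac12(M+M^t)$. Assume: * **A1.** $A_0$ is a smooth function from $\mathcal W$ to the symmetric positive definite real matrices, with $A_0\,dF$ symmetric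 on $\mathcal W$. * **A2.** There is a smooth skew-symmetric matrix-valued function $K$ on $\mathcal W$ with $\mathrm{Re}(K\,dF-A_0\,dQ)>0$ on $\mathcal W$. * **B1.** There is a smooth function $a_0$ from $\mathcal U^*$ to the symmetric positive definite real matrices with $a_0\,df^*$ symmetric and $\mathrm{Re}\,(a_0b_0)\ge0$ on $\mathcal U^*$. * **B2.** There is a smooth skew-symmetric matrix-valued function $k$ on $\mathcal U^*$ with $\mathrm{Re}(k\,df^*+a_0b_0)>0$ on $\mathcal U^*$. * **B3.** There is $c_0>0$ such that, for $u\in\mathcal U^*$, $df^*(u)$ has a simple eigenvalue $\alpha_0(u)$ with $|\alpha_0(u)|<c_0$, all its other eigenvalues have absolute value $\ge 2c_0$, and $\eta(u):=d\alpha_0(u)\cdot r_0(u)\neq0$, where $r_0(u)$ is a unit eigenvector of $df^*(u)$ for $\alpha_0(u)$. Let $c,C>0$ and let $\mathcal K\subset\mathcal W$ be compact with $u\in\mathcal U^*$ for every $(u,v)\in\mathcal K$. Then there is $\varepsilon_0>0$ such that the following holds for every $C^2$ stationary solution $W=(U,V):\mathbb R\to\mathcal K$, $F(W)'=Q(W)$,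 with limits $W(\pm\infty)=W_\pm=(u_\pm,v^*(u_\pm))$ and $\varepsilon:=|W_+-W_-|<\varepsilon_0$. Suppose that * (A1, endpoint dissipativity) $\langle\xi,A_0(W_\pm)\,dQ(W_\pm)\,\xi\rangle\le -c\,|dQ(W_\pm)\,\xi|^2$ for all $\xi\in\mathbb R^N$; * **C.** $|W'(x)|\le C\varepsilon^2$, $|W''(x)|\le C\varepsilon|W'(x)|$, $U'(x)\ne0$ and $\Big|\dfrac{U'(x)}{|U'(x)|}+\mathrm{sgn}(\eta(U(x)))\,r_0(U(x))\Big|\le C\varepsilon$ for all $x\in\mathbb R$. Then $W$ is spectrally stable in $H^1$: for every $\lambda\in\mathbb C\setminus\{0\}$ with $\mathrm{Re}\,\lambda\ge0$, the only $w\in H^1(\mathbb R;\mathbb C^N)$ with $\lambda w+(dF(W)w)'-dQ(W)w=0$ is $w=0$. No assumption that $dF$ is invertible (noncharacteristicity) is made. -/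

import Mathlib

open Set Filter Topology MeasureTheory
open scoped ContDiff

noncomputable section

/-- Weak derivative on the real line: `g` is the distributional derivative of `f`. -/
def HasWeakDeriv {E : Type*} [NormedAddCommGroup E] [NormedSpace ℝ E] (f g : ℝ → E) : Prop :=
  LocallyIntegrable f volume ∧ LocallyIntegrable g volume ∧
    ∀ φ : ℝ → ℝ, ContDiff ℝ ∞ φ → HasCompactSupport φ →
      ∫ x, deriv φ x • f x = -∫ x, φ x • g x

/-- The Sobolev space `H¹(ℝ)`: square integrable with square integrable weak derivative. -/
def MemH1 {E : Type*} [NormedAddCommGroup E] [NormedSpace ℝ E] (f : ℝ → E) : Prop :=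
  MemLp f 2 volume ∧ ∃ g : ℝ → E, MemLp g 2 volume ∧ HasWeakDeriv f g

/-- The states `w = (u, v) ∈ ℝⁿ × ℝʳ = ℝᴺ` with the Euclidean norm of `ℝᴺ`. -/
abbrev State (n r : ℕ) : Type := EuclideanSpace ℝ (Fin n ⊕ Fin r)

/-- The conserved part `u` of `w = (u, v)`. -/
def uPart {n r : ℕ} (w : State n r) : EuclideanSpace ℝ (Fin n) :=
  WithLp.toLp 2 fun i => w (Sum.inl i)

/-- The state `(u, v)`. -/
def mkState {n r : ℕ} (u : EuclideanSpace ℝ (Fin n)) (v : EuclideanSpace ℝ (Fin r)) : State n r :=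
  WithLp.toLp 2 (Sum.elim u v)

/-- The Jacobian matrix `(∂ Fᵢ / ∂ wⱼ)` of `F` at `w`. -/
def jacobian {ι κ : Type*} [Fintype ι] [Fintype κ] [DecidableEq ι]
    (F : EuclideanSpace ℝ ι → EuclideanSpace ℝ κ) (w : EuclideanSpace ℝ ι) : Matrix κ ι ℝ :=
  Matrix.of fun i j => fderiv ℝ F w (EuclideanSpace.single j 1) i

/-- The matrix `Re M = (M + Mᵀ) / 2`. -/
def symPart {ι : Type*} (M : Matrix ι ι ℝ) : Matrix ι ι ℝ :=
  (1 / 2 : ℝ) • (M + M.transpose)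

/-- Smoothness on `s` of a matrix-valued function, entry by entry. -/
def SmoothMatrixOn {E ι κ : Type*} [NormedAddCommGroup E] [NormedSpace ℝ E]
    (A : E → Matrix ι κ ℝ) (s : Set E) : Prop :=
  ∀ i j, ContDiffOn ℝ ∞ (fun w => A w i j) s

/-! ### The relaxation system `w_t + F(w)_x = Q(w)`, `Q = (0, q)` -/

/-- The relaxation term `Q(w) = (0, q(w))`. -/
def source {n r : ℕ} (q : State n r → EuclideanSpace ℝ (Fin r)) (w : State n r) : State n r :=
  mkState 0 (q w)

/-- The equilibrium state `(u, v*(u))`. -/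
def equilibrium {n r : ℕ} (vstar : EuclideanSpace ℝ (Fin n) → EuclideanSpace ℝ (Fin r))
    (u : EuclideanSpace ℝ (Fin n)) : State n r :=
  mkState u (vstar u)

/-- The flux `f*(u) = f(u, v*(u))` of the relaxed system, where `F = (f, g)`. -/
def relaxedFlux {n r : ℕ} (F : State n r → State n r)
    (vstar : EuclideanSpace ℝ (Fin n) → EuclideanSpace ℝ (Fin r))
    (u : EuclideanSpace ℝ (Fin n)) : EuclideanSpace ℝ (Fin n) :=
  uPart (F (equilibrium vstar u))

/-- The Chapman-Enskog viscosity `b₀(u)`: with the blocks `A₁₁, A₁₂, A₂₁, A₂₂` of `dF` and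
`0, 0, q₁, q₂` of `dQ` at `(u, v*(u))`, and `a = A₁₁ - A₁₂ q₂⁻¹ q₁`, `c = A₂₁ - A₂₂ q₂⁻¹ q₁`,
it is `b₀ = -A₁₂ q₂⁻¹ (c + q₂⁻¹ q₁ a)`. -/
def viscosity {n r : ℕ} (F : State n r → State n r)
    (q : State n r → EuclideanSpace ℝ (Fin r))
    (vstar : EuclideanSpace ℝ (Fin n) → EuclideanSpace ℝ (Fin r))
    (u : EuclideanSpace ℝ (Fin n)) : Matrix (Fin n) (Fin n) ℝ :=
  let dF := jacobian F (equilibrium vstar u)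
  let dQ := jacobian (source q) (equilibrium vstar u)
  let q₁ := dQ.toBlocks₂₁
  let q₂ := dQ.toBlocks₂₂
  let a := dF.toBlocks₁₁ - dF.toBlocks₁₂ * q₂⁻¹ * q₁
  let c := dF.toBlocks₂₁ - dF.toBlocks₂₂ * q₂⁻¹ * q₁;
  -(dF.toBlocks₁₂ * q₂⁻¹ * (c + q₂⁻¹ * q₁ * a))

/-- The standing structure of the system: `F`, `q` are `C³` on the open set `𝒲`; the graph of the
`C¹` function `v*` over the open set `𝒰` lies in `𝒲` and is the zero set of `q`; and all
eigenvalues of `d_v q(u, v*(u))` have negative real part. -/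
structure RelaxationStructure {n r : ℕ} (F : State n r → State n r)
    (q : State n r → EuclideanSpace ℝ (Fin r))
    (vstar : EuclideanSpace ℝ (Fin n) → EuclideanSpace ℝ (Fin r))
    (𝒲 : Set (State n r)) (𝒰 : Set (EuclideanSpace ℝ (Fin n))) : Prop where
  isOpen_W : IsOpen 𝒲
  isOpen_U : IsOpen 𝒰
  contDiffOn_F : ContDiffOn ℝ 3 F 𝒲
  contDiffOn_q : ContDiffOn ℝ 3 q 𝒲
  contDiffOn_vstar : ContDiffOn ℝ 1 vstar 𝒰
  graph_mem : ∀ u ∈ 𝒰, equilibrium vstar u ∈ 𝒲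
  eq_zero_iff : ∀ u ∈ 𝒰, ∀ v, mkState u v ∈ 𝒲 → (q (mkState u v) = 0 ↔ v = vstar u)
  stable : ∀ u ∈ 𝒰, ∀ z ∈ spectrum ℂ
    ((jacobian (source q) (equilibrium vstar u)).toBlocks₂₂.map (algebraMap ℝ ℂ)), z.re < 0

/-- First half of A1: `A₀` is a smooth symmetric positive definite symmetrizer of `dF`. -/
structure IsSymmetrizer {n r : ℕ} (F : State n r → State n r) (𝒲 : Set (State n r))
    (A₀ : State n r → Matrix (Fin n ⊕ Fin r) (Fin n ⊕ Fin r) ℝ) : Prop where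
  smooth : SmoothMatrixOn A₀ 𝒲
  posDef : ∀ w ∈ 𝒲, (A₀ w).PosDef
  symm : ∀ w ∈ 𝒲, (A₀ w * jacobian F w).IsSymm

/-- Second half of A1, at the state `w`: `⟨ξ, A₀ dQ(w) ξ⟩ ≤ -c |dQ(w) ξ|²`. -/
def DissipativeAt {n r : ℕ} (q : State n r → EuclideanSpace ℝ (Fin r))
    (A₀ : State n r → Matrix (Fin n ⊕ Fin r) (Fin n ⊕ Fin r) ℝ) (c : ℝ) (w : State n r) : Prop :=
  ∀ ξ : State n r,
    inner ℝ ξ (Matrix.toEuclideanLin (A₀ w * jacobian (source q) w) ξ) ≤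
      -c * ‖Matrix.toEuclideanLin (jacobian (source q) w) ξ‖ ^ 2

/-- A2, the Shizuta-Kawashima condition, with compensating matrix `K`. -/
structure ShizutaKawashima {n r : ℕ} (F : State n r → State n r)
    (q : State n r → EuclideanSpace ℝ (Fin r)) (𝒲 : Set (State n r))
    (A₀ K : State n r → Matrix (Fin n ⊕ Fin r) (Fin n ⊕ Fin r) ℝ) : Prop where
  smooth : SmoothMatrixOn K 𝒲
  skew : ∀ w ∈ 𝒲, (K w).transpose = -K w
  pos : ∀ w ∈ 𝒲,
    (symPart (K w * jacobian F w - A₀ w * jacobian (source q) w)).PosDef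

/-! ### The relaxed system `u_t + f*(u)_x = 0` -/

/-- B1: `a₀` symmetrizes `df*` and makes the Chapman-Enskog viscosity dissipative. -/
structure ReducedSymmetrizer {n r : ℕ} (F : State n r → State n r)
    (q : State n r → EuclideanSpace ℝ (Fin r))
    (vstar : EuclideanSpace ℝ (Fin n) → EuclideanSpace ℝ (Fin r))
    (𝒰 : Set (EuclideanSpace ℝ (Fin n)))
    (a₀ : EuclideanSpace ℝ (Fin n) → Matrix (Fin n) (Fin n) ℝ) : Prop where
  smooth : SmoothMatrixOn a₀ 𝒰
  posDef : ∀ u ∈ 𝒰, (a₀ u).PosDef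
  symm : ∀ u ∈ 𝒰, (a₀ u * jacobian (relaxedFlux F vstar) u).IsSymm
  dissipative : ∀ u ∈ 𝒰, (symPart (a₀ u * viscosity F q vstar u)).PosSemidef

/-- B2, the reduced Shizuta-Kawashima condition `Re (k df* + a₀ b₀) > 0`. -/
structure ReducedKawashima {n r : ℕ} (F : State n r → State n r)
    (q : State n r → EuclideanSpace ℝ (Fin r))
    (vstar : EuclideanSpace ℝ (Fin n) → EuclideanSpace ℝ (Fin r))
    (𝒰 : Set (EuclideanSpace ℝ (Fin n)))
    (a₀ k : EuclideanSpace ℝ (Fin n) → Matrix (Fin n) (Fin n) ℝ) : Prop where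
  smooth : SmoothMatrixOn k 𝒰
  skew : ∀ u ∈ 𝒰, (k u).transpose = -k u
  pos : ∀ u ∈ 𝒰,
    (symPart (k u * jacobian (relaxedFlux F vstar) u + a₀ u * viscosity F q vstar u)).PosDef

/-- The genuine nonlinearity coefficient `η(u) = dα₀(u) · r₀(u)`. -/
def gnlCoeff {n : ℕ} (α₀ : EuclideanSpace ℝ (Fin n) → ℝ)
    (r₀ : EuclideanSpace ℝ (Fin n) → EuclideanSpace ℝ (Fin n))
    (u : EuclideanSpace ℝ (Fin n)) : ℝ :=
  fderiv ℝ α₀ u (r₀ u)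

/-- B3: `α₀(u)` is a simple eigenvalue of `df*(u)` with `|α₀(u)| < c₀`, all other eigenvalues have
absolute value at least `2 c₀`, `r₀(u)` is a unit eigenvector (of either sign), and the field is
genuinely nonlinear. -/
structure PrincipalField {n r : ℕ} (F : State n r → State n r)
    (vstar : EuclideanSpace ℝ (Fin n) → EuclideanSpace ℝ (Fin r))
    (𝒰 : Set (EuclideanSpace ℝ (Fin n))) (c₀ : ℝ)
    (α₀ : EuclideanSpace ℝ (Fin n) → ℝ)
    (r₀ : EuclideanSpace ℝ (Fin n) → EuclideanSpace ℝ (Fin n)) : Prop where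
  c₀_pos : 0 < c₀
  small : ∀ u ∈ 𝒰, |α₀ u| < c₀
  simple : ∀ u ∈ 𝒰, (jacobian (relaxedFlux F vstar) u).charpoly.rootMultiplicity (α₀ u) = 1
  others : ∀ u ∈ 𝒰, ∀ μ ∈ spectrum ℝ (jacobian (relaxedFlux F vstar) u),
    μ ≠ α₀ u → 2 * c₀ ≤ |μ|
  unit : ∀ u ∈ 𝒰, ‖r₀ u‖ = 1
  eigen : ∀ u ∈ 𝒰,
    Matrix.toEuclideanLin (jacobian (relaxedFlux F vstar) u) (r₀ u) = α₀ u • r₀ u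
  genuinelyNonlinear : ∀ u ∈ 𝒰, gnlCoeff α₀ r₀ u ≠ 0

/-! ### Profiles and spectral stability -/

/-- `W` is a (stationary) relaxation shock profile connecting `W₋` to `W₊`. -/
structure IsProfile {n r : ℕ} (F : State n r → State n r)
    (q : State n r → EuclideanSpace ℝ (Fin r)) (W : ℝ → State n r) (Wm Wp : State n r) :
    Prop where
  contDiff : ContDiff ℝ 2 W
  equation : ∀ x, HasDerivAt (fun y => F (W y)) (source q (W x)) x
  tendsto_atBot : Tendsto W atBot (𝓝 Wm)
  tendsto_atTop : Tendsto W atTop (𝓝 Wp)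

/-- Assumption C with constant `C`, where `ε = |W₊ - W₋|` and `U` is the `u`-part of `W`. -/
structure ProfileBounds {n r : ℕ} (α₀ : EuclideanSpace ℝ (Fin n) → ℝ)
    (r₀ : EuclideanSpace ℝ (Fin n) → EuclideanSpace ℝ (Fin n)) (C ε : ℝ)
    (W : ℝ → State n r) : Prop where
  size : ∀ x, ‖deriv W x‖ ≤ C * ε ^ 2
  second : ∀ x, ‖deriv (deriv W) x‖ ≤ C * ε * ‖deriv W x‖
  ne_zero : ∀ x, uPart (deriv W x) ≠ 0
  direction : ∀ x,
    ‖‖uPart (deriv W x)‖⁻¹ • uPart (deriv W x) +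
        Real.sign (gnlCoeff α₀ r₀ (uPart (W x))) • r₀ (uPart (W x))‖ ≤ C * ε

/-- `w` solves `λ w + (dF(W) w)' - dQ(W) w = 0` in the sense of distributions. -/
def SolvesEigenvalueEq {n r : ℕ} (F Q : State n r → State n r) (W : ℝ → State n r) (z : ℂ)
    (w : ℝ → EuclideanSpace ℂ (Fin n ⊕ Fin r)) : Prop :=
  HasWeakDeriv
    (fun x => Matrix.toEuclideanLin ((jacobian F (W x)).map (algebraMap ℝ ℂ)) (w x))
    (fun x => Matrix.toEuclideanLin ((jacobian Q (W x)).map (algebraMap ℝ ℂ)) (w x) - z • w x)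

/-- Spectral stability of `W` in `H¹`. -/
def SpectrallyStable {n r : ℕ} (F Q : State n r → State n r) (W : ℝ → State n r) : Prop :=
  ∀ z : ℂ, z ≠ 0 → 0 ≤ z.re → ∀ w : ℝ → EuclideanSpace ℂ (Fin n ⊕ Fin r),
    MemH1 w → SolvesEigenvalueEq F Q W z w → w =ᵐ[volume] 0

end

set_option linter.unusedSectionVars false

/-! ### Weak derivatives on the line -/

/-! An eigenfunction w = (u, v) is tested with an energy that is monotone on the whole line. Being
integrable, this energy is identically zero, and so is its dissipation, which controls w.

Let A = dF(W), let ū be the conserved part of the profile, J = df*(ū), and let s be the relaxed part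
of dQ(W)w. Inverting d_v q gives v = -Du + es, with D = `slaving` and e = `relaxInv`
(`sndL_eq_of_regular`). The conserved rows can be integrated because λ ≠ 0: U = -λ⁻¹(Aw)_u satisfies
U' = u and λU + au + Bs = 0, where a = `reduced` and B = `coupling`. The equation is weighted by N =
a₀ - Ψa₀J, where Ψ = 2Lψ and ψ' = |ū'|. Three mechanisms give decay.

Compression, after Goodman: the weighted flux a₀J - Ψa₀JJ has a derivative that is negative at rate
|ū'|. In the principal direction this is genuine nonlinearity; in the other directions the
derivative of the weight, a multiple of -|ū'|a₀JJ, dominates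
(`SymmetrizableField.exists_goodman_form`).

Viscosity: rewriting ⟨U, NBs⟩ by means of the relaxed rows, and adding the compensator k, produces
-⟨u, (kJ + a₀b₀)u⟩ to leading order, which is definite by B2 (`energy_identity`,
`RelaxationStructure.kawashimaMatrix_equilibrium`).

Relaxation: the symmetrized energy ½⟨w, A₀Aw⟩ dissipates |s|²
(`IsSymmetrizer.exists_energy_estimate`). A large multiple of it absorbs the cross terms, and the
remaining errors are small with ε (`energy_absorb`, `energy_vanishing`).

Smallness comes from the geometry of the profile (`RelaxationStructure.exists_profile_estimates`): W
lies within O(|W'|) of equilibrium, α₀(ū) = O(ε), and α₀(ū) decreases at a rate proportional to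
|ū'|. Hence the curve has length O(ε), and both Ψ and W - W₋ are O(ε).

The equation is never solved for w'. Quadratic energies are differentiated from the continuity of w
and the differentiability of Aw alone (`hasDerivAt_re_inner_symmetric`), so A may be singular. -/

theorem integral_deriv_smul_primitive_of_continuous {E : Type*} [NormedAddCommGroup E]
    [NormedSpace ℝ E] [CompleteSpace E] {g : ℝ → E} (hg : Continuous g) {φ : ℝ → ℝ}
    (hφ : ContDiff ℝ ∞ φ) (hφc : HasCompactSupport φ) :
    ∫ x, deriv φ x • (∫ t in (0 : ℝ)..x, g t) = -∫ x, φ x • g x := by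
  have hG : ∀ x, HasDerivAt (fun x => ∫ t in (0 : ℝ)..x, g t) (g x) x := fun x =>
    intervalIntegral.integral_hasDerivAt_right (hg.intervalIntegrable _ _)
      (hg.stronglyMeasurableAtFilter _ _) hg.continuousAt
  have hGc : Continuous (fun x => ∫ t in (0 : ℝ)..x, g t) :=
    continuous_iff_continuousAt.2 fun x => (hG x).continuousAt
  have hd : Continuous (deriv φ) := hφ.continuous_deriv (by simp)
  have hi1 : Integrable (fun x => deriv φ x • (∫ t in (0 : ℝ)..x, g t)) :=
    (hd.smul hGc).integrable_of_hasCompactSupport (hφc.deriv.smul_right)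
  have hi2 : Integrable (fun x => φ x • g x) :=
    (hφ.continuous.smul hg).integrable_of_hasCompactSupport (hφc.smul_right)
  have hi3 : Integrable (fun x => φ x • (∫ t in (0 : ℝ)..x, g t)) :=
    (hφ.continuous.smul hGc).integrable_of_hasCompactSupport (hφc.smul_right)
  have key := integral_eq_zero_of_hasDerivAt_of_integrable
    (f := fun x => φ x • (∫ t in (0 : ℝ)..x, g t))
    (fun x => ((hφ.differentiable (by simp) x).hasDerivAt).smul (hG x)) (hi2.add hi1) hi3
  rw [integral_add hi2 hi1] at key
  exact eq_neg_of_add_eq_zero_right key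

/-- Both sides are continuous in g for the L¹ norm, with constants ∫|φ'| and sup|φ|, and compactly
supported continuous functions are dense in L¹. -/
theorem integral_deriv_smul_primitive_of_integrable {E : Type*} [NormedAddCommGroup E]
    [NormedSpace ℝ E] [CompleteSpace E] {g : ℝ → E} (hg : Integrable g) {φ : ℝ → ℝ}
    (hφ : ContDiff ℝ ∞ φ) (hφc : HasCompactSupport φ) :
    ∫ x, deriv φ x • (∫ t in (0 : ℝ)..x, g t) = -∫ x, φ x • g x := by
  have hd : Continuous (deriv φ) := hφ.continuous_deriv (by simp)
  have hdi : Integrable (deriv φ) := hd.integrable_of_hasCompactSupport hφc.deriv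
  obtain ⟨B, hB⟩ := hφc.exists_bound_of_continuous hφ.continuous
  have hB0 : 0 ≤ B := (norm_nonneg _).trans (hB 0)
  set A : ℝ := ∫ x, ‖deriv φ x‖ with hA
  have hA0 : 0 ≤ A := integral_nonneg fun _ => norm_nonneg _
  have hprim : ∀ f : ℝ → E, Integrable f → Continuous (fun x => ∫ t in (0 : ℝ)..x, f t) :=
    fun f hf => intervalIntegral.continuous_primitive (fun a b => hf.intervalIntegrable) 0
  have hi1 : ∀ f : ℝ → E, Integrable f →
      Integrable (fun x => deriv φ x • (∫ t in (0 : ℝ)..x, f t)) := fun f hf =>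
    (hd.smul (hprim f hf)).integrable_of_hasCompactSupport (hφc.deriv.smul_right)
  have hi2 : ∀ f : ℝ → E, Integrable f → Integrable (fun x => φ x • f x) := fun f hf =>
    hf.bdd_smul B hφ.continuous.aestronglyMeasurable (Eventually.of_forall hB)
  rw [eq_neg_iff_add_eq_zero, ← norm_eq_zero]
  refine le_antisymm (le_of_forall_pos_le_add fun δ hδ => ?_) (norm_nonneg _)
  -- The two sides together change by at most (A + B) times the L¹ error, which this tolerance keeps
  -- below δ.
  obtain ⟨gc, -, hgc, hgcc, hgci⟩ := hg.exists_hasCompactSupport_integral_sub_le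
    (show 0 < δ / (A + B + 1) by positivity)
  set f : ℝ → E := fun x => g x - gc x with hf
  have hfi : Integrable f := hg.sub hgci
  have h0 := integral_deriv_smul_primitive_of_continuous hgcc hφ hφc
  have e1 : ∫ x, deriv φ x • (∫ t in (0 : ℝ)..x, g t) =
      (∫ x, deriv φ x • (∫ t in (0 : ℝ)..x, f t)) +
        ∫ x, deriv φ x • (∫ t in (0 : ℝ)..x, gc t) := by
    rw [← integral_add (hi1 f hfi) (hi1 gc hgci)]
    congr 1; ext x
    rw [← smul_add, ← intervalIntegral.integral_add hfi.intervalIntegrable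
      hgci.intervalIntegrable]
    simp [hf]
  have e2 : ∫ x, φ x • g x = (∫ x, φ x • f x) + ∫ x, φ x • gc x := by
    rw [← integral_add (hi2 f hfi) (hi2 gc hgci)]
    congr 1; ext x
    simp [hf, ← smul_add]
  have e3 : (∫ x, deriv φ x • (∫ t in (0 : ℝ)..x, g t)) + ∫ x, φ x • g x =
      (∫ x, deriv φ x • (∫ t in (0 : ℝ)..x, f t)) + ∫ x, φ x • f x := by
    rw [e1, e2, h0]; abel
  have b1 : ‖∫ x, deriv φ x • (∫ t in (0 : ℝ)..x, f t)‖ ≤ A * ∫ x, ‖f x‖ := by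
    rw [hA, ← integral_mul_const]
    refine (norm_integral_le_integral_norm _).trans
      (integral_mono (hi1 f hfi).norm (hdi.norm.mul_const _) fun x => ?_)
    simp only [norm_smul]
    gcongr
    refine intervalIntegral.norm_integral_le_integral_norm_uIoc.trans ?_
    exact setIntegral_le_integral hfi.norm (Eventually.of_forall fun _ => norm_nonneg _)
  have b2 : ‖∫ x, φ x • f x‖ ≤ B * ∫ x, ‖f x‖ := by
    rw [← integral_const_mul]
    refine (norm_integral_le_integral_norm _).trans
      (integral_mono (hi2 f hfi).norm (hfi.norm.const_mul _) fun x => ?_)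
    simp only [norm_smul]
    exact mul_le_mul_of_nonneg_right (hB x) (norm_nonneg _)
  rw [e3, zero_add]
  calc _ ≤ A * (∫ x, ‖f x‖) + B * ∫ x, ‖f x‖ := (norm_add_le _ _).trans (add_le_add b1 b2)
    _ = (A + B) * ∫ x, ‖f x‖ := by ring
    _ ≤ (A + B) * (δ / (A + B + 1)) := by gcongr
    _ ≤ δ := by
      rw [← mul_div_assoc, div_le_iff₀ (by positivity)]
      nlinarith

theorem integral_deriv_smul_primitive {E : Type*} [NormedAddCommGroup E]
    [NormedSpace ℝ E] [CompleteSpace E] {g : ℝ → E} (hg : LocallyIntegrable g) {φ : ℝ → ℝ}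
    (hφ : ContDiff ℝ ∞ φ) (hφc : HasCompactSupport φ) :
    ∫ x, deriv φ x • (∫ t in (0 : ℝ)..x, g t) = -∫ x, φ x • g x := by
  obtain ⟨R, hR⟩ := hφc.isCompact.isBounded.subset_closedBall 0
  -- The interval must contain 0, the base point of the primitive, even when the support of φ is
  -- empty.
  set R' := max R 0
  have hR' : tsupport φ ⊆ Icc (-R') R' := by
    intro x hx
    have := hR hx
    rw [Metric.mem_closedBall, dist_zero_right, Real.norm_eq_abs] at this
    exact abs_le.1 (this.trans (le_max_left _ _))
  have hint : Integrable ((Icc (-R') R').indicator g) :=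
    (integrable_indicator_iff measurableSet_Icc).2 (hg.integrableOn_isCompact isCompact_Icc)
  have h := integral_deriv_smul_primitive_of_integrable hint hφ hφc
  have e1 : (fun x => deriv φ x • (∫ t in (0 : ℝ)..x, (Icc (-R') R').indicator g t)) =
      fun x => deriv φ x • (∫ t in (0 : ℝ)..x, g t) := by
    ext x
    by_cases hx : x ∈ tsupport φ
    · congr 1
      refine intervalIntegral.integral_congr fun t ht => indicator_of_mem ?_ _
      have h0 : (0 : ℝ) ∈ Icc (-R') R' := by simp [R']
      exact (ordConnected_Icc.uIcc_subset h0 (hR' hx)) ht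
    · have : deriv φ x = 0 := by
        by_contra hne
        exact hx (support_deriv_subset hne)
      simp [this]
  have e2 : (fun x => φ x • (Icc (-R') R').indicator g x) = fun x => φ x • g x := by
    ext x
    by_cases hx : x ∈ tsupport φ
    · rw [indicator_of_mem (hR' hx)]
    · simp [image_eq_zero_of_notMem_tsupport hx]
  rwa [e1, e2] at h

/-- The primitive from -∞ vanishes to the left of the support, and to the right of it because the
total mass is zero. -/
theorem exists_antiderivative_hasCompactSupport {θ : ℝ → ℝ} (hθ : ContDiff ℝ ∞ θ)
    (hθc : HasCompactSupport θ) (h0 : ∫ x, θ x = 0) :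
    ∃ φ : ℝ → ℝ, ContDiff ℝ ∞ φ ∧ HasCompactSupport φ ∧ deriv φ = θ := by
  obtain ⟨R, hR⟩ := hθc.isCompact.isBounded.subset_closedBall 0
  have hsupp : ∀ x, x ∉ Icc (-R) R → θ x = 0 := by
    intro x hx
    apply image_eq_zero_of_notMem_tsupport
    intro h
    have := hR h
    rw [Metric.mem_closedBall, dist_zero_right, Real.norm_eq_abs] at this
    exact hx (abs_le.1 this)
  have hI : Integrable θ := hθ.continuous.integrable_of_hasCompactSupport hθc
  have hd : ∀ x, HasDerivAt (fun x => ∫ t in Iic x, θ t) (θ x) x := by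
    intro x
    have h1 : (fun x => ∫ t in Iic x, θ t) =
        fun x => (∫ t in Iic (0 : ℝ), θ t) + ∫ t in (0 : ℝ)..x, θ t := by
      ext x
      rw [← intervalIntegral.integral_Iic_sub_Iic hI.integrableOn hI.integrableOn]
      ring
    rw [h1]
    exact (intervalIntegral.integral_hasDerivAt_right (hθ.continuous.intervalIntegrable _ _)
      (hθ.continuous.stronglyMeasurableAtFilter _ _) hθ.continuous.continuousAt).const_add _
  refine ⟨fun x => ∫ t in Iic x, θ t, ?_, ?_, funext fun x => (hd x).deriv⟩
  · rw [contDiff_infty_iff_deriv]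
    refine ⟨fun x => (hd x).differentiableAt, ?_⟩
    rwa [show deriv (fun x => ∫ t in Iic x, θ t) = θ from funext fun x => (hd x).deriv]
  · refine HasCompactSupport.intro (isCompact_Icc (a := -R) (b := R)) fun x hx => ?_
    rw [mem_Icc, not_and_or, not_le, not_le] at hx
    rcases hx with hx | hx
    · refine setIntegral_eq_zero_of_forall_eq_zero fun t ht => hsupp t fun h => ?_
      exact absurd (h.1.trans ht) (not_le.2 hx)
    · have : ∫ t in Ioi x, θ t = 0 :=
        setIntegral_eq_zero_of_forall_eq_zero fun t ht => hsupp t fun h =>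
          absurd (hx.trans (mem_Ioi.1 ht)) (not_lt.2 h.2)
      have h2 := integral_add_compl (measurableSet_Iic (a := x)) hI
      rw [compl_Iic, this, add_zero, h0] at h2
      exact h2

/-- A locally integrable function with a weak derivative is almost everywhere equal to a primitive
of it. -/
theorem HasWeakDeriv.exists_ae_eq_primitive {E : Type*} [NormedAddCommGroup E]
    [NormedSpace ℝ E] [CompleteSpace E] {f g : ℝ → E} (h : HasWeakDeriv f g) :
    ∃ c : E, f =ᵐ[volume] fun x => c + ∫ t in (0 : ℝ)..x, g t := by
  obtain ⟨hf, hg, hfg⟩ := h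
  have hgi : ∀ a b, IntervalIntegrable g volume a b := fun a b =>
    (hg.integrableOn_isCompact isCompact_uIcc).intervalIntegrable
  have hGc : Continuous (fun x => ∫ t in (0 : ℝ)..x, g t) :=
    intervalIntegral.continuous_primitive hgi 0
  set D : ℝ → E := fun x => f x - ∫ t in (0 : ℝ)..x, g t with hD
  have hDl : LocallyIntegrable D := hf.sub hGc.locallyIntegrable
  have hint : ∀ φ : ℝ → ℝ, Continuous φ → HasCompactSupport φ → ∀ k : ℝ → E,
      LocallyIntegrable k → Integrable (fun x => φ x • k x) := fun φ hφ hc k hk =>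
    hk.integrable_smul_left_of_hasCompactSupport hφ hc
  have hD0 : ∀ φ : ℝ → ℝ, ContDiff ℝ ∞ φ → HasCompactSupport φ →
      ∫ x, deriv φ x • D x = 0 := by
    intro φ hφ hφc
    have hd : Continuous (deriv φ) := hφ.continuous_deriv (by simp)
    simp only [hD, smul_sub]
    rw [integral_sub (hint _ hd hφc.deriv _ hf) (hint _ hd hφc.deriv _ hGc.locallyIntegrable),
      hfg φ hφ hφc, integral_deriv_smul_primitive hg hφ hφc, sub_self]
  -- The du Bois-Reymond argument: with ψ of mass one, χ - (∫χ)ψ has mean zero and is therefore the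
  -- derivative of a test function. As D annihilates such derivatives, it acts on χ like the
  -- constant c = ∫ψD.
  let b : ContDiffBump (0 : ℝ) := default
  set ψ : ℝ → ℝ := b.normed volume with hψ
  have hψs : ContDiff ℝ ∞ ψ := b.contDiff_normed
  have hψc : HasCompactSupport ψ := b.hasCompactSupport_normed
  have hψ1 : ∫ x, ψ x = 1 := b.integral_normed
  set c : E := ∫ x, ψ x • D x with hc
  refine ⟨c, ?_⟩
  have key : ∀ᵐ x, D x - c = 0 := by
    refine ae_eq_zero_of_integral_contDiff_smul_eq_zero (hDl.sub (locallyIntegrable_const c))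
      fun χ hχ hχc => ?_
    set I : ℝ := ∫ x, χ x with hI
    have hχi : Integrable χ := hχ.continuous.integrable_of_hasCompactSupport hχc
    have hψi : Integrable ψ := hψs.continuous.integrable_of_hasCompactSupport hψc
    obtain ⟨φ, hφ, hφc, hφd⟩ := exists_antiderivative_hasCompactSupport
      (θ := fun x => χ x - I * ψ x) (hχ.sub (contDiff_const.mul hψs))
      (hχc.sub (hψc.mul_left)) (by
        rw [integral_sub hχi (hψi.const_mul _), integral_const_mul, hψ1, mul_one, sub_self])
    have h1 := hD0 φ hφ hφc
    rw [hφd] at h1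
    have h2 : ∫ x, (χ x - I * ψ x) • D x = (∫ x, χ x • D x) - I • c := by
      have hi : Integrable (fun x => I • ψ x • D x) :=
        (hint _ hψs.continuous hψc _ hDl).smul I
      simp only [sub_smul, mul_smul]
      rw [integral_sub (hint _ hχ.continuous hχc _ hDl) hi, integral_smul]
    rw [h2] at h1
    simp only [smul_sub]
    rw [integral_sub (hint _ hχ.continuous hχc _ hDl) (hχi.smul_const c), integral_smul_const]
    exact h1
  filter_upwards [key] with x hx
  rw [← sub_eq_iff_eq_add]
  exact sub_eq_zero.1 hx

theorem MemH1.exists_continuous_ae_eq {E : Type*} [NormedAddCommGroup E]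
    [NormedSpace ℝ E] [CompleteSpace E] {f : ℝ → E} (h : MemH1 f) :
    ∃ f' : ℝ → E, Continuous f' ∧ f =ᵐ[volume] f' := by
  obtain ⟨-, g, -, hg⟩ := h
  obtain ⟨c, hc⟩ := hg.exists_ae_eq_primitive
  exact ⟨_, continuous_const.add (intervalIntegral.continuous_primitive
    (fun a b =>
      (hg.2.1.integrableOn_isCompact isCompact_uIcc).intervalIntegrable) 0), hc⟩

theorem HasWeakDeriv.congr_ae {E : Type*} [NormedAddCommGroup E] [NormedSpace ℝ E]
    {f g f' g' : ℝ → E} (h : HasWeakDeriv f g) (hf : f =ᵐ[volume] f') (hg : g =ᵐ[volume] g') :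
    HasWeakDeriv f' g' := by
  refine ⟨h.1.congr hf, h.2.1.congr hg, fun φ hφ hφc => ?_⟩
  rw [← integral_congr_ae (hf.mono fun x hx => congrArg (deriv φ x • ·) hx), h.2.2 φ hφ hφc,
    integral_congr_ae (hg.mono fun x hx => congrArg (φ x • ·) hx)]

/-- A continuous function with a continuous weak derivative is classically differentiable. -/
theorem HasWeakDeriv.hasDerivAt {E : Type*} [NormedAddCommGroup E]
    [NormedSpace ℝ E] [CompleteSpace E] {f g : ℝ → E} (h : HasWeakDeriv f g)
    (hf : Continuous f) (hg : Continuous g) (x : ℝ) : HasDerivAt f (g x) x := by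
  obtain ⟨c, hc⟩ := h.exists_ae_eq_primitive
  have hd : ∀ x, HasDerivAt (fun x => c + ∫ t in (0 : ℝ)..x, g t) (g x) x := fun x =>
    (intervalIntegral.integral_hasDerivAt_right (hg.intervalIntegrable _ _)
      (hg.stronglyMeasurableAtFilter _ _) hg.continuousAt).const_add c
  have : f = fun x => c + ∫ t in (0 : ℝ)..x, g t :=
    (Continuous.ae_eq_iff_eq volume hf
      (continuous_iff_continuousAt.2 fun x => (hd x).continuousAt)).1 hc
  rw [this]
  exact hd x

/-- An integrable antitone function on the line vanishes. -/
theorem Antitone.eq_zero_of_integrable {P : ℝ → ℝ} (hP : Antitone P) (hi : Integrable P) (x : ℝ) :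
    P x = 0 := by
  -- An integrable function cannot exceed a positive constant in norm on a set of infinite measure.
  -- By monotonicity, a positive value at x would persist on the left half line and a negative one
  -- on the right.
  have key : ∀ s : Set ℝ, volume s = ⊤ → ∀ c : ℝ, (∀ y ∈ s, c ≤ ‖P y‖) → c ≤ 0 := by
    intro s hs c hc
    by_contra! hpos
    have h1 := hi.measure_norm_ge_lt_top hpos
    exact absurd (measure_mono_top (fun y hy => hc y hy) hs) h1.ne
  refine le_antisymm (key (Iic x) Real.volume_Iic _ fun y hy => ?_) ?_
  · exact (hP hy).trans (le_abs_self _)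
  · have := key (Ici x) Real.volume_Ici (-P x) fun y hy => ?_
    · linarith
    · exact (neg_le_neg (hP hy)).trans (neg_le_abs _)

/-! ### The pointwise energy inequality -/

theorem HasDerivAt.complexCLM_apply {E G : Type*} [NormedAddCommGroup E] [NormedSpace ℂ E]
    [NormedAddCommGroup G] [NormedSpace ℂ G] {S : ℝ → E →L[ℂ] G} {S' : E →L[ℂ] G} {f : ℝ → E}
    {f' : E} {x : ℝ} (hS : HasDerivAt S S' x) (hf : HasDerivAt f f' x) :
    HasDerivAt (fun t => S t (f t)) (S' (f x) + S x f') x :=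
  ((ContinuousLinearMap.restrictScalarsL ℂ E G ℝ ℝ).hasFDerivAt.comp_hasDerivAt x hS).clm_apply hf

theorem HasDerivAt.complex_re {f : ℝ → ℂ} {f' : ℂ} {x : ℝ} (hf : HasDerivAt f f' x) :
    HasDerivAt (fun t => (f t).re) f'.re x :=
  Complex.reCLM.hasFDerivAt.comp_hasDerivAt x hf

theorem abs_re_inner_clm_le {E G : Type*} [NormedAddCommGroup E] [InnerProductSpace ℂ E]
    [NormedAddCommGroup G] [InnerProductSpace ℂ G] (M : G →L[ℂ] E) (x : E) (z : G) {a b c : ℝ}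
    (hx : ‖x‖ ≤ a) (hM : ‖M‖ ≤ b) (hz : ‖z‖ ≤ c) : |(inner ℂ x (M z)).re| ≤ a * (b * c) := by
  refine (Complex.abs_re_le_norm _).trans ((norm_inner_le_norm _ _).trans ?_)
  have hb : 0 ≤ b := (norm_nonneg _).trans hM
  have : ‖M z‖ ≤ b * c := (M.le_opNorm z).trans (mul_le_mul hM hz (norm_nonneg _) hb)
  exact mul_le_mul hx this (norm_nonneg _) ((norm_nonneg _).trans hx)

section Pointwise

variable {E G : Type*} [NormedAddCommGroup E] [InnerProductSpace ℂ E]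
  [NormedAddCommGroup G] [InnerProductSpace ℂ G]

local notation "⟪" x ", " y "⟫" => inner ℂ x y

/-- Pairing N times the integrated equation with U gives Re z⟨U, NU⟩, a transport term and ⟨U, Ts⟩.
The last one is rewritten with s = h' + zv and v = -Du + es, and every zU that meets u is replaced
by -au - Bs. This turns the source into the viscous form -T((A₂₁ - A₂₂D) + Da). The skew k
contributes k∘a by the same substitution. What is left over is the final bracket. -/
theorem energy_identity (z : ℂ) (U u : E) (v s h : G) (a N S S' k k' : E →L[ℂ] E)
    (B T T' : G →L[ℂ] E) (Y' : E →L[ℂ] E) (A₂₁ D : E →L[ℂ] G) (A₂₂ e : G →L[ℂ] G)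
    (hN : ∀ x y, ⟪N x, y⟫ = ⟪x, N y⟫) (hS : ∀ x y, ⟪S x, y⟫ = ⟪x, S y⟫)
    (hk : ∀ x y, ⟪k x, y⟫ = -⟪x, k y⟫) (hT : T = N.comp B)
    (h1 : z • U + a u + B s = 0) (hh : h = A₂₁ u + A₂₂ v) (hv : v = -D u + e s) :
    2⁻¹ * (⟪U, S' U + S u⟫ + ⟪u, S U⟫).re
      - (⟪U, Y' (z • U) + T (D (z • u))⟫ + ⟪u, T (D (z • U))⟫).re
      + (⟪U, T' h + T (s - z • v)⟫ + ⟪u, T h⟫).re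
      - 2⁻¹ * (⟪z • U, k' U + k u⟫ + ⟪z • u, k U⟫).re =
    -(z.re * ⟪U, N U⟫.re) + 2⁻¹ * ⟪U, S' U⟫.re
      - ⟪u, (k.comp a - T.comp (A₂₁ - A₂₂.comp D) - T.comp (D.comp a)) u⟫.re
      + (-⟪U, (N.comp a - S) u⟫.re - ⟪U, Y' (z • U)⟫.re + ⟪U, T' h⟫.re
        - 2 * z.re * ⟪U, T.comp e s⟫.re + ⟪z • U, T.comp e s⟫.re
        + ⟪u, T.comp (D.comp B) s⟫.re + ⟪u, T.comp (A₂₂.comp e) s⟫.re - z.re * ⟪u, k U⟫.re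
        - 2⁻¹ * ⟪z • U, k' U⟫.re - ⟪u, k.comp B s⟫.re) := by
  have hzU : z • U = -a u - B s := by
    rw [eq_sub_iff_add_eq, eq_neg_iff_add_eq_zero, add_right_comm]; exact h1
  have e1 : ⟪u, S U⟫.re = ⟪U, S u⟫.re := by
    rw [← hS, ← inner_conj_symm (𝕜 := ℂ), Complex.conj_re]
  have im0 : ⟪U, N U⟫.im = 0 := by
    have := congrArg Complex.im (inner_conj_symm (𝕜 := ℂ) U (N U))
    rw [hN, Complex.conj_im] at this
    linarith
  have e2 : z.re * ⟪U, N U⟫.re = -⟪U, N (a u)⟫.re - ⟪U, T s⟫.re := by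
    have : ⟪U, N (z • U)⟫.re = z.re * ⟪U, N U⟫.re := by
      rw [map_smul, inner_smul_right, Complex.mul_re, im0]; ring
    rw [← this, hzU, hT]
    simp
  have e3 : ⟪u, k (z • U)⟫.re = -⟪u, k (a u)⟫.re - ⟪u, k (B s)⟫.re := by
    rw [hzU]; simp
  have e4 : ⟪z • U, k u⟫.re = -⟪u, k (z • U)⟫.re := by
    rw [← inner_conj_symm (𝕜 := ℂ), hk, Complex.conj_re, Complex.neg_re]
  have e5 : ⟪z • u, k U⟫.re = 2 * z.re * ⟪u, k U⟫.re - ⟪u, k (z • U)⟫.re := by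
    rw [map_smul, inner_smul_left, inner_smul_right]
    simp [Complex.mul_re]; ring
  have e6 : ⟪u, T (D (z • U))⟫.re = -⟪u, T (D (a u))⟫.re - ⟪u, T (D (B s))⟫.re := by
    rw [hzU]; simp [inner_neg_right]
  have e7 : ⟪u, T h⟫.re = ⟪u, T (A₂₁ u)⟫.re - ⟪u, T (A₂₂ (D u))⟫.re + ⟪u, T (A₂₂ (e s))⟫.re := by
    rw [hh, hv]; simp [inner_neg_right]; ring
  have e8 : ⟪U, T (s - z • v)⟫.re = ⟪U, T s⟫.re + ⟪U, T (D (z • u))⟫.re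
      - 2 * z.re * ⟪U, T (e s)⟫.re + ⟪z • U, T (e s)⟫.re := by
    rw [hv, inner_smul_left]
    simp [inner_neg_right, inner_smul_right, Complex.mul_re]
    ring
  rw [map_sub, inner_sub_right, Complex.sub_re] at e8
  simp only [inner_add_right, inner_sub_right, Complex.add_re, Complex.sub_re,
    ContinuousLinearMap.comp_apply, sub_apply, map_sub, e1, e4, e5, e6, e7]
  linarith

/-- Each error contains a coefficient derivative or the commutator (factor ρ), a product of u with
s, two factors s, or the factor Re z. The vector zU is estimated through -(au + Bs) and never
through |z||U|, so the bound is uniform in z. -/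
theorem energy_error_le {C ρ : ℝ} (hC : 1 ≤ C) (hρ : 0 ≤ ρ) (z : ℂ) (hz : 0 ≤ z.re) (U u : E)
    (v s h : G) (a k k' Y' R : E →L[ℂ] E)
    (B T T' : G →L[ℂ] E) (A₂₁ D : E →L[ℂ] G) (A₂₂ e : G →L[ℂ] G)
    (h1 : z • U + a u + B s = 0) (hh : h = A₂₁ u + A₂₂ v) (hv : v = -D u + e s)
    (ba : ‖a‖ ≤ C) (bB : ‖B‖ ≤ C) (bT : ‖T‖ ≤ C) (bk : ‖k‖ ≤ C) (b21 : ‖A₂₁‖ ≤ C)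
    (b22 : ‖A₂₂‖ ≤ C) (bD : ‖D‖ ≤ C) (be : ‖e‖ ≤ C) (bk' : ‖k'‖ ≤ C * ρ) (bY' : ‖Y'‖ ≤ C * ρ)
    (bT' : ‖T'‖ ≤ C * ρ) (bR : ‖R‖ ≤ C * ρ) :
    -⟪U, R u⟫.re - ⟪U, Y' (z • U)⟫.re + ⟪U, T' h⟫.re
        - 2 * z.re * ⟪U, T.comp e s⟫.re + ⟪z • U, T.comp e s⟫.re
        + ⟪u, T.comp (D.comp B) s⟫.re + ⟪u, T.comp (A₂₂.comp e) s⟫.re - z.re * ⟪u, k U⟫.re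
        - 2⁻¹ * ⟪z • U, k' U⟫.re - ⟪u, k.comp B s⟫.re ≤
      10 * C ^ 4 * (ρ * ‖U‖ * (‖u‖ + ‖s‖) + ‖u‖ * ‖s‖ + ‖s‖ ^ 2 + z.re * ‖U‖ * (‖u‖ + ‖s‖)) := by
  have hC0 : 0 ≤ C := by linarith
  set α := ‖U‖ with hα
  set β := ‖u‖ with hβ
  set γ := ‖s‖ with hγ
  have α0 : 0 ≤ α := norm_nonneg _
  have β0 : 0 ≤ β := norm_nonneg _
  have γ0 : 0 ≤ γ := norm_nonneg _
  have hzU : z • U = -(a u + B s) := by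
    rw [eq_neg_iff_add_eq_zero, ← add_assoc]; exact h1
  have by' : ‖z • U‖ ≤ C * (β + γ) := by
    rw [hzU, norm_neg, mul_add]
    exact norm_add_le_of_le (a.le_of_opNorm_le ba u) (B.le_of_opNorm_le bB s)
  have bv : ‖v‖ ≤ C * (β + γ) := by
    rw [hv, mul_add]
    refine norm_add_le_of_le ?_ (e.le_of_opNorm_le be s)
    rw [norm_neg]; exact D.le_of_opNorm_le bD u
  have bh : ‖h‖ ≤ 2 * C ^ 2 * (β + γ) := by
    rw [hh]
    refine (norm_add_le_of_le (A₂₁.le_of_opNorm_le b21 u) (A₂₂.le_of_opNorm_le b22 v)).trans ?_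
    have := mul_le_mul_of_nonneg_left bv hC0
    nlinarith [mul_nonneg hC0 β0, mul_nonneg hC0 γ0, mul_nonneg (mul_nonneg hC0 β0) (sub_nonneg.2 hC),
      mul_nonneg (mul_nonneg hC0 γ0) (sub_nonneg.2 hC)]
  have bTe := (T.opNorm_comp_le e).trans (mul_le_mul bT be (norm_nonneg _) hC0)
  have bDB := (D.opNorm_comp_le B).trans (mul_le_mul bD bB (norm_nonneg _) hC0)
  have bTDB := (T.opNorm_comp_le (D.comp B)).trans (mul_le_mul bT bDB (norm_nonneg _) hC0)
  have bAe := (A₂₂.opNorm_comp_le e).trans (mul_le_mul b22 be (norm_nonneg _) hC0)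
  have bTAe := (T.opNorm_comp_le (A₂₂.comp e)).trans (mul_le_mul bT bAe (norm_nonneg _) hC0)
  have bkB := (k.opNorm_comp_le B).trans (mul_le_mul bk bB (norm_nonneg _) hC0)
  have t1 := abs_le.1 (abs_re_inner_clm_le R U u le_rfl bR le_rfl)
  have t2 := abs_le.1 (abs_re_inner_clm_le Y' U (z • U) le_rfl bY' by')
  have t3 := abs_le.1 (abs_re_inner_clm_le T' U h le_rfl bT' bh)
  have t4 := abs_le.1 (abs_re_inner_clm_le (T.comp e) U s le_rfl bTe le_rfl)
  have t5 := abs_le.1 (abs_re_inner_clm_le (T.comp e) (z • U) s by' bTe le_rfl)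
  have t6 := abs_le.1 (abs_re_inner_clm_le (T.comp (D.comp B)) u s le_rfl bTDB le_rfl)
  have t7 := abs_le.1 (abs_re_inner_clm_le (T.comp (A₂₂.comp e)) u s le_rfl bTAe le_rfl)
  have t8 := abs_le.1 (abs_re_inner_clm_le k u U le_rfl bk le_rfl)
  have t9 := abs_le.1 (abs_re_inner_clm_le k' (z • U) U by' bk' le_rfl)
  have t10 := abs_le.1 (abs_re_inner_clm_le (k.comp B) u s le_rfl bkB le_rfl)
  have t4' := mul_le_mul_of_nonneg_left t4.1 hz
  have t8' := mul_le_mul_of_nonneg_left t8.1 hz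
  have p1 : C ≤ C ^ 4 := le_self_pow₀ hC (by norm_num)
  have p2 : C ^ 2 ≤ C ^ 4 := pow_le_pow_right₀ hC (by norm_num)
  have p3 : C ^ 3 ≤ C ^ 4 := pow_le_pow_right₀ hC (by norm_num)
  have q1 : 0 ≤ ρ * α * β := by positivity
  have q2 : 0 ≤ ρ * α * γ := by positivity
  have q3 : 0 ≤ β * γ := by positivity
  have q4 : 0 ≤ γ ^ 2 := by positivity
  have q5 : 0 ≤ z.re * α * β := by positivity
  have q6 : 0 ≤ z.re * α * γ := by positivity
  have m := fun (x : ℝ) (hx : 0 ≤ x) => And.intro (mul_le_mul_of_nonneg_right p1 hx)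
    (And.intro (mul_le_mul_of_nonneg_right p2 hx) (And.intro (mul_le_mul_of_nonneg_right p3 hx)
      (mul_nonneg (show 0 ≤ C ^ 4 by positivity) hx)))
  obtain ⟨m11, m12, m13, m14⟩ := m _ q1
  obtain ⟨m21, m22, m23, m24⟩ := m _ q2
  obtain ⟨m31, m32, m33, m34⟩ := m _ q3
  obtain ⟨m41, m42, m43, m44⟩ := m _ q4
  obtain ⟨m51, m52, m53, m54⟩ := m _ q5
  obtain ⟨m61, m62, m63, m64⟩ := m _ q6
  ring_nf at *
  linarith [t1.1, t2.1, t3.2, t5.2, t6.2, t7.2, t9.1, t10.1]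

/-- Young's inequality with a definite order of choices. Here α, β, γ stand for |U|, |u|, |s| and σ
for Re z. First M is taken so large that the relaxation energy pays for all γ² and σ terms; then ε
is taken small depending on M. -/
theorem energy_absorb {C m θ c : ℝ} (hC : 1 ≤ C) (hm : 0 < m) (hθ : 0 < θ) (hc : 0 < c) :
    ∃ M : ℝ, 0 < M ∧ ∃ ε₀ : ℝ, 0 < ε₀ ∧ ∀ ε ρ σ α β γ w : ℝ, 0 ≤ ε → ε ≤ ε₀ → 0 ≤ ρ → ρ ≤ C * ε →
      0 ≤ σ → w ^ 2 ≤ C * (β ^ 2 + γ ^ 2) →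
      β ^ 2 + γ ^ 2 ≤ C * w ^ 2 →
      -(m * σ * α ^ 2) - θ * ρ * α ^ 2 - θ * β ^ 2
        + C * (ρ * α * (β + γ) + β * γ + γ ^ 2 + σ * α * (β + γ))
        + C * ε * (β ^ 2 + ρ * α ^ 2)
        + M * (-(m * σ * w ^ 2) - c * γ ^ 2 + C * ε * w ^ 2) ≤ -(θ / 4) * β ^ 2 - γ ^ 2 := by
  have hC0 : 0 < C := by linarith
  -- The first summand pays for the cross term with σ. The second pays for γ²: C²/θ from the product
  -- βγ, C from the explicit γ² term, and 2 for the ε-errors and the final -γ².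
  set M := C ^ 3 / (2 * m) / m + (C ^ 2 / θ + C + 2) / c with hM
  have hM0 : 0 < M := by positivity
  have hM1 : C ^ 3 / (2 * m) ≤ M * m := by
    rw [hM, add_mul, div_mul_cancel₀ _ hm.ne']
    have : 0 ≤ (C ^ 2 / θ + C + 2) / c * m := by positivity
    linarith
  have hM2 : C ^ 2 / θ + C + 2 ≤ M * c := by
    rw [hM, add_mul, div_mul_cancel₀ _ hc.ne']
    have : 0 ≤ C ^ 3 / (2 * m) / m * c := by positivity
    linarith
  -- All coefficients of ε in front of β² and γ². Since Q contains M, the threshold ε₀ can only be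
  -- fixed after M.
  set Q := C ^ 3 / θ + M * C ^ 2 + C with hQ
  have hQ0 : 0 < Q := by positivity
  set ε₀ := min (θ / (2 * C)) (min (θ / (4 * Q)) (1 / Q)) with hε₀
  refine ⟨M, hM0, ε₀, by positivity, ?_⟩
  intro ε ρ σ α β γ w hε hεle hρ hρε hσ hw1 hw2
  have i1 : C * ε ≤ θ / 2 := by
    have := (hεle.trans (min_le_left _ _))
    rw [le_div_iff₀ (by positivity)] at this
    linarith
  have i2 : Q * ε ≤ θ / 4 := by
    have := (hεle.trans ((min_le_right _ _).trans (min_le_left _ _)))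
    rw [le_div_iff₀ (by positivity)] at this
    linarith
  have i3 : Q * ε ≤ 1 := by
    have := (hεle.trans ((min_le_right _ _).trans (min_le_right _ _)))
    rw [le_div_iff₀ (by positivity)] at this
    linarith
  have sq : (β + γ) ^ 2 ≤ 2 * (β ^ 2 + γ ^ 2) := by nlinarith [sq_nonneg (β - γ)]
  have young : ∀ t a b : ℝ, 0 < t → C * a * b ≤ t * a ^ 2 + C ^ 2 / (4 * t) * b ^ 2 := by
    intro t a b ht
    have h := sq_nonneg (2 * t * a - C * b)
    have : t * a ^ 2 + C ^ 2 / (4 * t) * b ^ 2 - C * a * b = (2 * t * a - C * b) ^ 2 / (4 * t) := by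
      field_simp; ring
    have : 0 ≤ (2 * t * a - C * b) ^ 2 / (4 * t) := by positivity
    linarith
  have j1 : C * (ρ * α * (β + γ)) ≤ θ / 2 * ρ * α ^ 2 + C ^ 3 / θ * ε * (β ^ 2 + γ ^ 2) := by
    have h := mul_le_mul_of_nonneg_left (young (θ / 2) α (β + γ) (by positivity)) hρ
    have h2 : C ^ 2 / (4 * (θ / 2)) * (β + γ) ^ 2 ≤ C ^ 2 / θ * (β ^ 2 + γ ^ 2) := by
      have : C ^ 2 / (4 * (θ / 2)) = C ^ 2 / θ / 2 := by field_simp; ring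
      rw [this]
      have := mul_le_mul_of_nonneg_left sq (show 0 ≤ C ^ 2 / θ / 2 by positivity)
      linarith
    have h3 := mul_le_mul_of_nonneg_left h2 hρ
    have h4 := mul_le_mul_of_nonneg_right hρε (show 0 ≤ C ^ 2 / θ * (β ^ 2 + γ ^ 2) by positivity)
    have h5 : C * ε * (C ^ 2 / θ * (β ^ 2 + γ ^ 2)) = C ^ 3 / θ * ε * (β ^ 2 + γ ^ 2) := by ring
    linarith
  have j2 : C * (β * γ) ≤ θ / 4 * β ^ 2 + C ^ 2 / θ * γ ^ 2 := by
    have h := young (θ / 4) β γ (by positivity)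
    have : C ^ 2 / (4 * (θ / 4)) = C ^ 2 / θ := by field_simp
    rw [this] at h
    linarith
  have j3 : C * (σ * α * (β + γ)) ≤ m * σ * α ^ 2 + M * m * σ * w ^ 2 := by
    have h := mul_le_mul_of_nonneg_left (young m α (β + γ) hm) hσ
    have h2 : C ^ 2 / (4 * m) * (β + γ) ^ 2 ≤ C ^ 3 / (2 * m) * w ^ 2 := by
      have e1 := mul_le_mul_of_nonneg_left sq (show 0 ≤ C ^ 2 / (4 * m) by positivity)
      have e2 := mul_le_mul_of_nonneg_left hw2 (show 0 ≤ C ^ 2 / (4 * m) * 2 by positivity)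
      have e3 : C ^ 2 / (4 * m) * 2 * (C * w ^ 2) = C ^ 3 / (2 * m) * w ^ 2 := by field_simp; ring
      linarith
    have h3 := mul_le_mul_of_nonneg_left h2 hσ
    have h4 := mul_le_mul_of_nonneg_left hM1 (show 0 ≤ σ * w ^ 2 by positivity)
    linarith
  have j4 : M * (C * ε * w ^ 2) ≤ M * C ^ 2 * ε * (β ^ 2 + γ ^ 2) := by
    have := mul_le_mul_of_nonneg_left hw1 (show 0 ≤ M * (C * ε) by positivity)
    linarith
  have j5 : C * ε * (ρ * α ^ 2) ≤ θ / 2 * ρ * α ^ 2 := by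
    have := mul_le_mul_of_nonneg_right i1 (show 0 ≤ ρ * α ^ 2 by positivity)
    linarith
  have j6 : C ^ 3 / θ * ε * (β ^ 2 + γ ^ 2) + M * C ^ 2 * ε * (β ^ 2 + γ ^ 2) + C * ε * β ^ 2 ≤
      θ / 4 * β ^ 2 + γ ^ 2 := by
    have e1 := mul_le_mul_of_nonneg_right i2 (sq_nonneg β)
    have e2 := mul_le_mul_of_nonneg_right i3 (sq_nonneg γ)
    have e3 : 0 ≤ C * ε * γ ^ 2 := by positivity
    have e4 : Q * ε * β ^ 2 + Q * ε * γ ^ 2 = C ^ 3 / θ * ε * (β ^ 2 + γ ^ 2)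
      + M * C ^ 2 * ε * (β ^ 2 + γ ^ 2) + C * ε * β ^ 2 + C * ε * γ ^ 2 := by rw [hQ]; ring
    linarith
  have j7 := mul_le_mul_of_nonneg_right hM2 (sq_nonneg γ)
  nlinarith

end Pointwise

/-! ### Integration of the energy inequality over the line -/

section Energy

variable {E G : Type*} [NormedAddCommGroup E] [InnerProductSpace ℂ E]
  [NormedAddCommGroup G] [InnerProductSpace ℂ G]

local notation "⟪" x ", " y "⟫" => inner ℂ x y

theorem integrable_re_inner_clm {C : ℝ} {M : ℝ → G →L[ℂ] E} {f : ℝ → E} {g : ℝ → G}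
    (hM : ∀ x, ‖M x‖ ≤ C) (hc : Continuous fun x => ⟪f x, M x (g x)⟫.re)
    (hf : Integrable fun x => ‖f x‖ ^ 2) (hg : Integrable fun x => ‖g x‖ ^ 2) :
    Integrable fun x => ⟪f x, M x (g x)⟫.re := by
  have hC : 0 ≤ C := (norm_nonneg _).trans (hM 0)
  refine ((hf.add hg).const_mul C).mono' hc.aestronglyMeasurable (Eventually.of_forall fun x => ?_)
  have h := abs_re_inner_clm_le (M x) (f x) (g x) le_rfl (hM x) le_rfl
  rw [Real.norm_eq_abs]
  refine h.trans ?_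
  simp only [Pi.add_apply]
  nlinarith [mul_nonneg hC (sq_nonneg (‖f x‖ - ‖g x‖)), mul_nonneg hC (sq_nonneg (‖f x‖ )),
    mul_nonneg hC (sq_nonneg (‖g x‖))]

/-- Uniform energy estimate: solutions of the integrated eigenvalue system vanish when the
variation of the coefficients is small. -/
theorem energy_vanishing {C m θ c : ℝ} (hC : 1 ≤ C) (hm : 0 < m) (hθ : 0 < θ) (hc : 0 < c) :
    ∃ ε₀ : ℝ, 0 < ε₀ ∧ ∀ (ε : ℝ) (z : ℂ) (ρ : ℝ → ℝ) (U u : ℝ → E) (v s h : ℝ → G)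
      (a N S S' k k' Y' : ℝ → E →L[ℂ] E) (B T T' : ℝ → G →L[ℂ] E) (A₂₁ D : ℝ → E →L[ℂ] G)
      (A₂₂ e : ℝ → G →L[ℂ] G) (p p' w : ℝ → ℝ),
      0 ≤ ε → ε ≤ ε₀ → 0 ≤ z.re →
      (∀ x, 0 ≤ ρ x) → (∀ x, ρ x ≤ C * ε) →
      (∀ x, HasDerivAt U (u x) x) → (∀ x, HasDerivAt h (s x - z • v x) x) →
      (∀ x, HasDerivAt S (S' x) x) → (∀ x, HasDerivAt T (T' x) x) →
      (∀ x, HasDerivAt (fun t => (T t).comp (D t)) (Y' x) x) → (∀ x, HasDerivAt k (k' x) x) →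
      (∀ x, HasDerivAt p (p' x) x) → Integrable p →
      Integrable (fun x => ‖U x‖ ^ 2) → Integrable (fun x => ‖h x‖ ^ 2) →
      (∀ x, z • U x + a x (u x) + B x (s x) = 0) → (∀ x, h x = A₂₁ x (u x) + A₂₂ x (v x)) →
      (∀ x, v x = -D x (u x) + e x (s x)) →
      (∀ x, T x = (N x).comp (B x)) →
      (∀ x y y', ⟪N x y, y'⟫ = ⟪y, N x y'⟫) → (∀ x y y', ⟪S x y, y'⟫ = ⟪y, S x y'⟫) →
      (∀ x y y', ⟪k x y, y'⟫ = -⟪y, k x y'⟫) →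
      (∀ x, ‖a x‖ ≤ C) → (∀ x, ‖B x‖ ≤ C) → (∀ x, ‖T x‖ ≤ C) → (∀ x, ‖k x‖ ≤ C) →
      (∀ x, ‖S x‖ ≤ C) →
      (∀ x, ‖A₂₁ x‖ ≤ C) → (∀ x, ‖A₂₂ x‖ ≤ C) → (∀ x, ‖D x‖ ≤ C) → (∀ x, ‖e x‖ ≤ C) →
      (∀ x, ‖k' x‖ ≤ C * ρ x) → (∀ x, ‖Y' x‖ ≤ C * ρ x) → (∀ x, ‖T' x‖ ≤ C * ρ x) →
      (∀ x, ‖(N x).comp (a x) - S x‖ ≤ C * ρ x) →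
      (∀ x y, m * ‖y‖ ^ 2 ≤ ⟪y, N x y⟫.re) →
      (∀ x y, 2⁻¹ * ⟪y, S' x y⟫.re ≤ -(θ * ρ x * ‖y‖ ^ 2) + C * ε * ρ x * ‖y‖ ^ 2) →
      (∀ x y, θ * ‖y‖ ^ 2 - C * ε * ‖y‖ ^ 2 ≤ ⟪y, ((k x).comp (a x)
        - (T x).comp (A₂₁ x - (A₂₂ x).comp (D x)) - (T x).comp ((D x).comp (a x))) y⟫.re) →
      (∀ x, w x ^ 2 ≤ C * (‖u x‖ ^ 2 + ‖s x‖ ^ 2)) →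
      (∀ x, ‖u x‖ ^ 2 + ‖s x‖ ^ 2 ≤ C * w x ^ 2) →
      (∀ x, p' x ≤ -(m * z.re * w x ^ 2) - c * ‖s x‖ ^ 2 + C * ε * w x ^ 2) →
      ∀ x, u x = 0 ∧ s x = 0 := by
  have hC0 : 0 ≤ C := by linarith
  have hCC : C ≤ 10 * C ^ 4 := by
    have := le_self_pow₀ hC (show 4 ≠ 0 by norm_num)
    nlinarith
  -- The pointwise error bound carries 10C⁴, so absorption is arranged with this constant in place
  -- of C.
  obtain ⟨M, hM, ε₀, hε₀, habs⟩ := energy_absorb (show 1 ≤ 10 * C ^ 4 by linarith) hm hθ hc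
  refine ⟨ε₀, hε₀, ?_⟩
  intro ε z ρ U u v s h a N S S' k k' Y' B T T' A₂₁ D A₂₂ e p p' w hε hεle hz hρ hρε hU hh' hS hT
    hY hk hp hpi hUi hhi h1 hh hv hTN hNs hSs hks ba bB bT bk bS b21 b22 bD be bk' bY' bT' bR hN
    hS' hpos hw1 hw2 hp'
  -- The pieces of the energy: the weighted flux ⟨U, SU⟩, the two viscous correctors ⟨U, TD(zU)⟩ and
  -- ⟨U, Th⟩, and the compensator ⟨zU, kU⟩. The multiple M of p is added to them.
  have d1 := fun x => ((hU x).inner ℂ ((hS x).complexCLM_apply (hU x))).complex_re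
  have d2 := fun x => ((hU x).inner ℂ ((hY x).complexCLM_apply ((hU x).const_smul z))).complex_re
  have d3 := fun x => ((hU x).inner ℂ ((hT x).complexCLM_apply (hh' x))).complex_re
  have d4 := fun x =>
    (((hU x).const_smul z).inner ℂ ((hk x).complexCLM_apply (hU x))).complex_re
  have dP := fun x => (((((d1 x).const_mul 2⁻¹).sub (d2 x)).add (d3 x)).sub
    ((d4 x).const_mul 2⁻¹)).add ((hp x).const_mul M)
  have cont : ∀ {f f' : ℝ → ℝ}, (∀ x, HasDerivAt f (f' x) x) → Continuous f := fun hf =>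
    continuous_iff_continuousAt.2 fun x => (hf x).continuousAt
  have hzUi : Integrable (fun x => ‖z • U x‖ ^ 2) := by
    simp only [norm_smul, mul_pow]
    exact hUi.const_mul _
  have bTD : ∀ x, ‖(T x).comp (D x)‖ ≤ C * C := fun x =>
    ((T x).opNorm_comp_le (D x)).trans (mul_le_mul (bT x) (bD x) (norm_nonneg _) hC0)
  have i1 := integrable_re_inner_clm bS (cont d1) hUi hUi
  have i2 := integrable_re_inner_clm bTD (cont d2) hUi hzUi
  have i3 := integrable_re_inner_clm bT (cont d3) hUi hhi
  have i4 := integrable_re_inner_clm bk (cont d4) hzUi hUi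
  have iP := ((((i1.const_mul 2⁻¹).sub i2).add i3).sub (i4.const_mul 2⁻¹)).add (hpi.const_mul M)
  obtain ⟨P, P', hP, hPi, hP'⟩ : ∃ P P' : ℝ → ℝ, (∀ x, HasDerivAt P (P' x) x) ∧ Integrable P ∧
      ∀ x, P' x ≤ -(θ / 4) * ‖u x‖ ^ 2 - ‖s x‖ ^ 2 := by
    refine ⟨_, _, dP, iP, fun x => ?_⟩
    refine le_trans ?_ (habs ε (ρ x) z.re ‖U x‖ ‖u x‖ ‖s x‖ (w x) hε hεle (hρ x)
      ((hρε x).trans (mul_le_mul_of_nonneg_right hCC hε)) hz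
      ((hw1 x).trans (mul_le_mul_of_nonneg_right hCC (by positivity)))
      ((hw2 x).trans (mul_le_mul_of_nonneg_right hCC (by positivity))))
    have id := energy_identity z (U x) (u x) (v x) (s x) (h x) (a x) (N x) (S x) (S' x) (k x)
      (k' x) (B x) (T x) (T' x) (Y' x) (A₂₁ x) (D x) (A₂₂ x) (e x) (hNs x) (hSs x) (hks x)
      (hTN x) (h1 x) (hh x) (hv x)
    have er := energy_error_le hC (hρ x) z hz (U x) (u x) (v x) (s x) (h x) (a x) (k x)
      (k' x) (Y' x) ((N x).comp (a x) - S x) (B x) (T x) (T' x) (A₂₁ x) (D x) (A₂₂ x) (e x)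
      (h1 x) (hh x) (hv x) (ba x) (bB x) (bT x) (bk x) (b21 x) (b22 x) (bD x) (be x) (bk' x)
      (bY' x) (bT' x) (bR x)
    have g1 := mul_le_mul_of_nonneg_left (hN x (U x)) hz
    have g2 := hS' x (U x)
    have g3 := hpos x (u x)
    have g4 := mul_le_mul_of_nonneg_left (hp' x) hM.le
    have g5 : C * ε * ‖u x‖ ^ 2 + C * ε * ρ x * ‖U x‖ ^ 2 ≤
        10 * C ^ 4 * ε * (‖u x‖ ^ 2 + ρ x * ‖U x‖ ^ 2) := by
      have := mul_le_mul_of_nonneg_right hCC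
        (show 0 ≤ ε * (‖u x‖ ^ 2 + ρ x * ‖U x‖ ^ 2) by have := hρ x; positivity)
      linarith
    have g6 : M * (C * ε * w x ^ 2) ≤ M * (10 * C ^ 4 * ε * w x ^ 2) := by
      have := mul_le_mul_of_nonneg_right hCC (show 0 ≤ ε * w x ^ 2 by positivity)
      have := mul_le_mul_of_nonneg_left this hM.le
      linarith
    simp only [ContinuousLinearMap.comp_apply, Pi.smul_apply] at id er ⊢
    rw [id]
    linarith
  have hPmono : Antitone P := antitone_of_deriv_nonpos (fun x => (hP x).differentiableAt) fun x => by
    rw [(hP x).deriv]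
    nlinarith [hP' x, sq_nonneg ‖u x‖, sq_nonneg ‖s x‖]
  -- An integrable antitone P is identically zero. Its derivative then vanishes, and with it both
  -- nonnegative dissipation terms.
  have hP0 : P = fun _ => 0 := funext fun x => hPmono.eq_zero_of_integrable hPi x
  intro x
  have h0 : P' x = 0 := (hP x).unique (hP0 ▸ hasDerivAt_const x (0 : ℝ))
  have h1 := hP' x
  rw [h0] at h1
  have hu : 0 ≤ θ / 4 * ‖u x‖ ^ 2 := by positivity
  constructor
  · have : θ / 4 * ‖u x‖ ^ 2 = 0 := by nlinarith [sq_nonneg ‖s x‖]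
    simpa [hθ.ne'] using this
  · have : ‖s x‖ ^ 2 = 0 := by nlinarith [sq_nonneg ‖s x‖]
    simpa using this

end Energy

/-- The derivative of `Re ⟨w, S w⟩` for symmetric `S`, when `w` is only continuous but `S w` is
differentiable. -/
theorem hasDerivAt_re_inner_symmetric {X : Type*} [NormedAddCommGroup X] [InnerProductSpace ℂ X]
    {S : ℝ → X →L[ℂ] X} {S' : X →L[ℂ] X} {w : ℝ → X} {g : X} {x : ℝ}
    (hsym : ∀ t y y', inner ℂ (S t y) y' = inner ℂ y (S t y'))
    (hw : ContinuousAt w x) (hS : HasDerivAt S S' x)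
    (hg : HasDerivAt (fun t => S t (w t)) g x) :
    HasDerivAt (fun t => (inner ℂ (w t) (S t (w t))).re)
      (2 * (inner ℂ (w x) g).re - (inner ℂ (w x) (S' (w x))).re) x := by
  rw [hasDerivAt_iff_tendsto_slope] at hS hg ⊢
  have hw' : Tendsto w (𝓝[≠] x) (𝓝 (w x)) := hw.mono_left nhdsWithin_le_nhds
  have hre : ∀ {f : ℝ → ℂ} {a : ℂ}, Tendsto f (𝓝[≠] x) (𝓝 a) →
      Tendsto (fun t => (f t).re) (𝓝[≠] x) (𝓝 a.re) := fun h =>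
    (Complex.continuous_re.tendsto _).comp h
  have happ : Tendsto (fun t => slope S x t (w t)) (𝓝[≠] x) (𝓝 (S' (w x))) :=
    (isBoundedBilinearMap_apply (𝕜 := ℂ)).continuous.tendsto (S', w x) |>.comp
      (hS.prodMk_nhds hw')
  have t1 := hre (hw'.inner (𝕜 := ℂ) hg)
  have t2 := hre (hg.inner (𝕜 := ℂ) (tendsto_const_nhds (x := w x)))
  have t3 := hre (happ.inner (𝕜 := ℂ) (tendsto_const_nhds (x := w x)))
  have hlim := (t1.add t2).sub t3
  have c1 : (inner ℂ g (w x)).re = (inner ℂ (w x) g).re := by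
    rw [← inner_conj_symm (𝕜 := ℂ), Complex.conj_re]
  have c2 : (inner ℂ (S' (w x)) (w x)).re = (inner ℂ (w x) (S' (w x))).re := by
    rw [← inner_conj_symm (𝕜 := ℂ), Complex.conj_re]
  rw [c1, c2, ← two_mul] at hlim
  refine hlim.congr fun t => ?_
  -- A discrete product rule containing increments of S and of Sw but none of w: symmetry of S moves
  -- S onto whichever w is left over.
  have key : (inner ℂ (w t) (S t (w t) - S x (w x))) + (inner ℂ (S t (w t) - S x (w x)) (w x))
      - inner ℂ ((S t - S x) (w t)) (w x) =
      inner ℂ (w t) (S t (w t)) - inner ℂ (w x) (S x (w x)) := by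
    simp only [inner_sub_left, inner_sub_right, sub_apply, hsym]
    ring
  have key' := congrArg Complex.re key
  simp only [Complex.add_re, Complex.sub_re] at key'
  simp only [slope_def_module, ← Complex.coe_smul, smul_apply, inner_smul_left, inner_smul_right,
    Complex.conj_ofReal, Complex.re_ofReal_mul, smul_eq_mul, ← Complex.sub_re]
  simp only [Complex.sub_re]
  rw [← key']
  ring

/-! ### Real matrices acting on real or complex vectors -/

section Mcl

variable (𝕜 : Type*) [RCLike 𝕜] {ι κ μ : Type*} [Fintype ι] [Fintype κ] [Fintype μ]
  [DecidableEq ι] [DecidableEq κ] [DecidableEq μ]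

/-- The continuous linear map of a real matrix over `𝕜 = ℝ` or `ℂ`. -/
noncomputable def mcl (M : Matrix κ ι ℝ) : EuclideanSpace 𝕜 ι →L[𝕜] EuclideanSpace 𝕜 κ :=
  (Matrix.toEuclideanLin (M.map (algebraMap ℝ 𝕜))).toContinuousLinearMap

theorem mcl_apply (M : Matrix κ ι ℝ) (x : EuclideanSpace 𝕜 ι) (i : κ) :
    mcl 𝕜 M x i = ∑ j, algebraMap ℝ 𝕜 (M i j) * x j := rfl

theorem toEuclideanLin_eq_mcl (M : Matrix κ ι ℝ) (x : EuclideanSpace ℝ ι) :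
    Matrix.toEuclideanLin M x = mcl ℝ M x := rfl

theorem mcl_mul (M : Matrix μ κ ℝ) (N : Matrix κ ι ℝ) :
    mcl 𝕜 (M * N) = (mcl 𝕜 M).comp (mcl 𝕜 N) := by
  ext x i
  simp only [mcl_apply, ContinuousLinearMap.comp_apply, Matrix.mul_apply, map_sum, map_mul,
    Finset.sum_mul, Finset.mul_sum]
  rw [Finset.sum_comm]
  simp only [mul_assoc]

theorem mcl_add (M N : Matrix κ ι ℝ) : mcl 𝕜 (M + N) = mcl 𝕜 M + mcl 𝕜 N := by
  ext x i
  simp [mcl_apply, add_mul, Finset.sum_add_distrib]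

theorem mcl_smul (r : ℝ) (M : Matrix κ ι ℝ) : mcl 𝕜 (r • M) = r • mcl 𝕜 M := by
  ext x i
  simp [mcl_apply, Finset.mul_sum, mul_assoc, RCLike.real_smul_eq_coe_mul]

theorem mcl_neg (M : Matrix κ ι ℝ) : mcl 𝕜 (-M) = -mcl 𝕜 M := by
  ext x i
  simp [mcl_apply]

theorem mcl_sub (M N : Matrix κ ι ℝ) : mcl 𝕜 (M - N) = mcl 𝕜 M - mcl 𝕜 N := by
  rw [sub_eq_add_neg, mcl_add, mcl_neg, sub_eq_add_neg]

theorem mcl_one : mcl 𝕜 (1 : Matrix ι ι ℝ) = ContinuousLinearMap.id 𝕜 _ := by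
  ext x i
  simp [mcl_apply, Matrix.one_apply]

/-- `mcl` as a real linear map. -/
noncomputable def mclₗ : Matrix κ ι ℝ →ₗ[ℝ] (EuclideanSpace 𝕜 ι →L[𝕜] EuclideanSpace 𝕜 κ) where
  toFun := mcl 𝕜
  map_add' := mcl_add 𝕜
  map_smul' := mcl_smul 𝕜

/-- The operator is a combination of fixed operators with the entries as coefficients, so regularity
and derivatives of matrix functions can be checked entry by entry. -/
theorem mcl_eq_sum (M : Matrix κ ι ℝ) :
    mcl 𝕜 M = ∑ i, ∑ j, M i j • mcl 𝕜 (Matrix.single i j (1 : ℝ)) := by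
  have h : mclₗ 𝕜 M = mclₗ 𝕜 (∑ i, ∑ j, M i j • Matrix.single i j (1 : ℝ)) := by
    congr 1
    conv_lhs => rw [Matrix.matrix_eq_sum_single M]
    simp
  simp only [map_sum, map_smul] at h
  exact h

theorem inner_mcl_transpose (M : Matrix κ ι ℝ) (x : EuclideanSpace 𝕜 ι)
    (y : EuclideanSpace 𝕜 κ) : inner 𝕜 (mcl 𝕜 M x) y = inner 𝕜 x (mcl 𝕜 M.transpose y) := by
  simp only [PiLp.inner_apply, RCLike.inner_apply, mcl_apply, map_sum, map_mul, Finset.mul_sum,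
    Finset.sum_mul, Matrix.transpose_apply]
  rw [Finset.sum_comm]
  refine Finset.sum_congr rfl fun i _ => Finset.sum_congr rfl fun j _ => ?_
  have h : (starRingEnd 𝕜) (algebraMap ℝ 𝕜 (M j i)) = algebraMap ℝ 𝕜 (M j i) :=
    RCLike.conj_ofReal _
  rw [h]
  ring

theorem inner_mcl_of_isSymm {M : Matrix ι ι ℝ} (hM : M.IsSymm) (x y : EuclideanSpace 𝕜 ι) :
    inner 𝕜 (mcl 𝕜 M x) y = inner 𝕜 x (mcl 𝕜 M y) := by
  rw [inner_mcl_transpose, hM.eq]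

theorem inner_mcl_of_skew {M : Matrix ι ι ℝ} (hM : M.transpose = -M) (x y : EuclideanSpace 𝕜 ι) :
    inner 𝕜 (mcl 𝕜 M x) y = -inner 𝕜 x (mcl 𝕜 M y) := by
  rw [inner_mcl_transpose, hM, mcl_neg, neg_apply, inner_neg_right]

/-- The real part of a complex vector. -/
def reVec (x : EuclideanSpace ℂ ι) : EuclideanSpace ℝ ι := WithLp.toLp 2 fun i => (x i).re

/-- The imaginary part of a complex vector. -/
def imVec (x : EuclideanSpace ℂ ι) : EuclideanSpace ℝ ι := WithLp.toLp 2 fun i => (x i).im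

theorem reVec_mcl (M : Matrix κ ι ℝ) (x : EuclideanSpace ℂ ι) :
    reVec (mcl ℂ M x) = mcl ℝ M (reVec x) := by
  ext i
  simp [reVec, mcl_apply]

theorem imVec_mcl (M : Matrix κ ι ℝ) (x : EuclideanSpace ℂ ι) :
    imVec (mcl ℂ M x) = mcl ℝ M (imVec x) := by
  ext i
  simp [imVec, mcl_apply]

theorem re_inner_eq (x y : EuclideanSpace ℂ ι) :
    (inner ℂ x y).re = inner ℝ (reVec x) (reVec y) + inner ℝ (imVec x) (imVec y) := by
  simp only [PiLp.inner_apply, RCLike.inner_apply, reVec, imVec, Complex.re_sum,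
    ← Finset.sum_add_distrib]
  refine Finset.sum_congr rfl fun i _ => ?_
  simp [Complex.mul_re]

theorem norm_sq_eq_reVec_imVec (x : EuclideanSpace ℂ ι) :
    ‖x‖ ^ 2 = ‖reVec x‖ ^ 2 + ‖imVec x‖ ^ 2 := by
  rw [← real_inner_self_eq_norm_sq (reVec x), ← real_inner_self_eq_norm_sq (imVec x),
    ← re_inner_eq, ← inner_self_eq_norm_sq (𝕜 := ℂ)]
  rfl

/-- A real matrix acts separately on real and imaginary parts. Inequalities between real quadratic
forms thereby extend to complex vectors. -/
theorem re_inner_mcl (M : Matrix ι ι ℝ) (x : EuclideanSpace ℂ ι) :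
    (inner ℂ x (mcl ℂ M x)).re =
      inner ℝ (reVec x) (mcl ℝ M (reVec x)) + inner ℝ (imVec x) (mcl ℝ M (imVec x)) := by
  rw [re_inner_eq, reVec_mcl, imVec_mcl]

theorem norm_sq_mcl (M : Matrix κ ι ℝ) (x : EuclideanSpace ℂ ι) :
    ‖mcl ℂ M x‖ ^ 2 = ‖mcl ℝ M (reVec x)‖ ^ 2 + ‖mcl ℝ M (imVec x)‖ ^ 2 := by
  rw [norm_sq_eq_reVec_imVec, reVec_mcl, imVec_mcl]

theorem inner_mcl_symPart (M : Matrix ι ι ℝ) (x : EuclideanSpace ℝ ι) :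
    inner ℝ x (mcl ℝ (symPart M) x) = inner ℝ x (mcl ℝ M x) := by
  rw [symPart, mcl_smul, mcl_add, smul_apply, add_apply, inner_smul_right,
    inner_add_right, ← inner_mcl_transpose, real_inner_comm]
  ring

theorem inner_mcl_pos {M : Matrix ι ι ℝ} (hM : M.PosDef) {x : EuclideanSpace ℝ ι} (hx : x ≠ 0) :
    0 < inner ℝ x (mcl ℝ M x) := by
  have h := hM.dotProduct_mulVec_pos (x := x.ofLp) (fun h => hx (by ext i; exact congrFun h i))
  have e : inner ℝ x (mcl ℝ M x) = dotProduct (star x.ofLp) (M.mulVec x.ofLp) := by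
    simp only [PiLp.inner_apply, RCLike.inner_apply, mcl_apply, dotProduct, Matrix.mulVec]
    simp [mul_comm]
  rw [e]
  exact h

theorem mcl_fromBlocks_inl {ι' κ' : Type*} [Fintype ι'] [Fintype κ'] [DecidableEq ι']
    (M : Matrix (κ ⊕ κ') (ι ⊕ ι') ℝ) (x : EuclideanSpace 𝕜 (ι ⊕ ι')) (i : κ) :
    mcl 𝕜 M x (Sum.inl i) = mcl 𝕜 M.toBlocks₁₁ (WithLp.toLp 2 fun j => x (Sum.inl j)) i +
      mcl 𝕜 M.toBlocks₁₂ (WithLp.toLp 2 fun j => x (Sum.inr j)) i := by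
  simp [mcl_apply, Fintype.sum_sum_type, Matrix.toBlocks₁₁, Matrix.toBlocks₁₂]

theorem mcl_fromBlocks_inr {ι' κ' : Type*} [Fintype ι'] [Fintype κ'] [DecidableEq ι']
    (M : Matrix (κ ⊕ κ') (ι ⊕ ι') ℝ) (x : EuclideanSpace 𝕜 (ι ⊕ ι')) (i : κ') :
    mcl 𝕜 M x (Sum.inr i) = mcl 𝕜 M.toBlocks₂₁ (WithLp.toLp 2 fun j => x (Sum.inl j)) i +
      mcl 𝕜 M.toBlocks₂₂ (WithLp.toLp 2 fun j => x (Sum.inr j)) i := by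
  simp [mcl_apply, Fintype.sum_sum_type, Matrix.toBlocks₂₁, Matrix.toBlocks₂₂]

end Mcl

/-! ### Matrix functions with regular entries -/

/-- Entrywise `C¹` matrix functions. -/
def C1MatrixOn {X ι κ : Type*} [NormedAddCommGroup X] [NormedSpace ℝ X]
    (A : X → Matrix κ ι ℝ) (s : Set X) : Prop :=
  ∀ i j, ContDiffOn ℝ 1 (fun w => A w i j) s

namespace C1MatrixOn

variable {X Z ι κ μ : Type*} [NormedAddCommGroup X] [NormedSpace ℝ X] [NormedAddCommGroup Z]
  [NormedSpace ℝ Z] {A B : X → Matrix κ ι ℝ} {s : Set X}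

theorem of_smooth (h : SmoothMatrixOn A s) : C1MatrixOn A s := fun i j =>
  (h i j).of_le (by exact_mod_cast le_top)

theorem add (hA : C1MatrixOn A s) (hB : C1MatrixOn B s) : C1MatrixOn (fun w => A w + B w) s :=
  fun i j => (hA i j).add (hB i j)

theorem sub (hA : C1MatrixOn A s) (hB : C1MatrixOn B s) : C1MatrixOn (fun w => A w - B w) s :=
  fun i j => (hA i j).sub (hB i j)

theorem mul [Fintype κ] {A : X → Matrix μ κ ℝ} (hA : C1MatrixOn A s) (hB : C1MatrixOn B s) :
    C1MatrixOn (fun w => A w * B w) s := fun i j => by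
  simp only [Matrix.mul_apply]
  exact ContDiffOn.sum fun k _ => (hA i k).mul (hB k j)

theorem comp {f : Z → X} {t : Set Z} (hA : C1MatrixOn A s) (hf : ContDiffOn ℝ 1 f t)
    (h : MapsTo f t s) : C1MatrixOn (fun z => A (f z)) t := fun i j => (hA i j).comp hf h

theorem mono {t : Set X} (hA : C1MatrixOn A s) (h : t ⊆ s) : C1MatrixOn A t :=
  fun i j => (hA i j).mono h

theorem congr (hA : C1MatrixOn A s) (h : ∀ w ∈ s, B w = A w) : C1MatrixOn B s :=
  fun i j => (hA i j).congr fun w hw => by rw [h w hw]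

theorem det [Fintype ι] [DecidableEq ι] {A : X → Matrix ι ι ℝ} (hA : C1MatrixOn A s) :
    ContDiffOn ℝ 1 (fun w => (A w).det) s := by
  simp only [Matrix.det_apply]
  exact ContDiffOn.sum fun σ _ => (contDiffOn_prod fun i _ => hA _ _).const_smul _

theorem inv [Fintype ι] [DecidableEq ι] {A : X → Matrix ι ι ℝ} (hA : C1MatrixOn A s)
    (h : ∀ w ∈ s, (A w).det ≠ 0) : C1MatrixOn (fun w => (A w)⁻¹) s := fun i j => by
  simp only [Matrix.inv_def, Matrix.smul_apply, Matrix.adjugate_apply, Ring.inverse_eq_inv',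
    smul_eq_mul]
  refine (hA.det.inv h).mul (C1MatrixOn.det (A := fun w => (A w).updateRow j (Pi.single i 1))
    fun k l => ?_)
  by_cases hk : k = j
  · subst hk
    simp only [Matrix.updateRow_self]
    exact contDiffOn_const
  · simp only [Matrix.updateRow_ne hk]
    exact hA k l

theorem contDiffOn_mcl (𝕜 : Type*) [RCLike 𝕜] [Fintype ι] [Fintype κ] [DecidableEq ι] [DecidableEq κ]
    (hA : C1MatrixOn A s) : ContDiffOn ℝ 1 (fun w => mcl 𝕜 (A w)) s := by
  simp only [mcl_eq_sum 𝕜 (A _)]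
  exact ContDiffOn.sum fun i _ => ContDiffOn.sum fun j _ => (hA i j).smul contDiffOn_const

end C1MatrixOn

/-! ### Compactness lemmas -/

/-- K need not be convex, so the Lipschitz constant comes from local Lipschitz continuity and
compactness and not from the bound on the derivative. -/
theorem ContDiffOn.exists_bounds_of_isCompact {X Y : Type*} [NormedAddCommGroup X]
    [NormedSpace ℝ X] [NormedAddCommGroup Y] [NormedSpace ℝ Y] {m : X → Y} {s K : Set X}
    (hm : ContDiffOn ℝ 1 m s) (hs : IsOpen s) (hK : IsCompact K) (hKs : K ⊆ s) :
    ∃ C : ℝ, 0 ≤ C ∧ (∀ w ∈ K, ‖m w‖ ≤ C) ∧ (∀ w ∈ K, ‖fderiv ℝ m w‖ ≤ C) ∧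
      ∀ w ∈ K, ∀ w' ∈ K, ‖m w - m w'‖ ≤ C * ‖w - w'‖ := by
  obtain ⟨C₁, h₁⟩ := hK.exists_bound_of_continuousOn (hm.continuousOn.mono hKs)
  obtain ⟨C₂, h₂⟩ := hK.exists_bound_of_continuousOn
    ((hm.continuousOn_fderiv_of_isOpen hs le_rfl).mono hKs)
  obtain ⟨C₃, h₃⟩ : ∃ C, LipschitzOnWith C m K := by
    refine LocallyLipschitzOn.exists_lipschitzOnWith_of_compact hK fun x hx => ?_
    obtain ⟨C, t, ht, h⟩ := (hm.contDiffAt (hs.mem_nhds (hKs hx))).exists_lipschitzOnWith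
    exact ⟨C, t, mem_nhdsWithin_of_mem_nhds ht, h⟩
  refine ⟨max (max C₁ C₂) C₃, le_max_of_le_right C₃.2, fun w hw => ?_, fun w hw => ?_,
    fun w hw w' hw' => ?_⟩
  · exact (h₁ w hw).trans ((le_max_left _ _).trans (le_max_left _ _))
  · exact (h₂ w hw).trans ((le_max_right _ _).trans (le_max_left _ _))
  · have := h₃.dist_le_mul w hw w' hw'
    rw [dist_eq_norm, dist_eq_norm] at this
    exact this.trans (mul_le_mul_of_nonneg_right (le_max_right _ _) (norm_nonneg _))

/-- On the compact part of K where f₀ ≤ 0 the function f₁ is at least some μ > 0. With |f₀| ≤ B, the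
choice L = (|B| + 1)/μ makes the sum at least 1 there; elsewhere f₀ > 0 suffices for positivity. -/
theorem IsCompact.exists_add_mul_ge {X : Type*} [TopologicalSpace X] {K : Set X}
    (hK : IsCompact K) {f₀ f₁ : X → ℝ} (h₀ : ContinuousOn f₀ K) (h₁ : ContinuousOn f₁ K)
    (hpos : ∀ x ∈ K, 0 ≤ f₁ x) (hzero : ∀ x ∈ K, f₁ x = 0 → 0 < f₀ x) :
    ∃ L θ : ℝ, 0 < L ∧ 0 < θ ∧ ∀ x ∈ K, θ ≤ f₀ x + L * f₁ x := by
  have hK0 : IsCompact (K ∩ f₀ ⁻¹' Iic 0) := by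
    obtain ⟨t, ht, h⟩ := continuousOn_iff_isClosed.1 h₀ (Iic 0) isClosed_Iic
    rw [inter_comm, h, inter_comm]
    exact hK.inter_right ht
  obtain ⟨μ, hμ, hμ'⟩ := hK0.exists_forall_le' (h₁.mono inter_subset_left) (a := 0)
    fun x hx => lt_of_le_of_ne (hpos x hx.1) fun h =>
      absurd (hzero x hx.1 h.symm) (not_lt.2 hx.2)
  obtain ⟨B, hB⟩ := hK.exists_bound_of_continuousOn h₀
  set L := (|B| + 1) / μ with hL
  have hL0 : 0 < L := by positivity
  obtain ⟨θ, hθ, hθ'⟩ := hK.exists_forall_le' (h₀.add (h₁.const_mul L)) (a := 0) fun x hx => by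
    by_cases hx0 : f₀ x ≤ 0
    · have h1 := mul_le_mul_of_nonneg_left (hμ' x ⟨hx, hx0⟩) hL0.le
      have h2 : L * μ = |B| + 1 := div_mul_cancel₀ _ hμ.ne'
      have h3 := (abs_le.1 (hB x hx)).1
      have h4 := le_abs_self B
      simp only [Pi.add_apply]
      linarith
    · have := mul_nonneg hL0.le (hpos x hx)
      simp only [Pi.add_apply]
      push Not at hx0
      linarith
  exact ⟨L, θ, hL0, hθ, hθ'⟩

theorem quadratic_ge_of_sphere {E : Type*} [NormedAddCommGroup E] [InnerProductSpace ℝ E]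
    {M : E →L[ℝ] E} {θ : ℝ} (h : ∀ x, ‖x‖ = 1 → θ ≤ inner ℝ x (M x)) (x : E) :
    θ * ‖x‖ ^ 2 ≤ inner ℝ x (M x) := by
  rcases eq_or_ne x 0 with rfl | hx
  · simp
  · have hn : ‖x‖ ≠ 0 := norm_ne_zero_iff.2 hx
    have h1 := h (‖x‖⁻¹ • x) (by rw [norm_smul, norm_inv, norm_norm, inv_mul_cancel₀ hn])
    rw [map_smul, inner_smul_left, inner_smul_right] at h1
    have h2 := mul_le_mul_of_nonneg_right h1 (sq_nonneg ‖x‖)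
    refine h2.trans_eq ?_
    simp only [conj_trivial]
    field_simp

/-! ### Definiteness and derivatives of matrix functions on compact sets -/

section MatrixFunctions

variable {ι κ : Type*} [Fintype ι] [Fintype κ] [DecidableEq ι] [DecidableEq κ]

theorem continuousOn_mcl {X : Type*} [TopologicalSpace X] (𝕜 : Type*) [RCLike 𝕜]
    {A : X → Matrix κ ι ℝ} {s : Set X} (h : ∀ i j, ContinuousOn (fun w => A w i j) s) :
    ContinuousOn (fun w => mcl 𝕜 (A w)) s := by
  simp only [mcl_eq_sum 𝕜 (A _)]
  exact continuousOn_finsetSum _ fun i _ => continuousOn_finsetSum _ fun j _ =>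
    (h i j).smul continuousOn_const

theorem exists_forall_mul_norm_sq_le_real {X : Type*} [TopologicalSpace X] {K : Set X}
    (hK : IsCompact K) {M : X → Matrix ι ι ℝ} (hM : ∀ i j, ContinuousOn (fun w => M w i j) K)
    (hpos : ∀ w ∈ K, (symPart (M w)).PosDef) :
    ∃ θ : ℝ, 0 < θ ∧ ∀ w ∈ K, ∀ x : EuclideanSpace ℝ ι,
      θ * ‖x‖ ^ 2 ≤ inner ℝ x (mcl ℝ (M w) x) := by
  have hc : ContinuousOn (fun p : X × EuclideanSpace ℝ ι => inner ℝ p.2 (mcl ℝ (M p.1) p.2))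
      (K ×ˢ Metric.sphere 0 1) := by
    have h1 : ContinuousOn (fun p : X × EuclideanSpace ℝ ι => mcl ℝ (M p.1))
        (K ×ˢ Metric.sphere 0 1) :=
      (continuousOn_mcl ℝ hM).comp continuousOn_fst fun p hp => hp.1
    exact continuousOn_snd.inner (𝕜 := ℝ) (h1.clm_apply continuousOn_snd)
  obtain ⟨θ, hθ, h⟩ := (hK.prod (isCompact_sphere (0 : EuclideanSpace ℝ ι) 1)).exists_forall_le'
    hc (a := 0) fun p hp => by
      rw [← inner_mcl_symPart]
      refine inner_mcl_pos (hpos _ hp.1) fun h0 => ?_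
      have := hp.2
      rw [h0] at this
      simp at this
  exact ⟨θ, hθ, fun w hw => quadratic_ge_of_sphere fun x hx => h (w, x) ⟨hw, by simpa using hx⟩⟩

theorem exists_forall_mul_norm_sq_le {X : Type*} [TopologicalSpace X] {K : Set X}
    (hK : IsCompact K) {M : X → Matrix ι ι ℝ} (hM : ∀ i j, ContinuousOn (fun w => M w i j) K)
    (hpos : ∀ w ∈ K, (symPart (M w)).PosDef) :
    ∃ θ : ℝ, 0 < θ ∧ ∀ w ∈ K, ∀ x : EuclideanSpace ℂ ι,
      θ * ‖x‖ ^ 2 ≤ (inner ℂ x (mcl ℂ (M w) x)).re := by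
  obtain ⟨θ, hθ, h⟩ := exists_forall_mul_norm_sq_le_real hK hM hpos
  refine ⟨θ, hθ, fun w hw x => ?_⟩
  rw [re_inner_mcl, norm_sq_eq_reVec_imVec, mul_add]
  exact add_le_add (h w hw _) (h w hw _)

theorem symPart_posDef {M : Matrix ι ι ℝ} (hM : M.PosDef) : (symPart M).PosDef := by
  have h := hM.isHermitian
  rw [Matrix.IsHermitian, Matrix.conjTranspose_eq_transpose_of_trivial] at h
  rwa [symPart, h, ← two_smul ℝ M, smul_smul, one_div, inv_mul_cancel₀ two_ne_zero, one_smul]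

/-- The entrywise directional derivative of a matrix function. -/
noncomputable def dirMatrix {X : Type*} [NormedAddCommGroup X] [NormedSpace ℝ X]
    (G : X → Matrix κ ι ℝ) (u e : X) : Matrix κ ι ℝ :=
  Matrix.of fun i j => fderiv ℝ (fun w => G w i j) u e

section Dir

variable {X : Type*} [NormedAddCommGroup X] [NormedSpace ℝ X] {G : X → Matrix κ ι ℝ} {s : Set X}

theorem C1MatrixOn.hasDerivAt_mcl (𝕜 : Type*) [RCLike 𝕜] (hG : C1MatrixOn G s) (hs : IsOpen s)
    {U : ℝ → X} {U' : X} {x : ℝ} (hU : HasDerivAt U U' x) (hx : U x ∈ s) :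
    HasDerivAt (fun t => mcl 𝕜 (G (U t))) (mcl 𝕜 (dirMatrix G (U x) U')) x := by
  simp only [mcl_eq_sum 𝕜 (G _)]
  rw [mcl_eq_sum 𝕜 (dirMatrix G (U x) U')]
  refine HasDerivAt.fun_sum fun i _ => HasDerivAt.fun_sum fun j _ => ?_
  have h : HasDerivAt (fun t => G (U t) i j) (dirMatrix G (U x) U' i j) x :=
    (((hG i j).contDiffAt (hs.mem_nhds hx)).differentiableAt
      one_ne_zero).hasFDerivAt.comp_hasDerivAt x hU
  exact h.smul_const (mcl 𝕜 (Matrix.single i j (1 : ℝ)))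

theorem C1MatrixOn.fderiv_mcl (𝕜 : Type*) [RCLike 𝕜] (hG : C1MatrixOn G s) (hs : IsOpen s)
    {u : X} (hu : u ∈ s) (e : X) :
    fderiv ℝ (fun w => mcl 𝕜 (G w)) u e = mcl 𝕜 (dirMatrix G u e) := by
  have hl : HasDerivAt (fun t : ℝ => u + t • e) e 0 := by
    simpa using ((hasDerivAt_id (0 : ℝ)).smul_const e).const_add u
  have hu0 : u + (0 : ℝ) • e = u := by simp
  have h1 := hG.hasDerivAt_mcl 𝕜 hs hl (by rwa [hu0])
  have hd : DifferentiableAt ℝ (fun w => mcl 𝕜 (G w)) (u + (0 : ℝ) • e) := by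
    rw [hu0]
    exact ((hG.contDiffOn_mcl 𝕜).contDiffAt (hs.mem_nhds hu)).differentiableAt one_ne_zero
  have h2 := hd.hasFDerivAt.comp_hasDerivAt 0 hl
  have h3 := h1.unique h2
  rw [hu0] at h3
  exact h3.symm

theorem C1MatrixOn.exists_bounds (𝕜 : Type*) [RCLike 𝕜] (hG : C1MatrixOn G s) (hs : IsOpen s)
    {K : Set X} (hK : IsCompact K) (hKs : K ⊆ s) :
    ∃ C : ℝ, 0 ≤ C ∧ (∀ w ∈ K, ‖mcl 𝕜 (G w)‖ ≤ C) ∧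
      (∀ w ∈ K, ∀ e, ‖mcl 𝕜 (dirMatrix G w e)‖ ≤ C * ‖e‖) ∧
      ∀ w ∈ K, ∀ w' ∈ K, ‖mcl 𝕜 (G w) - mcl 𝕜 (G w')‖ ≤ C * ‖w - w'‖ := by
  obtain ⟨C, hC, h1, h2, h3⟩ := (hG.contDiffOn_mcl 𝕜).exists_bounds_of_isCompact hs hK hKs
  refine ⟨C, hC, h1, fun w hw e => ?_, h3⟩
  rw [← hG.fderiv_mcl 𝕜 hs (hKs hw)]
  exact ContinuousLinearMap.le_of_opNorm_le _ (h2 w hw) e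

theorem C1MatrixOn.continuousOn_dirMatrix (hG : C1MatrixOn G s) (hs : IsOpen s) (i : κ) (j : ι) :
    ContinuousOn (fun p : X × X => dirMatrix G p.1 p.2 i j) (s ×ˢ univ) :=
  (((hG i j).continuousOn_fderiv_of_isOpen hs le_rfl).comp continuousOn_fst
    fun _ hp => hp.1).clm_apply continuousOn_snd

theorem dirMatrix_neg (u e : X) : dirMatrix G u (-e) = -dirMatrix G u e := by
  ext i j; simp [dirMatrix]

theorem dirMatrix_add (u e e' : X) :
    dirMatrix G u (e + e') = dirMatrix G u e + dirMatrix G u e' := by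
  ext i j; simp [dirMatrix]

theorem dirMatrix_smul (u e : X) (t : ℝ) :
    dirMatrix G u (t • e) = t • dirMatrix G u e := by
  ext i j; simp [dirMatrix]

end Dir

/-- A simple eigenvalue of a real matrix has only one unit eigenvector up to sign. -/
theorem eq_or_eq_neg_of_rootMultiplicity_eq_one {J : Matrix ι ι ℝ} {α : ℝ}
    (hα : J.charpoly.rootMultiplicity α = 1) {r r' : EuclideanSpace ℝ ι}
    (hr : mcl ℝ J r = α • r) (hr' : mcl ℝ J r' = α • r') (hn : ‖r‖ = 1) (hn' : ‖r'‖ = 1) :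
    r' = r ∨ r' = -r := by
  -- Geometric multiplicity is at most algebraic multiplicity, so the eigenspace is at most a line.
  have hle := LinearMap.finrank_eigenspace_le (Matrix.toLin' J) α
  rw [Matrix.charpoly_toLin', hα] at hle
  have hmem : ∀ {y : EuclideanSpace ℝ ι}, mcl ℝ J y = α • y →
      y.ofLp ∈ Module.End.eigenspace (Matrix.toLin' J) α := by
    intro y hy
    rw [Module.End.mem_eigenspace_iff]
    exact congrArg WithLp.ofLp hy
  rw [finrank_le_one_iff] at hle
  obtain ⟨v, hv⟩ := hle
  obtain ⟨a, ha⟩ := hv ⟨_, hmem hr⟩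
  obtain ⟨b, hb⟩ := hv ⟨_, hmem hr'⟩
  have ha' : a • (v : ι → ℝ) = r.ofLp := congrArg Subtype.val ha
  have hb' : b • (v : ι → ℝ) = r'.ofLp := congrArg Subtype.val hb
  have ha0 : a ≠ 0 := by
    rintro rfl
    rw [zero_smul] at ha'
    have : r = 0 := by ext i; exact (congrFun ha' i).symm
    simp [this] at hn
  have hrr : r' = (b / a) • r := by
    ext i
    have h1 := congrFun ha' i
    have h2 := congrFun hb' i
    simp only [Pi.smul_apply, smul_eq_mul] at h1 h2
    simp only [PiLp.smul_apply, smul_eq_mul]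
    rw [← h1, ← h2]
    field_simp
  have hba : |b / a| = 1 := by
    rw [hrr, norm_smul, hn, mul_one] at hn'
    exact hn'
  rcases abs_eq (by norm_num : (0 : ℝ) ≤ 1) |>.1 hba with h | h
  · left; rw [hrr, h, one_smul]
  · right; rw [hrr, h, neg_one_smul]

end MatrixFunctions

/-! ### The principal characteristic field -/

/-- A matrix field `J`, symmetrized by `a₀`, with a simple genuinely nonlinear eigenvalue `α₀`. -/
structure SymmetrizableField {n : ℕ} (𝒰 : Set (EuclideanSpace ℝ (Fin n)))
    (J a₀ : EuclideanSpace ℝ (Fin n) → Matrix (Fin n) (Fin n) ℝ)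
    (α₀ : EuclideanSpace ℝ (Fin n) → ℝ)
    (r₀ : EuclideanSpace ℝ (Fin n) → EuclideanSpace ℝ (Fin n)) : Prop where
  isOpen : IsOpen 𝒰
  c1_J : C1MatrixOn J 𝒰
  c1_a : C1MatrixOn a₀ 𝒰
  posDef : ∀ u ∈ 𝒰, (a₀ u).PosDef
  symm : ∀ u ∈ 𝒰, (a₀ u * J u).IsSymm
  simple : ∀ u ∈ 𝒰, (J u).charpoly.rootMultiplicity (α₀ u) = 1
  unit : ∀ u ∈ 𝒰, ‖r₀ u‖ = 1
  eigen : ∀ u ∈ 𝒰, mcl ℝ (J u) (r₀ u) = α₀ u • r₀ u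
  gnl : ∀ u ∈ 𝒰, gnlCoeff α₀ r₀ u ≠ 0

theorem Filter.Tendsto.apply_clm {𝕜 E G : Type*} [RCLike 𝕜] [NormedAddCommGroup E]
    [NormedSpace 𝕜 E] [NormedAddCommGroup G] [NormedSpace 𝕜 G] {T : Type*} {l : Filter T}
    {S : T → E →L[𝕜] G} {S₀ : E →L[𝕜] G} {f : T → E} {f₀ : E} (hS : Tendsto S l (𝓝 S₀))
    (hf : Tendsto f l (𝓝 f₀)) : Tendsto (fun t => S t (f t)) l (𝓝 (S₀ f₀)) :=
  ((isBoundedBilinearMap_apply (𝕜 := 𝕜)).continuous.tendsto (S₀, f₀)).comp (hS.prodMk_nhds hf)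

namespace SymmetrizableField

variable {n : ℕ} {𝒰 : Set (EuclideanSpace ℝ (Fin n))}
  {J a₀ : EuclideanSpace ℝ (Fin n) → Matrix (Fin n) (Fin n) ℝ}
  {α₀ : EuclideanSpace ℝ (Fin n) → ℝ} {r₀ : EuclideanSpace ℝ (Fin n) → EuclideanSpace ℝ (Fin n)}

local notation "⟪" x ", " y "⟫" => inner ℝ x y

theorem c1_aJ (h : SymmetrizableField 𝒰 J a₀ α₀ r₀) :
    C1MatrixOn (fun u => a₀ u * J u) 𝒰 := h.c1_a.mul h.c1_J

/-- `fderiv` is zero wherever the derivative does not exist, so a nonzero genuine nonlinearity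
coefficient already contains differentiability of α₀. -/
theorem differentiableAt (h : SymmetrizableField 𝒰 J a₀ α₀ r₀) {u} (hu : u ∈ 𝒰) :
    DifferentiableAt ℝ α₀ u := by
  by_contra hd
  refine h.gnl u hu ?_
  rw [gnlCoeff, fderiv_zero_of_not_differentiableAt hd, zero_apply]

theorem inner_pos (h : SymmetrizableField 𝒰 J a₀ α₀ r₀) {u} (hu : u ∈ 𝒰)
    {r : EuclideanSpace ℝ (Fin n)} (hr : ‖r‖ = 1) : 0 < ⟪r, mcl ℝ (a₀ u) r⟫ :=
  inner_mcl_pos (h.posDef u hu) fun h0 => by simp [h0] at hr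

/-- The derivative of the eigenvalue in terms of the derivative of the symmetrized matrix. -/
theorem fderiv_mul_inner (h : SymmetrizableField 𝒰 J a₀ α₀ r₀) {u} (hu : u ∈ 𝒰)
    {r : EuclideanSpace ℝ (Fin n)} (hr : ‖r‖ = 1) (hJr : mcl ℝ (J u) r = α₀ u • r)
    (e : EuclideanSpace ℝ (Fin n)) :
    ⟪r, mcl ℝ (dirMatrix (fun u => a₀ u * J u) u e) r⟫ - α₀ u * ⟪r, mcl ℝ (dirMatrix a₀ u e) r⟫ =
      fderiv ℝ α₀ u e * ⟪r, mcl ℝ (a₀ u) r⟫ := by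
  have hl : HasDerivAt (fun t : ℝ => u + t • e) e 0 := by
    simpa using ((hasDerivAt_id (0 : ℝ)).smul_const e).const_add u
  have hu0 : u + (0 : ℝ) • e = u := by simp
  have hu0' : u + (0 : ℝ) • e ∈ 𝒰 := by rwa [hu0]
  -- The eigenvector r₀ may be discontinuous and jump in sign. Along an ultrafilter the vectors r₀(u
  -- + te) nevertheless converge, by compactness of the unit sphere.
  let F : Ultrafilter ℝ := Ultrafilter.of (𝓝[≠] (0 : ℝ))
  have hF : (F : Filter ℝ) ≤ 𝓝[≠] (0 : ℝ) := Ultrafilter.of_le _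
  have hF0 : (F : Filter ℝ) ≤ 𝓝 (0 : ℝ) := hF.trans nhdsWithin_le_nhds
  have hmem : ∀ᶠ t in (F : Filter ℝ), u + t • e ∈ 𝒰 :=
    hF0 (hl.continuousAt.preimage_mem_nhds (h.isOpen.mem_nhds hu0'))
  have hne : ∀ᶠ t in (F : Filter ℝ), t ≠ 0 := hF self_mem_nhdsWithin
  obtain ⟨r', hr', hlim⟩ := isCompact_iff_ultrafilter_le_nhds.1
    (isCompact_sphere (0 : EuclideanSpace ℝ (Fin n)) 1) (F.map fun t => r₀ (u + t • e))
    (le_principal_iff.2 (hmem.mono fun t ht => by simpa using h.unit _ ht))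
  have hrt : Tendsto (fun t => r₀ (u + t • e)) (F : Filter ℝ) (𝓝 r') := hlim
  have dα : HasDerivAt (fun t : ℝ => α₀ (u + t • e)) (fderiv ℝ α₀ u e) 0 := by
    have := (hu0.symm ▸ h.differentiableAt hu :
      DifferentiableAt ℝ α₀ (u + (0 : ℝ) • e)).hasFDerivAt.comp_hasDerivAt 0 hl
    rwa [hu0] at this
  have dG := h.c1_aJ.hasDerivAt_mcl ℝ h.isOpen hl hu0'
  have da := h.c1_a.hasDerivAt_mcl ℝ h.isOpen hl hu0'
  have dJ := h.c1_J.hasDerivAt_mcl ℝ h.isOpen hl hu0'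
  have cα := dα.continuousAt.tendsto.mono_left hF0
  have cJ := dJ.continuousAt.tendsto.mono_left hF0
  rw [hu0] at dG da cα cJ
  have hJr' : mcl ℝ (J u) r' = α₀ u • r' := by
    refine tendsto_nhds_unique (cJ.apply_clm hrt) ((cα.smul hrt).congr' ?_)
    filter_upwards [hmem] with t ht
    exact (h.eigen _ ht).symm
  have sα := (hasDerivAt_iff_tendsto_slope.1 dα).mono_left hF
  have sG := (hasDerivAt_iff_tendsto_slope.1 dG).mono_left hF
  have sa := (hasDerivAt_iff_tendsto_slope.1 da).mono_left hF
  have cr : Tendsto (fun _ : ℝ => r) (F : Filter ℝ) (𝓝 r) := tendsto_const_nhds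
  have l1 := cr.inner (𝕜 := ℝ) (sG.apply_clm hrt)
  have l2 := (cα.mul (cr.inner (𝕜 := ℝ) (sa.apply_clm hrt))).add
    (sα.mul (cr.inner (𝕜 := ℝ) ((tendsto_const_nhds (x := mcl ℝ (a₀ u))).apply_clm hrt)))
  -- By simplicity the limit r' is r or -r. The limiting identity is linear in r', so the sign does
  -- not matter.
  have key := tendsto_nhds_unique l1 (l2.congr' ?_)
  · rcases eq_or_eq_neg_of_rootMultiplicity_eq_one (h.simple u hu) hJr hJr' hr
      (by simpa using hr') with rfl | rfl
    · linarith
    · simp only [map_neg, inner_neg_right] at key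
      linarith
  · filter_upwards [hmem, hne] with t ht ht0
    -- The increment of a₀J is paired with the fixed r on the left and the moving eigenvector on the
    -- right. The eigenvalue equation of the latter is used at u + te, and that of r, moved across
    -- by symmetry, at u. No derivative of an eigenvector appears.
    have e1 : mcl ℝ (a₀ (u + t • e) * J (u + t • e)) (r₀ (u + t • e)) =
        α₀ (u + t • e) • mcl ℝ (a₀ (u + t • e)) (r₀ (u + t • e)) := by
      rw [mcl_mul, ContinuousLinearMap.comp_apply, h.eigen _ ht, map_smul]
    have e2 : ⟪r, mcl ℝ (a₀ u * J u) (r₀ (u + t • e))⟫ =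
        α₀ u * ⟪r, mcl ℝ (a₀ u) (r₀ (u + t • e))⟫ := by
      have hsa : (a₀ u).IsSymm := by
        have := (h.posDef u hu).isHermitian
        rwa [Matrix.IsHermitian, Matrix.conjTranspose_eq_transpose_of_trivial] at this
      rw [← inner_mcl_of_isSymm ℝ (h.symm u hu), mcl_mul, ContinuousLinearMap.comp_apply, hJr,
        map_smul, inner_smul_left, inner_mcl_of_isSymm ℝ hsa]
      simp
    simp only [slope_def_module, sub_zero, hu0, smul_apply, sub_apply, inner_smul_right,
      inner_sub_right, e1, e2, smul_eq_mul]
    ring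

theorem continuousOn_mcl_dir {G : EuclideanSpace ℝ (Fin n) → Matrix (Fin n) (Fin n) ℝ}
    (hG : C1MatrixOn G 𝒰) (h𝒰 : IsOpen 𝒰) :
    ContinuousOn (fun p : EuclideanSpace ℝ (Fin n) × EuclideanSpace ℝ (Fin n) =>
      mcl ℝ (dirMatrix G p.1 p.2)) (𝒰 ×ˢ univ) :=
  continuousOn_mcl ℝ (hG.continuousOn_dirMatrix h𝒰)

/-- Unit eigenvectors of the principal field, oriented by increasing eigenvalue. -/
def oriented (Kc : Set (EuclideanSpace ℝ (Fin n)))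
    (J a₀ : EuclideanSpace ℝ (Fin n) → Matrix (Fin n) (Fin n) ℝ)
    (α₀ : EuclideanSpace ℝ (Fin n) → ℝ) :
    Set (EuclideanSpace ℝ (Fin n) × EuclideanSpace ℝ (Fin n)) :=
  {p | p ∈ Kc ×ˢ Metric.sphere 0 1 ∧ mcl ℝ (J p.1) p.2 - α₀ p.1 • p.2 = 0 ∧
    0 ≤ ⟪p.2, mcl ℝ (dirMatrix (fun u => a₀ u * J u) p.1 p.2) p.2⟫
      - α₀ p.1 * ⟪p.2, mcl ℝ (dirMatrix a₀ p.1 p.2) p.2⟫}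

/-- Continuity of dα₀ is not among the hypotheses. This expression equals dα₀(r)⟨r, a₀r⟩ at unit
eigenvectors and is continuous, so it replaces dα₀ in compactness arguments. -/
theorem continuousOn_num (h : SymmetrizableField 𝒰 J a₀ α₀ r₀) :
    ContinuousOn (fun p : EuclideanSpace ℝ (Fin n) × EuclideanSpace ℝ (Fin n) =>
      ⟪p.2, mcl ℝ (dirMatrix (fun u => a₀ u * J u) p.1 p.2) p.2⟫
        - α₀ p.1 * ⟪p.2, mcl ℝ (dirMatrix a₀ p.1 p.2) p.2⟫) (𝒰 ×ˢ univ) := by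
  have hα : ContinuousOn α₀ 𝒰 := fun u hu =>
    (h.differentiableAt hu).continuousAt.continuousWithinAt
  have hα' : ContinuousOn (fun p : EuclideanSpace ℝ (Fin n) × EuclideanSpace ℝ (Fin n) => α₀ p.1)
      (𝒰 ×ˢ univ) := hα.comp continuousOn_fst fun p hp => hp.1
  have h1 := continuousOn_mcl_dir h.c1_aJ h.isOpen
  have h2 := continuousOn_mcl_dir h.c1_a h.isOpen
  exact (continuousOn_snd.inner (𝕜 := ℝ) (h1.clm_apply continuousOn_snd)).sub
    (hα'.mul (continuousOn_snd.inner (𝕜 := ℝ) (h2.clm_apply continuousOn_snd)))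

theorem isCompact_oriented (h : SymmetrizableField 𝒰 J a₀ α₀ r₀)
    {Kc : Set (EuclideanSpace ℝ (Fin n))} (hK : IsCompact Kc) (hKU : Kc ⊆ 𝒰) :
    IsCompact (oriented Kc J a₀ α₀) := by
  have hc : IsCompact (Kc ×ˢ Metric.sphere (0 : EuclideanSpace ℝ (Fin n)) 1) :=
    hK.prod (isCompact_sphere _ _)
  have hsub : Kc ×ˢ Metric.sphere (0 : EuclideanSpace ℝ (Fin n)) 1 ⊆ 𝒰 ×ˢ univ :=
    fun p hp => ⟨hKU hp.1, mem_univ _⟩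
  have hα : ContinuousOn α₀ Kc := fun u hu =>
    (h.differentiableAt (hKU hu)).continuousAt.continuousWithinAt
  have c1 : ContinuousOn (fun p : EuclideanSpace ℝ (Fin n) × EuclideanSpace ℝ (Fin n) =>
      mcl ℝ (J p.1) p.2 - α₀ p.1 • p.2) (Kc ×ˢ Metric.sphere 0 1) := by
    have hJ : ContinuousOn (fun p : EuclideanSpace ℝ (Fin n) × EuclideanSpace ℝ (Fin n) =>
        mcl ℝ (J p.1)) (Kc ×ˢ Metric.sphere 0 1) :=
      (h.c1_J.contDiffOn_mcl ℝ).continuousOn.comp continuousOn_fst fun p hp => hKU hp.1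
    exact (hJ.clm_apply continuousOn_snd).sub
      ((hα.comp continuousOn_fst fun p hp => hp.1).smul continuousOn_snd)
  have h1 := c1.preimage_isClosed_of_isClosed hc.isClosed (isClosed_singleton (x := 0))
  have h2 := (h.continuousOn_num.mono hsub).preimage_isClosed_of_isClosed hc.isClosed
    (isClosed_Ici (a := (0 : ℝ)))
  refine (hc.inter_right (h1.inter h2)).of_isClosed_subset ?_ ?_
  rotate_left
  · rintro p ⟨hp, hp1, hp2⟩
    exact ⟨hp, ⟨hp, hp1⟩, hp, hp2⟩
  · convert h1.inter h2 using 1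
    ext p
    constructor
    · rintro ⟨hp, hp1, hp2⟩
      exact ⟨⟨hp, hp1⟩, hp, hp2⟩
    · rintro ⟨⟨hp, hp1⟩, -, hp2⟩
      exact ⟨hp, hp1, hp2⟩

theorem eq_or_eq_neg (h : SymmetrizableField 𝒰 J a₀ α₀ r₀) {u} (hu : u ∈ 𝒰)
    {r : EuclideanSpace ℝ (Fin n)} (hr : ‖r‖ = 1) (hJr : mcl ℝ (J u) r = α₀ u • r) :
    r = r₀ u ∨ r = -r₀ u :=
  eq_or_eq_neg_of_rootMultiplicity_eq_one (h.simple u hu) (h.eigen u hu) hJr (h.unit u hu) hr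

/-- The orientation condition is nonstrict in order to be closed; genuine nonlinearity excludes
equality. -/
theorem num_pos (h : SymmetrizableField 𝒰 J a₀ α₀ r₀)
    {Kc : Set (EuclideanSpace ℝ (Fin n))} (hKU : Kc ⊆ 𝒰)
    {p : EuclideanSpace ℝ (Fin n) × EuclideanSpace ℝ (Fin n)} (hp : p ∈ oriented Kc J a₀ α₀) :
    0 < ⟪p.2, mcl ℝ (dirMatrix (fun u => a₀ u * J u) p.1 p.2) p.2⟫
      - α₀ p.1 * ⟪p.2, mcl ℝ (dirMatrix a₀ p.1 p.2) p.2⟫ := by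
  obtain ⟨⟨hp1, hp2⟩, hp3, hp4⟩ := hp
  have hu := hKU hp1
  have hr : ‖p.2‖ = 1 := by simpa using hp2
  have hJr := sub_eq_zero.1 hp3
  refine lt_of_le_of_ne hp4 (Ne.symm ?_)
  rw [h.fderiv_mul_inner hu hr hJr]
  refine mul_ne_zero ?_ (h.inner_pos hu hr).ne'
  rcases h.eq_or_eq_neg hu hr hJr with h1 | h1
  · rw [h1]; exact h.gnl _ hu
  · rw [h1, map_neg]; exact neg_ne_zero.2 (h.gnl _ hu)

theorem sign_smul_mem_oriented (h : SymmetrizableField 𝒰 J a₀ α₀ r₀)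
    {Kc : Set (EuclideanSpace ℝ (Fin n))} (hKU : Kc ⊆ 𝒰) {u} (hu : u ∈ Kc) :
    (u, Real.sign (gnlCoeff α₀ r₀ u) • r₀ u) ∈ oriented Kc J a₀ α₀ := by
  have hη := h.gnl u (hKU hu)
  set σ := Real.sign (gnlCoeff α₀ r₀ u) with hσ
  have hσ1 : |σ| = 1 := by
    rcases Real.sign_apply_eq_of_ne_zero _ hη with h1 | h1 <;> rw [hσ, h1] <;> simp
  have hn : ‖σ • r₀ u‖ = 1 := by
    rw [norm_smul, h.unit u (hKU hu), mul_one]; exact hσ1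
  have hJ : mcl ℝ (J u) (σ • r₀ u) = α₀ u • σ • r₀ u := by
    rw [map_smul, h.eigen u (hKU hu), smul_comm]
  refine ⟨⟨hu, by simpa using hn⟩, sub_eq_zero.2 hJ, ?_⟩
  rw [h.fderiv_mul_inner (hKU hu) hn hJ]
  refine mul_nonneg ?_ (h.inner_pos (hKU hu) hn).le
  rw [map_smul, smul_eq_mul]
  rcases hη.lt_or_gt with h1 | h1
  · rw [hσ, Real.sign_of_neg h1, neg_one_mul]; exact neg_nonneg.2 h1.le
  · rw [hσ, Real.sign_of_pos h1, one_mul]; exact h1.le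

/-- Compressivity of the principal field and definiteness of the corresponding weighted form. -/
theorem exists_goodman_form (h : SymmetrizableField 𝒰 J a₀ α₀ r₀)
    {Kc : Set (EuclideanSpace ℝ (Fin n))} (hK : IsCompact Kc) (hKU : Kc ⊆ 𝒰) :
    ∃ L θ δ : ℝ, 0 < L ∧ 0 < θ ∧ 0 < δ ∧ ∀ u ∈ Kc, |α₀ u| ≤ δ → ∀ e,
      ‖e + Real.sign (gnlCoeff α₀ r₀ u) • r₀ u‖ ≤ δ →
      fderiv ℝ α₀ u e ≤ -θ ∧ ∀ x : EuclideanSpace ℂ (Fin n),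
        2⁻¹ * (inner ℂ x (mcl ℂ (dirMatrix (fun u => a₀ u * J u) u e) x)).re
          - L * (inner ℂ x (mcl ℂ (a₀ u * J u * J u) x)).re ≤ -(θ * ‖x‖ ^ 2) := by
  have hΓ := h.isCompact_oriented hK hKU
  have hΓU : oriented Kc J a₀ α₀ ⊆ 𝒰 ×ˢ univ := fun p hp => ⟨hKU hp.1.1, mem_univ _⟩
  have hα : ContinuousOn α₀ Kc := fun u hu =>
    (h.differentiableAt (hKU hu)).continuousAt.continuousWithinAt
  obtain ⟨ν, hν, hν'⟩ := hΓ.exists_forall_le' (h.continuousOn_num.mono hΓU) (a := 0)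
    fun p hp => h.num_pos hKU hp
  obtain ⟨CG, hCG, -, hCG', -⟩ := h.c1_aJ.exists_bounds ℝ h.isOpen hK hKU
  obtain ⟨Ca, hCa, hCa1, hCa2, -⟩ := h.c1_a.exists_bounds ℝ h.isOpen hK hKU
  obtain ⟨Cα, hCα⟩ := hK.exists_bound_of_continuousOn hα
  obtain ⟨m, hm, hm'⟩ := exists_forall_mul_norm_sq_le_real hK
    (fun i j => (h.c1_a i j).continuousOn.mono hKU)
    fun w hw => symPart_posDef (h.posDef w (hKU hw))
  have hGc : ContinuousOn (fun p : (EuclideanSpace ℝ (Fin n) × EuclideanSpace ℝ (Fin n)) ×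
      EuclideanSpace ℝ (Fin n) => mcl ℝ (dirMatrix (fun u => a₀ u * J u) p.1.1 p.1.2))
      (oriented Kc J a₀ α₀ ×ˢ Metric.sphere 0 1) :=
    ((continuousOn_mcl_dir h.c1_aJ h.isOpen).mono hΓU).comp continuousOn_fst fun p hp => hp.1
  have hJc : ContinuousOn (fun p : (EuclideanSpace ℝ (Fin n) × EuclideanSpace ℝ (Fin n)) ×
      EuclideanSpace ℝ (Fin n) => mcl ℝ (a₀ p.1.1 * J p.1.1 * J p.1.1))
      (oriented Kc J a₀ α₀ ×ˢ Metric.sphere 0 1) :=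
    ((h.c1_aJ.mul h.c1_J).contDiffOn_mcl ℝ).continuousOn.comp
      (continuous_fst.comp continuous_fst).continuousOn fun p hp => hKU hp.1.1.1
  have hαc : ContinuousOn (fun p : (EuclideanSpace ℝ (Fin n) × EuclideanSpace ℝ (Fin n)) ×
      EuclideanSpace ℝ (Fin n) => α₀ p.1.1) (oriented Kc J a₀ α₀ ×ˢ Metric.sphere 0 1) :=
    hα.comp (continuous_fst.comp continuous_fst).continuousOn fun p hp => hp.1.1.1
  -- Symmetry of a₀J shows that a₀JJ is the a₀-square of Jx, degenerate exactly on the kernel of J.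
  have hJJ : ∀ u ∈ 𝒰, ∀ x : EuclideanSpace ℝ (Fin n),
      ⟪x, mcl ℝ (a₀ u * J u * J u) x⟫ = ⟪mcl ℝ (J u) x, mcl ℝ (a₀ u) (mcl ℝ (J u) x)⟫ := by
    intro u hu x
    have hsa : (a₀ u).IsSymm := by
      have := (h.posDef u hu).isHermitian
      rwa [Matrix.IsHermitian, Matrix.conjTranspose_eq_transpose_of_trivial] at this
    rw [mcl_mul, ContinuousLinearMap.comp_apply, ← inner_mcl_of_isSymm ℝ (h.symm u hu), mcl_mul,
      ContinuousLinearMap.comp_apply, inner_mcl_of_isSymm ℝ hsa]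
  have hJJ0 : ∀ u ∈ Kc, ∀ x : EuclideanSpace ℝ (Fin n),
      m * ‖mcl ℝ (J u) x‖ ^ 2 ≤ ⟪x, mcl ℝ (a₀ u * J u * J u) x⟫ := fun u hu x => by
    rw [hJJ u (hKU hu)]
    exact hm' u hu _
  -- The second function vanishes only if Jx = 0 and α₀ = 0. Then x is ± the oriented eigenvector,
  -- on which the first function is positive. The summand α₀² is what makes the kernel of J the
  -- principal eigenspace; it is removed below at the cost Lδ.
  obtain ⟨L, θ₂, hL, hθ₂, hLθ⟩ := (hΓ.prod (isCompact_sphere (0 : EuclideanSpace ℝ (Fin n))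
    1)).exists_add_mul_ge
    (f₀ := fun p => 2⁻¹ * ⟪p.2, mcl ℝ (dirMatrix (fun u => a₀ u * J u) p.1.1 p.1.2) p.2⟫)
    (f₁ := fun p => ⟪p.2, mcl ℝ (a₀ p.1.1 * J p.1.1 * J p.1.1) p.2⟫ + α₀ p.1.1 ^ 2)
    (continuousOn_const.mul (continuousOn_snd.inner (𝕜 := ℝ) (hGc.clm_apply continuousOn_snd)))
    ((continuousOn_snd.inner (𝕜 := ℝ) (hJc.clm_apply continuousOn_snd)).add (hαc.pow 2))
    (fun p hp => add_nonneg ((by positivity : 0 ≤ m * ‖mcl ℝ (J p.1.1) p.2‖ ^ 2).trans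
      (hJJ0 _ hp.1.1.1 _)) (sq_nonneg _))
    (by
      rintro ⟨⟨u, r⟩, x⟩ ⟨hp, hx⟩ h0
      have hu := hp.1.1
      have hr : ‖r‖ = 1 := by simpa using hp.1.2
      have hx1 : ‖x‖ = 1 := by simpa using hx
      have hJr : mcl ℝ (J u) r = α₀ u • r := sub_eq_zero.1 hp.2.1
      have hpos : 0 ≤ m * ‖mcl ℝ (J u) x‖ ^ 2 := by positivity
      have hge := hJJ0 u hu x
      simp only at h0 ⊢
      have hα0 : α₀ u = 0 := by
        have : α₀ u ^ 2 = 0 := by nlinarith [sq_nonneg (α₀ u)]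
        simpa using this
      have hJx : mcl ℝ (J u) x = α₀ u • x := by
        have : m * ‖mcl ℝ (J u) x‖ ^ 2 = 0 := by nlinarith [sq_nonneg (α₀ u)]
        have : mcl ℝ (J u) x = 0 := by simpa [hm.ne'] using this
        rw [this, hα0, zero_smul]
      have hN := h.num_pos hKU hp
      simp only [hα0, zero_mul, sub_zero] at hN
      rcases eq_or_eq_neg_of_rootMultiplicity_eq_one (h.simple u (hKU hu)) hJr hJx hr hx1
        with rfl | rfl
      · linarith
      · simp only [map_neg, inner_neg_left, inner_neg_right, neg_neg]
        linarith)
  -- A lower bound for dα₀ on oriented eigenvectors, since dα₀(r)⟨r, a₀r⟩ ≥ ν and ⟨r, a₀r⟩ ≤ Ca + 1.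
  -- The constant B below bounds the norm of dα₀ by the same formula.
  set θ₁ := ν / (Ca + 1) with hθ₁
  have hθ₁0 : 0 < θ₁ := by positivity
  set B := (CG + |Cα| * Ca) / m with hB
  have hB0 : 0 ≤ B := by positivity
  -- The entry 1 turns |α₀| ≤ δ into α₀² ≤ δ. The second entry limits the effect of e + r on dα₀ to
  -- θ₁/2, and the third limits the errors in the quadratic form to θ₂/2.
  set δ := min 1 (min (θ₁ / (2 * (B + 1))) (θ₂ / (2 * (CG + L)))) with hδ
  have hδ0 : 0 < δ := by positivity
  have hδ1 : δ ≤ 1 := min_le_left _ _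
  have hδ2 : B * δ ≤ θ₁ / 2 := by
    have h1 : δ ≤ θ₁ / (2 * (B + 1)) := (min_le_right _ _).trans (min_le_left _ _)
    rw [le_div_iff₀ (by positivity)] at h1
    linarith
  have hδ3 : (CG + L) * δ ≤ θ₂ / 2 := by
    have h1 : δ ≤ θ₂ / (2 * (CG + L)) := (min_le_right _ _).trans (min_le_right _ _)
    rw [le_div_iff₀ (by positivity)] at h1
    linarith
  refine ⟨L, min (θ₁ / 2) (θ₂ / 2), δ, hL, by positivity, hδ0, fun u hu hαδ e he => ?_⟩
  have hmem := h.sign_smul_mem_oriented hKU hu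
  set r := Real.sign (gnlCoeff α₀ r₀ u) • r₀ u with hr
  have hr1 : ‖r‖ = 1 := by simpa using hmem.1.2
  have hJr : mcl ℝ (J u) r = α₀ u • r := sub_eq_zero.1 hmem.2.1
  have hin : ∀ (M : EuclideanSpace ℝ (Fin n) →L[ℝ] EuclideanSpace ℝ (Fin n))
      (x : EuclideanSpace ℝ (Fin n)) (b : ℝ), ‖x‖ = 1 → ‖M‖ ≤ b → |⟪x, M x⟫| ≤ b := by
    intro M x b hx hM
    refine (abs_real_inner_le_norm _ _).trans ?_
    have := M.le_of_opNorm_le hM x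
    rw [hx, mul_one] at this
    rwa [hx, one_mul]
  constructor
  · refine le_trans ?_ (neg_le_neg (min_le_left _ _))
    have hpos := h.inner_pos (hKU hu) hr1
    have hle : ⟪r, mcl ℝ (a₀ u) r⟫ ≤ Ca + 1 :=
      ((le_abs_self _).trans (hin _ _ _ hr1 (hCa1 u hu))).trans (by linarith)
    have h1 : θ₁ ≤ fderiv ℝ α₀ u r := by
      have := hν' _ hmem
      rw [h.fderiv_mul_inner (hKU hu) hr1 hJr] at this
      rw [hθ₁, div_le_iff₀ (by positivity)]
      have hd : 0 ≤ fderiv ℝ α₀ u r := by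
        by_contra! hneg
        nlinarith
      exact this.trans (mul_le_mul_of_nonneg_left hle hd)
    have h2 : |fderiv ℝ α₀ u (e + r)| ≤ B * δ := by
      have hm1 : m ≤ ⟪r, mcl ℝ (a₀ u) r⟫ := by
        have := hm' u hu r
        rwa [hr1, one_pow, mul_one] at this
      have id := h.fderiv_mul_inner (hKU hu) hr1 hJr (e + r)
      have b1 := hin _ _ _ hr1 (hCG' u hu (e + r))
      have b2 := hin _ _ _ hr1 (hCa2 u hu (e + r))
      have b3 : |α₀ u| ≤ |Cα| := (hCα u hu).trans (le_abs_self _)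
      have b4 : |fderiv ℝ α₀ u (e + r)| * m ≤ (CG + |Cα| * Ca) * δ := by
        calc |fderiv ℝ α₀ u (e + r)| * m ≤ |fderiv ℝ α₀ u (e + r)| * ⟪r, mcl ℝ (a₀ u) r⟫ :=
              mul_le_mul_of_nonneg_left hm1 (abs_nonneg _)
          _ = |fderiv ℝ α₀ u (e + r) * ⟪r, mcl ℝ (a₀ u) r⟫| := by rw [abs_mul, abs_of_pos hpos]
          _ ≤ CG * ‖e + r‖ + |α₀ u| * (Ca * ‖e + r‖) := by
            rw [← id]
            refine (abs_sub _ _).trans (add_le_add b1 ?_)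
            rw [abs_mul]
            exact mul_le_mul_of_nonneg_left b2 (abs_nonneg _)
          _ ≤ CG * δ + |Cα| * (Ca * δ) := by gcongr
          _ = _ := by ring
      rw [hB, div_mul_eq_mul_div, le_div_iff₀ hm]
      exact b4
    have h3 : fderiv ℝ α₀ u e = fderiv ℝ α₀ u (e + r) - fderiv ℝ α₀ u r := by
      rw [map_add]; ring
    have := (abs_le.1 h2).2
    linarith
  · have hreal : ∀ x : EuclideanSpace ℝ (Fin n), θ₂ / 2 * ‖x‖ ^ 2 ≤
        ⟪x, mcl ℝ (L • (a₀ u * J u * J u) -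
          (2⁻¹ : ℝ) • dirMatrix (fun u => a₀ u * J u) u e) x⟫ := by
      refine quadratic_ge_of_sphere fun x hx => ?_
      have h1 := hLθ ((u, r), x) ⟨hmem, by simpa using hx⟩
      simp only at h1
      have h2 := hin _ _ _ hx (hCG' u hu (e + r))
      have h3 : e = (e + r) + -r := by abel
      have h4 : α₀ u ^ 2 ≤ δ := by
        rw [← sq_abs]
        nlinarith [abs_nonneg (α₀ u)]
      rw [mcl_sub, mcl_smul, mcl_smul, h3, dirMatrix_add, dirMatrix_neg, mcl_add, mcl_neg]
      simp only [sub_apply, smul_apply, add_apply, neg_apply, inner_sub_right, inner_add_right,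
        inner_smul_right, inner_neg_right]
      have h5 := (abs_le.1 h2).2
      have h6 : CG * ‖e + r‖ ≤ CG * δ := mul_le_mul_of_nonneg_left he hCG
      have h7 := mul_le_mul_of_nonneg_left h4 hL.le
      have h8 : 0 ≤ CG * δ := by positivity
      linarith
    intro x
    have h1 : (θ₂ / 2) * ‖x‖ ^ 2 ≤ (inner ℂ x (mcl ℂ (L • (a₀ u * J u * J u) -
          (2⁻¹ : ℝ) • dirMatrix (fun u => a₀ u * J u) u e) x)).re := by
      rw [re_inner_mcl, norm_sq_eq_reVec_imVec, mul_add]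
      exact add_le_add (hreal _) (hreal _)
    have h2 : min (θ₁ / 2) (θ₂ / 2) * ‖x‖ ^ 2 ≤ θ₂ / 2 * ‖x‖ ^ 2 := by
      gcongr; exact min_le_right _ _
    rw [mcl_sub, mcl_smul, mcl_smul, sub_apply, smul_apply, smul_apply, inner_sub_right,
      ← Complex.coe_smul, ← Complex.coe_smul, inner_smul_right, inner_smul_right,
      Complex.sub_re, Complex.re_ofReal_mul, Complex.re_ofReal_mul] at h1
    linarith

end SymmetrizableField

/-! ### Blocks of states and Jacobians -/

section Blocks

variable (𝕜 : Type*) [RCLike 𝕜] {n r : ℕ}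

/-- The conserved part of a state. -/
noncomputable def fstL : EuclideanSpace 𝕜 (Fin n ⊕ Fin r) →L[𝕜] EuclideanSpace 𝕜 (Fin n) :=
  LinearMap.toContinuousLinearMap
    { toFun := fun x => WithLp.toLp 2 fun i => x (Sum.inl i)
      map_add' := fun _ _ => rfl
      map_smul' := fun _ _ => rfl }

/-- The relaxed part of a state. -/
noncomputable def sndL : EuclideanSpace 𝕜 (Fin n ⊕ Fin r) →L[𝕜] EuclideanSpace 𝕜 (Fin r) :=
  LinearMap.toContinuousLinearMap
    { toFun := fun x => WithLp.toLp 2 fun i => x (Sum.inr i)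
      map_add' := fun _ _ => rfl
      map_smul' := fun _ _ => rfl }

/-- The state with given conserved part and vanishing relaxed part. -/
noncomputable def inlL : EuclideanSpace ℝ (Fin n) →L[ℝ] State n r :=
  LinearMap.toContinuousLinearMap
    { toFun := fun u => WithLp.toLp 2 (Sum.elim u 0)
      map_add' := fun _ _ => by ext (i | i) <;> simp
      map_smul' := fun _ _ => by ext (i | i) <;> simp }

/-- The state with given relaxed part and vanishing conserved part. -/
noncomputable def inrL : EuclideanSpace ℝ (Fin r) →L[ℝ] State n r :=
  LinearMap.toContinuousLinearMap
    { toFun := fun v => WithLp.toLp 2 (Sum.elim 0 v)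
      map_add' := fun _ _ => by ext (i | i) <;> simp
      map_smul' := fun _ _ => by ext (i | i) <;> simp }

theorem mkState_eq (u : EuclideanSpace ℝ (Fin n)) (v : EuclideanSpace ℝ (Fin r)) :
    mkState u v = inlL u + inrL v := by
  ext (i | i) <;> simp [mkState, inlL, inrL]

theorem uPart_eq (w : State n r) : uPart w = fstL ℝ w := rfl

theorem mkState_fstL_sndL (w : State n r) : mkState (fstL ℝ w) (sndL ℝ w) = w := by
  ext (i | i) <;> rfl

theorem fstL_mkState (u : EuclideanSpace ℝ (Fin n)) (v : EuclideanSpace ℝ (Fin r)) :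
    fstL ℝ (mkState u v) = u := rfl

theorem sndL_mkState (u : EuclideanSpace ℝ (Fin n)) (v : EuclideanSpace ℝ (Fin r)) :
    sndL ℝ (mkState u v) = v := rfl

theorem norm_sq_eq_fstL_sndL (w : EuclideanSpace 𝕜 (Fin n ⊕ Fin r)) :
    ‖w‖ ^ 2 = ‖fstL 𝕜 w‖ ^ 2 + ‖sndL 𝕜 w‖ ^ 2 := by
  simp only [EuclideanSpace.norm_sq_eq, Fintype.sum_sum_type]
  rfl

theorem norm_fstL_le (w : EuclideanSpace 𝕜 (Fin n ⊕ Fin r)) : ‖fstL 𝕜 w‖ ≤ ‖w‖ := by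
  refine abs_le_of_sq_le_sq' ?_ (norm_nonneg _) |>.2
  rw [norm_sq_eq_fstL_sndL 𝕜 w]
  nlinarith [sq_nonneg ‖sndL 𝕜 w‖]

theorem norm_sndL_le (w : EuclideanSpace 𝕜 (Fin n ⊕ Fin r)) : ‖sndL 𝕜 w‖ ≤ ‖w‖ := by
  refine abs_le_of_sq_le_sq' ?_ (norm_nonneg _) |>.2
  rw [norm_sq_eq_fstL_sndL 𝕜 w]
  nlinarith [sq_nonneg ‖fstL 𝕜 w‖]

theorem norm_le_fstL_add_sndL (w : EuclideanSpace 𝕜 (Fin n ⊕ Fin r)) :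
    ‖w‖ ≤ ‖fstL 𝕜 w‖ + ‖sndL 𝕜 w‖ := by
  refine abs_le_of_sq_le_sq' ?_ (by positivity) |>.2
  rw [norm_sq_eq_fstL_sndL 𝕜 w]
  nlinarith [norm_nonneg (fstL 𝕜 w), norm_nonneg (sndL 𝕜 w),
    mul_nonneg (norm_nonneg (fstL 𝕜 w)) (norm_nonneg (sndL 𝕜 w))]

theorem norm_mkState_zero (v : EuclideanSpace ℝ (Fin r)) :
    ‖(mkState 0 v : State n r)‖ = ‖v‖ := by
  have h := norm_sq_eq_fstL_sndL ℝ (mkState 0 v : State n r)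
  rw [fstL_mkState, sndL_mkState, norm_zero, zero_pow two_ne_zero, zero_add] at h
  exact (sq_eq_sq₀ (norm_nonneg _) (norm_nonneg _)).1 h

theorem fstL_mcl (M : Matrix (Fin n ⊕ Fin r) (Fin n ⊕ Fin r) ℝ)
    (x : EuclideanSpace 𝕜 (Fin n ⊕ Fin r)) :
    fstL 𝕜 (mcl 𝕜 M x) = mcl 𝕜 M.toBlocks₁₁ (fstL 𝕜 x) + mcl 𝕜 M.toBlocks₁₂ (sndL 𝕜 x) := by
  ext i
  exact mcl_fromBlocks_inl 𝕜 M x i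

theorem sndL_mcl (M : Matrix (Fin n ⊕ Fin r) (Fin n ⊕ Fin r) ℝ)
    (x : EuclideanSpace 𝕜 (Fin n ⊕ Fin r)) :
    sndL 𝕜 (mcl 𝕜 M x) = mcl 𝕜 M.toBlocks₂₁ (fstL 𝕜 x) + mcl 𝕜 M.toBlocks₂₂ (sndL 𝕜 x) := by
  ext i
  exact mcl_fromBlocks_inr 𝕜 M x i

end Blocks

section Jacobian

variable {ι κ : Type*} [Fintype ι] [Fintype κ] [DecidableEq ι] [DecidableEq κ]

theorem mcl_jacobian (F : EuclideanSpace ℝ ι → EuclideanSpace ℝ κ) (w : EuclideanSpace ℝ ι) :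
    mcl ℝ (jacobian F w) = fderiv ℝ F w := by
  ext x i
  have hx : x = ∑ j, x j • EuclideanSpace.single j (1 : ℝ) := by
    ext i
    simp [Finset.sum_apply, Pi.single_apply]
  conv_rhs => rw [hx]
  simp [mcl_apply, jacobian, mul_comm]

theorem c1MatrixOn_jacobian {F : EuclideanSpace ℝ ι → EuclideanSpace ℝ κ}
    {s : Set (EuclideanSpace ℝ ι)} (hF : ContDiffOn ℝ 3 F s) (hs : IsOpen s) :
    C1MatrixOn (jacobian F) s := fun i j => by
  have h1 : ContDiffOn ℝ 1 (fderiv ℝ F) s := hF.fderiv_of_isOpen hs (by norm_num)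
  have h2 := h1.clm_apply (contDiffOn_const (c := EuclideanSpace.single j (1 : ℝ)))
  exact (EuclideanSpace.proj (𝕜 := ℝ) i).contDiff.comp_contDiffOn h2

end Jacobian

/-! ### The structure of relaxation systems near equilibrium -/

section Relaxation

variable {n r : ℕ} (F : State n r → State n r) (q : State n r → EuclideanSpace ℝ (Fin r))

/-- The inverse of `d_v q`. -/
noncomputable def relaxInv (w : State n r) : Matrix (Fin r) (Fin r) ℝ :=
  (jacobian (source q) w).toBlocks₂₂⁻¹

/-- The matrix `(d_v q)⁻¹ d_u q`. -/
noncomputable def slaving (w : State n r) : Matrix (Fin r) (Fin n) ℝ :=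
  relaxInv q w * (jacobian (source q) w).toBlocks₂₁

/-- The matrix `A₁₂ (d_v q)⁻¹`. -/
noncomputable def coupling (w : State n r) : Matrix (Fin n) (Fin r) ℝ :=
  (jacobian F w).toBlocks₁₂ * relaxInv q w

/-- The reduced matrix `A₁₁ - A₁₂ (d_v q)⁻¹ d_u q`. -/
noncomputable def reduced (w : State n r) : Matrix (Fin n) (Fin n) ℝ :=
  (jacobian F w).toBlocks₁₁ - (jacobian F w).toBlocks₁₂ * slaving q w

/-- The states over `𝒰` at which `d_v q` is invertible. -/
noncomputable def regularStates (𝒲 : Set (State n r)) (𝒰 : Set (EuclideanSpace ℝ (Fin n))) : Set (State n r) :=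
  {w | w ∈ 𝒲 ∧ uPart w ∈ 𝒰 ∧ (jacobian (source q) w).toBlocks₂₂.det ≠ 0}

variable {F q} {vstar : EuclideanSpace ℝ (Fin n) → EuclideanSpace ℝ (Fin r)}
  {𝒲 : Set (State n r)} {𝒰 : Set (EuclideanSpace ℝ (Fin n))}

theorem source_eq (w : State n r) : source q w = inrL (q w) := by
  rw [source, mkState_eq, map_zero, zero_add]

theorem norm_source (w : State n r) : ‖source q w‖ = ‖q w‖ := norm_mkState_zero _

theorem fstL_source (w : State n r) : fstL ℝ (source q w) = 0 := rfl

theorem ContDiffOn.source {k : WithTop ℕ∞} {s : Set (State n r)} (h : ContDiffOn ℝ k q s) :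
    ContDiffOn ℝ k (source q) s := by
  have : _root_.source q = fun w => (inrL (q w) : State n r) := funext source_eq
  rw [this]
  exact inrL.contDiff.comp_contDiffOn h

theorem jacobian_source_inl (w : State n r) (i : Fin n) (j : Fin n ⊕ Fin r) :
    jacobian (source q) w (Sum.inl i) j = 0 := by
  by_cases hd : DifferentiableAt ℝ (source q) w
  · have h1 : HasFDerivAt (fun w => fstL ℝ (source q w)) ((fstL ℝ).comp (fderiv ℝ (source q) w)) w :=
      (fstL ℝ).hasFDerivAt.comp w hd.hasFDerivAt
    have h2 : HasFDerivAt (fun w => fstL ℝ (source q w)) (0 : State n r →L[ℝ] _) w :=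
      hasFDerivAt_const (0 : EuclideanSpace ℝ (Fin n)) w
    have h3 := h1.unique h2
    exact congrArg (fun v : EuclideanSpace ℝ (Fin n) => v i)
      (DFunLike.congr_fun h3 (EuclideanSpace.single j 1))
  · simp [jacobian, fderiv_zero_of_not_differentiableAt hd]

theorem fstL_mcl_jacobian_source (𝕜 : Type*) [RCLike 𝕜] (w : State n r)
    (x : EuclideanSpace 𝕜 (Fin n ⊕ Fin r)) : fstL 𝕜 (mcl 𝕜 (jacobian (source q) w) x) = 0 := by
  ext i
  have : mcl 𝕜 (jacobian (source q) w) x (Sum.inl i) = 0 := by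
    simp [mcl_apply, jacobian_source_inl]
  exact this

/-- The relaxed row s = q₁u + q₂v is solved for v. This allows (u, s) to be used as coordinates in
place of (u, v). -/
theorem sndL_eq_of_regular (𝕜 : Type*) [RCLike 𝕜] {w : State n r}
    (hw : w ∈ regularStates q 𝒲 𝒰) (x : EuclideanSpace 𝕜 (Fin n ⊕ Fin r)) :
    sndL 𝕜 x = -mcl 𝕜 (slaving q w) (fstL 𝕜 x) +
      mcl 𝕜 (relaxInv q w) (sndL 𝕜 (mcl 𝕜 (jacobian (source q) w) x)) := by
  have hu : IsUnit (jacobian (source q) w).toBlocks₂₂.det := isUnit_iff_ne_zero.2 hw.2.2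
  have h : mcl 𝕜 (relaxInv q w) (mcl 𝕜 (jacobian (source q) w).toBlocks₂₂ (sndL 𝕜 x)) =
      sndL 𝕜 x := by
    rw [← ContinuousLinearMap.comp_apply, ← mcl_mul, relaxInv, Matrix.nonsing_inv_mul _ hu, mcl_one]
    rfl
  rw [sndL_mcl, map_add, h, slaving, mcl_mul, ContinuousLinearMap.comp_apply, neg_add_cancel_left]

/-- Substituting the slaving relation into the conserved row separates the effective flux of u from
the forcing by s. -/
theorem fstL_mcl_jacobian (𝕜 : Type*) [RCLike 𝕜] {w : State n r}
    (hw : w ∈ regularStates q 𝒲 𝒰) (x : EuclideanSpace 𝕜 (Fin n ⊕ Fin r)) :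
    fstL 𝕜 (mcl 𝕜 (jacobian F w) x) = mcl 𝕜 (reduced F q w) (fstL 𝕜 x) +
      mcl 𝕜 (coupling F q w) (sndL 𝕜 (mcl 𝕜 (jacobian (source q) w) x)) := by
  rw [fstL_mcl, sndL_eq_of_regular 𝕜 hw x, reduced, coupling, mcl_sub, mcl_mul, mcl_mul]
  simp only [map_add, map_neg, sub_apply, ContinuousLinearMap.comp_apply]
  abel

theorem RelaxationStructure.c1_jacobian_F (hS : RelaxationStructure F q vstar 𝒲 𝒰) :
    C1MatrixOn (jacobian F) 𝒲 := c1MatrixOn_jacobian hS.contDiffOn_F hS.isOpen_W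

theorem RelaxationStructure.c1_jacobian_source (hS : RelaxationStructure F q vstar 𝒲 𝒰) :
    C1MatrixOn (jacobian (source q)) 𝒲 := c1MatrixOn_jacobian hS.contDiffOn_q.source hS.isOpen_W

theorem RelaxationStructure.isOpen_regularStates (hS : RelaxationStructure F q vstar 𝒲 𝒰) :
    IsOpen (regularStates q 𝒲 𝒰) := by
  have h1 : ContinuousOn (fun w => (jacobian (source q) w).toBlocks₂₂.det) 𝒲 :=
    (C1MatrixOn.det (A := fun w => (jacobian (source q) w).toBlocks₂₂)
      fun _ _ => hS.c1_jacobian_source _ _).continuousOn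
  have h2 := h1.isOpen_inter_preimage hS.isOpen_W (isOpen_compl_singleton (x := (0 : ℝ)))
  have h3 : IsOpen ((fun w : State n r => fstL ℝ w) ⁻¹' 𝒰) :=
    hS.isOpen_U.preimage (fstL ℝ).continuous
  convert h2.inter h3 using 1
  ext w
  constructor
  · rintro ⟨a, b, c⟩; exact ⟨⟨a, c⟩, b⟩
  · rintro ⟨⟨a, c⟩, b⟩; exact ⟨a, b, c⟩

theorem regularStates_subset : regularStates q 𝒲 𝒰 ⊆ 𝒲 := fun _ h => h.1

theorem RelaxationStructure.c1_relaxInv (hS : RelaxationStructure F q vstar 𝒲 𝒰) :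
    C1MatrixOn (relaxInv q) (regularStates q 𝒲 𝒰) :=
  C1MatrixOn.inv (A := fun w => (jacobian (source q) w).toBlocks₂₂)
    (fun _ _ => (hS.c1_jacobian_source _ _).mono regularStates_subset) fun _ h => h.2.2

theorem RelaxationStructure.c1_slaving (hS : RelaxationStructure F q vstar 𝒲 𝒰) :
    C1MatrixOn (slaving q) (regularStates q 𝒲 𝒰) :=
  hS.c1_relaxInv.mul (B := fun w => (jacobian (source q) w).toBlocks₂₁)
    fun _ _ => (hS.c1_jacobian_source _ _).mono regularStates_subset

theorem RelaxationStructure.c1_coupling (hS : RelaxationStructure F q vstar 𝒲 𝒰) :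
    C1MatrixOn (coupling F q) (regularStates q 𝒲 𝒰) :=
  C1MatrixOn.mul (A := fun w => (jacobian F w).toBlocks₁₂)
    (fun _ _ => (hS.c1_jacobian_F _ _).mono regularStates_subset) hS.c1_relaxInv

theorem RelaxationStructure.c1_reduced (hS : RelaxationStructure F q vstar 𝒲 𝒰) :
    C1MatrixOn (reduced F q) (regularStates q 𝒲 𝒰) :=
  C1MatrixOn.sub (A := fun w => (jacobian F w).toBlocks₁₁)
    (fun _ _ => (hS.c1_jacobian_F _ _).mono regularStates_subset)
    (C1MatrixOn.mul (A := fun w => (jacobian F w).toBlocks₁₂)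
      (fun _ _ => (hS.c1_jacobian_F _ _).mono regularStates_subset) hS.c1_slaving)

/-- Stability excludes 0 from the spectrum of d_v q at equilibrium. -/
theorem RelaxationStructure.equilibrium_mem (hS : RelaxationStructure F q vstar 𝒲 𝒰)
    {u : EuclideanSpace ℝ (Fin n)} (hu : u ∈ 𝒰) :
    equilibrium vstar u ∈ regularStates q 𝒲 𝒰 := by
  refine ⟨hS.graph_mem u hu, hu, fun hdet => ?_⟩
  have h0 : (0 : ℂ) ∈ spectrum ℂ ((jacobian (source q) (equilibrium vstar u)).toBlocks₂₂.map
      (algebraMap ℝ ℂ)) := by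
    rw [spectrum.zero_mem_iff, Matrix.isUnit_iff_isUnit_det, isUnit_iff_ne_zero, not_not]
    have := (algebraMap ℝ ℂ).map_det (jacobian (source q) (equilibrium vstar u)).toBlocks₂₂
    rw [hdet, map_zero] at this
    exact this.symm
  exact absurd (hS.stable u hu 0 h0) (by simp)

theorem RelaxationStructure.contDiffOn_equilibrium (hS : RelaxationStructure F q vstar 𝒲 𝒰) :
    ContDiffOn ℝ 1 (equilibrium vstar) 𝒰 := by
  have : equilibrium vstar = fun u => (inlL u + inrL (vstar u) : State n r) :=
    funext fun u => mkState_eq _ _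
  rw [this]
  exact inlL.contDiff.contDiffOn.add (inrL.contDiff.comp_contDiffOn hS.contDiffOn_vstar)

theorem RelaxationStructure.source_equilibrium (hS : RelaxationStructure F q vstar 𝒲 𝒰)
    {u : EuclideanSpace ℝ (Fin n)} (hu : u ∈ 𝒰) : source q (equilibrium vstar u) = 0 := by
  have h := (hS.eq_zero_iff u hu (vstar u) (hS.graph_mem u hu)).2 rfl
  rw [source_eq]
  have h' : q (equilibrium vstar u) = 0 := h
  rw [h', map_zero]

/-- The Jacobian of the relaxed flux is the reduced matrix at equilibrium. -/
theorem RelaxationStructure.jacobian_relaxedFlux (hS : RelaxationStructure F q vstar 𝒲 𝒰)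
    {u : EuclideanSpace ℝ (Fin n)} (hu : u ∈ 𝒰) :
    jacobian (relaxedFlux F vstar) u = reduced F q (equilibrium vstar u) := by
  have hreg := hS.equilibrium_mem hu
  have hE : HasFDerivAt (equilibrium vstar) (fderiv ℝ (equilibrium vstar) u) u :=
    ((hS.contDiffOn_equilibrium.contDiffAt (hS.isOpen_U.mem_nhds hu)).differentiableAt
      one_ne_zero).hasFDerivAt
  have hF : HasFDerivAt F (mcl ℝ (jacobian F (equilibrium vstar u))) (equilibrium vstar u) := by
    rw [mcl_jacobian]
    exact ((hS.contDiffOn_F.contDiffAt (hS.isOpen_W.mem_nhds hreg.1)).differentiableAt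
      (by norm_num)).hasFDerivAt
  have hQ : HasFDerivAt (source q) (mcl ℝ (jacobian (source q) (equilibrium vstar u)))
      (equilibrium vstar u) := by
    rw [mcl_jacobian]
    exact ((hS.contDiffOn_q.source.contDiffAt (hS.isOpen_W.mem_nhds hreg.1)).differentiableAt
      (by norm_num)).hasFDerivAt
  -- Differentiating Q(u, v*(u)) = 0: tangents to the equilibrium graph lie in the kernel of dQ, so
  -- the forcing term drops out of the conserved row.
  have hQ0 : ∀ e, mcl ℝ (jacobian (source q) (equilibrium vstar u))
      (fderiv ℝ (equilibrium vstar) u e) = 0 := by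
    have h1 := hQ.comp u hE
    have h2 : HasFDerivAt (source q ∘ equilibrium vstar)
        (0 : EuclideanSpace ℝ (Fin n) →L[ℝ] State n r) u := by
      refine (hasFDerivAt_const (0 : State n r) u).congr_of_eventuallyEq ?_
      filter_upwards [hS.isOpen_U.mem_nhds hu] with u' hu'
      exact hS.source_equilibrium hu'
    exact fun e => DFunLike.congr_fun (h1.unique h2) e
  have hfst : ∀ e, fstL ℝ (fderiv ℝ (equilibrium vstar) u e) = e := by
    have h1 := (fstL ℝ).hasFDerivAt.comp u hE
    have h2 : HasFDerivAt (⇑(fstL ℝ) ∘ equilibrium vstar)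
      (ContinuousLinearMap.id ℝ (EuclideanSpace ℝ (Fin n))) u := hasFDerivAt_id u
    exact fun e => DFunLike.congr_fun (h1.unique h2) e
  have hf : HasFDerivAt (relaxedFlux F vstar) (mcl ℝ (reduced F q (equilibrium vstar u))) u := by
    have h1 := (fstL ℝ).hasFDerivAt.comp u (hF.comp u hE)
    have h2 : (fstL ℝ).comp ((mcl ℝ (jacobian F (equilibrium vstar u))).comp
        (fderiv ℝ (equilibrium vstar) u)) = mcl ℝ (reduced F q (equilibrium vstar u)) := by
      ext1 e
      rw [ContinuousLinearMap.comp_apply, ContinuousLinearMap.comp_apply,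
        fstL_mcl_jacobian ℝ hreg, hQ0, hfst]
      simp
    rw [h2] at h1
    exact h1
  ext i j
  rw [jacobian, Matrix.of_apply, hf.fderiv]
  simp [mcl_apply]

/-- States of a compact set at which the source is small are regular. -/
theorem RelaxationStructure.exists_small_source (hS : RelaxationStructure F q vstar 𝒲 𝒰)
    {𝒦 : Set (State n r)} (h𝒦 : IsCompact 𝒦) (h𝒦𝒲 : 𝒦 ⊆ 𝒲) (h𝒦𝒰 : ∀ w ∈ 𝒦, uPart w ∈ 𝒰) :
    ∃ δ : ℝ, 0 < δ ∧ {w ∈ 𝒦 | ‖source q w‖ ≤ δ} ⊆ regularStates q 𝒲 𝒰 := by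
  have h1 : ContinuousOn (fun w => (jacobian (source q) w).toBlocks₂₂.det) 𝒦 :=
    (C1MatrixOn.det (A := fun w => (jacobian (source q) w).toBlocks₂₂)
      fun _ _ => (hS.c1_jacobian_source _ _).mono h𝒦𝒲).continuousOn
  -- On the compact set where d_v q is singular the source cannot vanish: a zero over 𝒰 is an
  -- equilibrium, where d_v q is invertible. So the source has a positive minimum there.
  have hc : IsCompact (𝒦 ∩ (𝒦 ∩ (fun w => (jacobian (source q) w).toBlocks₂₂.det) ⁻¹' {0})) :=
    h𝒦.inter_right (h1.preimage_isClosed_of_isClosed h𝒦.isClosed isClosed_singleton)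
  have h2 : ContinuousOn (fun w => ‖source q w‖) 𝒦 :=
    (hS.contDiffOn_q.source.continuousOn.mono h𝒦𝒲).norm
  obtain ⟨δ, hδ, h⟩ := hc.exists_forall_le' (h2.mono inter_subset_left) (a := 0) fun w hw => by
    rw [norm_pos_iff]
    intro h0
    have hu := h𝒦𝒰 w hw.1
    have hq : q w = 0 := by
      rw [← norm_eq_zero, ← norm_source, h0, norm_zero]
    have hw' : w = equilibrium vstar (uPart w) := by
      have := (hS.eq_zero_iff (uPart w) hu (sndL ℝ w) (by
        rw [uPart_eq, mkState_fstL_sndL]; exact h𝒦𝒲 hw.1)).1 (by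
        rw [uPart_eq, mkState_fstL_sndL]; exact hq)
      rw [equilibrium, ← this, uPart_eq, mkState_fstL_sndL]
    have := (hS.equilibrium_mem hu).2.2
    rw [← hw'] at this
    exact this hw.2.2
  -- Halved because the two bounds to be contradicted are both nonstrict.
  refine ⟨δ / 2, by positivity, fun w hw => ⟨h𝒦𝒲 hw.1, h𝒦𝒰 w hw.1, fun h0 => ?_⟩⟩
  have := h w ⟨hw.1, hw.1, h0⟩
  linarith [hw.2]

/-- The distance to equilibrium is controlled by the source. -/
theorem RelaxationStructure.exists_dist_equilibrium_le (hS : RelaxationStructure F q vstar 𝒲 𝒰)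
    {K : Set (State n r)} (hK : IsCompact K) (hKreg : K ⊆ regularStates q 𝒲 𝒰) :
    ∃ C : ℝ, ∀ w ∈ K, ‖w - equilibrium vstar (uPart w)‖ ≤ C * ‖source q w‖ := by
  refine hK.induction_on (p := fun s => ∃ C : ℝ, ∀ w ∈ s,
    ‖w - equilibrium vstar (uPart w)‖ ≤ C * ‖source q w‖) ⟨0, by simp⟩ ?_ ?_ ?_
  · rintro s t hst ⟨C, hC⟩
    exact ⟨C, fun w hw => hC w (hst hw)⟩
  · rintro s t ⟨C, hC⟩ ⟨C', hC'⟩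
    refine ⟨max C C', ?_⟩
    rintro w (hw | hw)
    · exact (hC w hw).trans (mul_le_mul_of_nonneg_right (le_max_left _ _) (norm_nonneg _))
    · exact (hC' w hw).trans (mul_le_mul_of_nonneg_right (le_max_right _ _) (norm_nonneg _))
  · intro w₀ hw₀
    have hreg := hKreg hw₀
    have hQc : ContDiffAt ℝ 3 (source q) w₀ :=
      hS.contDiffOn_q.source.contDiffAt (hS.isOpen_W.mem_nhds hreg.1)
    have hPc : ContinuousAt (fun w : State n r => equilibrium vstar (uPart w)) w₀ :=
      ContinuousAt.comp (f := fun w : State n r => fstL ℝ w) (g := equilibrium vstar)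
        (hS.contDiffOn_equilibrium.continuousOn.continuousAt (hS.isOpen_U.mem_nhds hreg.2.1))
        (fstL ℝ).continuous.continuousAt
    -- Near an equilibrium, w and its projection have the same conserved part, so dQ is injective on
    -- their difference, and strict differentiability compares dQ of it with Q(w). The tolerance
    -- 1/(2κ) lets half of the distance be absorbed. Away from equilibrium the source is bounded
    -- below and nothing needs proof.
    by_cases h0 : source q w₀ = 0
    · have hw' : equilibrium vstar (uPart w₀) = w₀ := by
        have hq : q w₀ = 0 := by rw [← norm_eq_zero, ← norm_source, h0, norm_zero]
        have := (hS.eq_zero_iff (uPart w₀) hreg.2.1 (sndL ℝ w₀) (by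
          rw [uPart_eq, mkState_fstL_sndL]; exact hreg.1)).1 (by
          rw [uPart_eq, mkState_fstL_sndL]; exact hq)
        rw [equilibrium, ← this, uPart_eq, mkState_fstL_sndL]
      have hst := hQc.hasStrictFDerivAt (by norm_num)
      rw [← mcl_jacobian] at hst
      set κ : ℝ := ‖mcl ℝ (relaxInv q w₀)‖ + 1 with hκ
      have hκ0 : 0 < κ := by positivity
      have hb := hst.isLittleO.bound (show 0 < 1 / (2 * κ) by positivity)
      have hp : Tendsto (fun w : State n r => (w, equilibrium vstar (uPart w))) (𝓝 w₀)
          (𝓝 (w₀, w₀)) := by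
        have := hPc.tendsto
        rw [hw'] at this
        exact tendsto_id.prodMk_nhds this
      have hU : ∀ᶠ w in 𝓝 w₀, w ∈ regularStates q 𝒲 𝒰 :=
        hS.isOpen_regularStates.mem_nhds hreg
      refine ⟨_, mem_nhdsWithin_of_mem_nhds (hU.and (hp.eventually hb)), 2 * κ, ?_⟩
      rintro w ⟨hwU, hw⟩
      simp only at hw
      rw [hS.source_equilibrium hwU.2.1, sub_zero] at hw
      set d := w - equilibrium vstar (uPart w) with hd
      have hd1 : fstL ℝ d = 0 := by
        rw [hd, map_sub]; exact sub_self _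
      have hd2 : ‖d‖ ≤ κ * ‖mcl ℝ (jacobian (source q) w₀) d‖ := by
        refine (norm_le_fstL_add_sndL ℝ d).trans ?_
        rw [hd1, norm_zero, zero_add, sndL_eq_of_regular ℝ hreg d, hd1, map_zero, neg_zero, zero_add]
        refine (ContinuousLinearMap.le_opNorm _ _).trans ?_
        exact mul_le_mul (by linarith) (norm_sndL_le ℝ _) (norm_nonneg _) hκ0.le
      have hd3 : ‖mcl ℝ (jacobian (source q) w₀) d‖ ≤ ‖source q w‖ + 1 / (2 * κ) * ‖d‖ := by
        have := norm_sub_norm_le (mcl ℝ (jacobian (source q) w₀) d) (source q w)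
        rw [norm_sub_rev] at this
        linarith
      have hd4 := mul_le_mul_of_nonneg_left hd3 hκ0.le
      have hd5 : κ * (1 / (2 * κ) * ‖d‖) = ‖d‖ / 2 := by field_simp
      linarith
    · have hpos : 0 < ‖source q w₀‖ := norm_pos_iff.2 h0
      have e1 : ∀ᶠ w in 𝓝 w₀, ‖source q w₀‖ / 2 < ‖source q w‖ :=
        hQc.continuousAt.norm.eventually (lt_mem_nhds (by simpa using half_lt_self hpos))
      set B : ℝ := ‖w₀ - equilibrium vstar (uPart w₀)‖ + 1 with hB
      have e2 : ∀ᶠ w in 𝓝 w₀, ‖w - equilibrium vstar (uPart w)‖ < B :=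
        (continuousAt_id.sub hPc).norm.eventually (gt_mem_nhds (lt_add_one _))
      refine ⟨_, mem_nhdsWithin_of_mem_nhds (e1.and e2), 2 * B / ‖source q w₀‖, ?_⟩
      rintro w ⟨hw1, hw2⟩
      refine hw2.le.trans ?_
      rw [div_mul_eq_mul_div, le_div_iff₀ hpos]
      have hB0 : 0 ≤ B := by positivity
      nlinarith

end Relaxation

/-! ### Estimates for profiles -/

/-- A bounded function decreasing at rate at least `θ n` bounds a primitive of `n`. -/
theorem exists_primitive_bounded {α α' ν : ℝ → ℝ} {θ b : ℝ} (hθ : 0 < θ) (hν : Continuous ν)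
    (hν0 : ∀ x, 0 ≤ ν x) (hα : ∀ x, HasDerivAt α (α' x) x) (hα' : ∀ x, α' x ≤ -(θ * ν x))
    (hb : ∀ x, |α x| ≤ b) :
    ∃ ψ : ℝ → ℝ, (∀ x, HasDerivAt ψ (ν x) x) ∧ (∀ x, |ψ x| ≤ 2 * b / θ) := by
  have hψ : ∀ x, HasDerivAt (fun x => ∫ t in (0 : ℝ)..x, ν t) (ν x) x := fun x =>
    intervalIntegral.integral_hasDerivAt_right (hν.intervalIntegrable _ _)
      (hν.stronglyMeasurableAtFilter _ _) hν.continuousAt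
  set ψ : ℝ → ℝ := fun x => ∫ t in (0 : ℝ)..x, ν t with hψd
  have hψ0 : ψ 0 = 0 := by simp [hψd]
  have hmono : Monotone ψ := monotone_of_deriv_nonneg (fun x => (hψ x).differentiableAt)
    fun x => by rw [(hψ x).deriv]; exact hν0 x
  -- ψ increases while θψ + α decreases, so θ|ψ(x) - ψ(0)| is at most the variation 2b of α.
  have hanti : Antitone fun x => θ * ψ x + α x := by
    have hd := fun x => ((hψ x).const_mul θ).add (hα x)
    refine antitone_of_deriv_nonpos (fun x => (hd x).differentiableAt) fun x => ?_
    refine (hd x).deriv.trans_le ?_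
    linarith [hα' x]
  refine ⟨ψ, hψ, fun x => ?_⟩
  rw [le_div_iff₀ hθ, show |ψ x| * θ = |ψ x * θ| by rw [abs_mul, abs_of_pos hθ], abs_le]
  have b0 := abs_le.1 (hb 0)
  have bx := abs_le.1 (hb x)
  rcases le_total 0 x with hx | hx
  · have h1 := hmono hx
    have h2 := hanti hx
    simp only [hψ0] at h1 h2
    constructor <;> nlinarith
  · have h1 := hmono hx
    have h2 := hanti hx
    simp only [hψ0] at h1 h2
    constructor <;> nlinarith

theorem norm_sub_le_of_deriv_le {X : Type*} [NormedAddCommGroup X] [NormedSpace ℝ X]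
    {f f' : ℝ → X} {g g' : ℝ → ℝ} (hf : ∀ x, HasDerivAt f (f' x) x)
    (hg : ∀ x, HasDerivAt g (g' x) x) (h : ∀ x, ‖f' x‖ ≤ g' x) {x y : ℝ} (hxy : x ≤ y) :
    ‖f y - f x‖ ≤ g y - g x := by
  have hc : ContinuousOn (fun t => f t - f x) (Icc x y) := fun t _ =>
    ((hf t).sub_const (f x)).continuousAt.continuousWithinAt
  exact image_norm_le_of_norm_deriv_right_le_deriv_boundary hc
    (fun t _ => ((hf t).sub_const (f x)).hasDerivWithinAt) (by simp)
    (fun t => (hg t).sub_const (g x)) (fun t _ => h t) (right_mem_Icc.2 hxy)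

section Profile

variable {n r : ℕ} {F : State n r → State n r} {q : State n r → EuclideanSpace ℝ (Fin r)}
  {vstar : EuclideanSpace ℝ (Fin n) → EuclideanSpace ℝ (Fin r)}
  {𝒲 : Set (State n r)} {𝒰 : Set (EuclideanSpace ℝ (Fin n))}

theorem IsProfile.hasDerivAt {W : ℝ → State n r} {Wm Wp : State n r} (hW : IsProfile F q W Wm Wp)
    (x : ℝ) : HasDerivAt W (deriv W x) x :=
  (hW.contDiff.differentiable (by norm_num) x).hasDerivAt

theorem IsProfile.hasDerivAt_deriv {W : ℝ → State n r} {Wm Wp : State n r}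
    (hW : IsProfile F q W Wm Wp) (x : ℝ) : HasDerivAt (deriv W) (deriv (deriv W) x) x := by
  have h : ContDiff ℝ (1 + 1) W := by
    have := hW.contDiff
    rwa [show (2 : WithTop ℕ∞) = 1 + 1 by norm_num] at this
  exact ((contDiff_succ_iff_deriv.1 h).2.2.differentiable one_ne_zero x).hasDerivAt

theorem IsProfile.mcl_jacobian_deriv {W : ℝ → State n r} {Wm Wp : State n r}
    (hS : RelaxationStructure F q vstar 𝒲 𝒰) (hW : IsProfile F q W Wm Wp) {x : ℝ}
    (hx : W x ∈ 𝒲) : mcl ℝ (jacobian F (W x)) (deriv W x) = source q (W x) := by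
  rw [mcl_jacobian]
  have hF := ((hS.contDiffOn_F.contDiffAt (hS.isOpen_W.mem_nhds hx)).differentiableAt
    (by norm_num)).hasFDerivAt
  exact (hF.comp_hasDerivAt x (hW.hasDerivAt x)).unique (hW.equation x)

/-- The profile equation A(W)W' = Q(W) is differentiated once more. The right side is quadratic in
W' or linear in W'', hence O(ε|W'|) for slowly varying profiles. -/
theorem IsProfile.mcl_jacobian_source_deriv {W : ℝ → State n r} {Wm Wp : State n r}
    (hS : RelaxationStructure F q vstar 𝒲 𝒰) (hW : IsProfile F q W Wm Wp)
    (hx : ∀ x, W x ∈ 𝒲) (x : ℝ) :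
    mcl ℝ (jacobian (source q) (W x)) (deriv W x) =
      mcl ℝ (dirMatrix (jacobian F) (W x) (deriv W x)) (deriv W x) +
        mcl ℝ (jacobian F (W x)) (deriv (deriv W) x) := by
  have hQ := ((hS.contDiffOn_q.source.contDiffAt (hS.isOpen_W.mem_nhds (hx x))).differentiableAt
    (by norm_num)).hasFDerivAt
  rw [← mcl_jacobian] at hQ
  have h1 := hQ.comp_hasDerivAt x (hW.hasDerivAt x)
  have h2 := (hS.c1_jacobian_F.hasDerivAt_mcl ℝ hS.isOpen_W (hW.hasDerivAt x) (hx x)).clm_apply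
    (hW.hasDerivAt_deriv x)
  have h3 : (fun x => mcl ℝ (jacobian F (W x)) (deriv W x)) = source q ∘ W :=
    funext fun x => hW.mcl_jacobian_deriv hS (hx x)
  rw [h3] at h2
  exact h1.unique h2

/-- The derivative of a slowly varying profile is slaved to its conserved part, which is nearly
in the kernel of the relaxed flux. -/
theorem RelaxationStructure.exists_deriv_estimates (hS : RelaxationStructure F q vstar 𝒲 𝒰)
    {K : Set (State n r)} (hK : IsCompact K) (hKreg : K ⊆ regularStates q 𝒲 𝒰) {C C₀ : ℝ}
    (hC : 0 < C) (hC₀ : 0 ≤ C₀) :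
    ∃ C₁ ε₁ : ℝ, 0 < C₁ ∧ 0 < ε₁ ∧ ∀ (W : ℝ → State n r) (Wm Wp : State n r) (ε : ℝ),
      IsProfile F q W Wm Wp → (∀ x, W x ∈ K) →
      (∀ x, equilibrium vstar (uPart (W x)) ∈ K) →
      (∀ x, ‖W x - equilibrium vstar (uPart (W x))‖ ≤ C₀ * ‖deriv W x‖) →
      0 ≤ ε → ε ≤ ε₁ → (∀ x, ‖deriv W x‖ ≤ C * ε ^ 2) →
      (∀ x, ‖deriv (deriv W) x‖ ≤ C * ε * ‖deriv W x‖) →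
      ∀ x, ‖deriv W x‖ ≤ C₁ * ‖uPart (deriv W x)‖ ∧
        ‖mcl ℝ (jacobian (relaxedFlux F vstar) (uPart (W x))) (uPart (deriv W x))‖ ≤
          C₁ * ε * ‖uPart (deriv W x)‖ := by
  have hopen := hS.isOpen_regularStates
  obtain ⟨CA, hCA, bA, bA', -⟩ := (hS.c1_jacobian_F.mono regularStates_subset).exists_bounds ℝ
    hopen hK hKreg
  obtain ⟨CE, hCE, bE, -, -⟩ := hS.c1_relaxInv.exists_bounds ℝ hopen hK hKreg
  obtain ⟨CD, hCD, bD, -, -⟩ := hS.c1_slaving.exists_bounds ℝ hopen hK hKreg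
  obtain ⟨CB, hCB, bB, -, -⟩ := hS.c1_coupling.exists_bounds ℝ hopen hK hKreg
  obtain ⟨Cr, hCr, -, -, br⟩ := hS.c1_reduced.exists_bounds ℝ hopen hK hKreg
  -- Tε|W'| bounds dQ(W)W'. The constant C₂ results from solving for the relaxed part of W' and
  -- absorbing CE·T·ε ≤ 1/2. C₃ collects the forcing and the replacement of W by its equilibrium
  -- projection.
  set T := 2 * CA * C with hT
  have hT0 : 0 ≤ T := by positivity
  set C₂ := 2 * (1 + CD) with hC₂
  have hC₂0 : 0 < C₂ := by positivity
  set C₃ := CB * T * C₂ + Cr * C₀ * C with hC₃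
  have hC₃0 : 0 ≤ C₃ := by positivity
  refine ⟨C₂ + C₃, min 1 (1 / (2 * (CE * T + 1))), by positivity, by positivity, ?_⟩
  intro W Wm Wp ε hW hWK hWeK hdist hε hε1 hsize hsecond x
  have hεone : ε ≤ 1 := hε1.trans (min_le_left _ _)
  have hεE : CE * T * ε ≤ 1 / 2 := by
    have := hε1.trans (min_le_right _ _)
    rw [le_div_iff₀ (by positivity)] at this
    linarith
  have hreg := hKreg (hWK x)
  set R := deriv W x with hR
  have hRε : ‖R‖ ≤ C * ε := by
    refine (hsize x).trans ?_
    have : ε ^ 2 ≤ ε := by nlinarith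
    exact mul_le_mul_of_nonneg_left this hC.le
  set u' := fstL ℝ R with hu'
  set τ := sndL ℝ (mcl ℝ (jacobian (source q) (W x)) R) with hτ
  have bτ : ‖τ‖ ≤ T * ε * ‖R‖ := by
    refine (norm_sndL_le ℝ _).trans ?_
    rw [hW.mcl_jacobian_source_deriv hS (fun x => (hKreg (hWK x)).1) x]
    have h1 : ‖mcl ℝ (dirMatrix (jacobian F) (W x) R) R‖ ≤ CA * (C * ε) * ‖R‖ := by
      refine ContinuousLinearMap.le_of_opNorm_le _ ((bA' _ (hWK x) R).trans ?_) R
      exact mul_le_mul_of_nonneg_left hRε hCA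
    have h2 : ‖mcl ℝ (jacobian F (W x)) (deriv (deriv W) x)‖ ≤ CA * (C * ε * ‖R‖) :=
      (ContinuousLinearMap.le_of_opNorm_le _ (bA _ (hWK x)) _).trans
        (mul_le_mul_of_nonneg_left (hsecond x) hCA)
    refine (norm_add_le_of_le h1 h2).trans (le_of_eq ?_)
    rw [hT]; ring
  have bR : ‖R‖ ≤ C₂ * ‖u'‖ := by
    have h1 : ‖sndL ℝ R‖ ≤ CD * ‖u'‖ + CE * (T * ε * ‖R‖) := by
      rw [sndL_eq_of_regular ℝ hreg R]
      refine norm_add_le_of_le ?_ ?_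
      · rw [norm_neg]
        exact ContinuousLinearMap.le_of_opNorm_le _ (bD _ (hWK x)) _
      · exact (ContinuousLinearMap.le_of_opNorm_le _ (bE _ (hWK x)) _).trans
          (mul_le_mul_of_nonneg_left bτ hCE)
    have h2 := norm_le_fstL_add_sndL ℝ R
    have h3 := mul_le_mul_of_nonneg_right hεE (norm_nonneg R)
    have h4 : CE * (T * ε * ‖R‖) = CE * T * ε * ‖R‖ := by ring
    rw [hC₂]
    linarith
  constructor
  · exact bR.trans (mul_le_mul_of_nonneg_right (by linarith) (norm_nonneg _))
  -- The source has no conserved part, so the conserved row of A(W)W' = Q(W) reads a ū' + Bτ = 0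
  -- with τ = O(ε|W'|).
  · have h0 := fstL_mcl_jacobian (F := F) ℝ hreg R
    rw [hW.mcl_jacobian_deriv hS hreg.1, fstL_source] at h0
    have h1 : mcl ℝ (reduced F q (W x)) u' = -mcl ℝ (coupling F q (W x)) τ :=
      eq_neg_of_add_eq_zero_left h0.symm
    have h2 : ‖mcl ℝ (reduced F q (W x)) u'‖ ≤ CB * (T * ε * (C₂ * ‖u'‖)) := by
      rw [h1, norm_neg]
      refine (ContinuousLinearMap.le_of_opNorm_le _ (bB _ (hWK x)) _).trans
        (mul_le_mul_of_nonneg_left (bτ.trans ?_) hCB)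
      exact mul_le_mul_of_nonneg_left bR (by positivity)
    have h3 : ‖mcl ℝ (reduced F q (W x)) - mcl ℝ (reduced F q (equilibrium vstar (uPart (W x))))‖ ≤
        Cr * (C₀ * (C * ε)) :=
      (br _ (hWK x) _ (hWeK x)).trans (mul_le_mul_of_nonneg_left
        ((hdist x).trans (mul_le_mul_of_nonneg_left hRε hC₀)) hCr)
    rw [hS.jacobian_relaxedFlux hreg.2.1]
    have h4 : mcl ℝ (reduced F q (equilibrium vstar (uPart (W x)))) u' =
        mcl ℝ (reduced F q (W x)) u' - (mcl ℝ (reduced F q (W x)) -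
          mcl ℝ (reduced F q (equilibrium vstar (uPart (W x))))) u' := by
      rw [sub_apply]; abel
    change ‖mcl ℝ (reduced F q (equilibrium vstar (uPart (W x)))) u'‖ ≤ _ * ‖u'‖
    rw [h4]
    refine (norm_sub_le _ _).trans ((add_le_add h2
      (ContinuousLinearMap.le_of_opNorm_le _ h3 u')).trans ?_)
    have h5 : 0 ≤ C₂ * (ε * ‖u'‖) := by positivity
    have h6 : CB * (T * ε * (C₂ * ‖u'‖)) + Cr * (C₀ * (C * ε)) * ‖u'‖ = C₃ * (ε * ‖u'‖) := by
      rw [hC₃]; ring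
    rw [h6]
    linarith

/-- Uniform geometry of small-amplitude profiles. -/
theorem RelaxationStructure.exists_profile_estimates (hS : RelaxationStructure F q vstar 𝒲 𝒰)
    {a₀ : EuclideanSpace ℝ (Fin n) → Matrix (Fin n) (Fin n) ℝ}
    {α₀ : EuclideanSpace ℝ (Fin n) → ℝ} {r₀ : EuclideanSpace ℝ (Fin n) → EuclideanSpace ℝ (Fin n)}
    (hf : SymmetrizableField 𝒰 (jacobian (relaxedFlux F vstar)) a₀ α₀ r₀)
    {C : ℝ} (hC : 0 < C) {𝒦 : Set (State n r)} (h𝒦 : IsCompact 𝒦) (h𝒦𝒲 : 𝒦 ⊆ 𝒲)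
    (h𝒦𝒰 : ∀ w ∈ 𝒦, uPart w ∈ 𝒰) :
    ∃ (K : Set (State n r)) (L θ C₁ ε₁ : ℝ), IsCompact K ∧ K ⊆ regularStates q 𝒲 𝒰 ∧ 0 < L ∧
      0 < θ ∧ 0 < C₁ ∧ 0 < ε₁ ∧ ∀ (W : ℝ → State n r) (Wm Wp : State n r) (ε : ℝ),
      IsProfile F q W Wm Wp → (∀ x, W x ∈ 𝒦) → ProfileBounds α₀ r₀ C ε W → 0 ≤ ε → ε ≤ ε₁ →
      (∀ x, W x ∈ K) ∧ (∀ x, equilibrium vstar (uPart (W x)) ∈ K) ∧ Wm ∈ K ∧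
      (∀ x, ‖W x - equilibrium vstar (uPart (W x))‖ ≤ C₁ * ‖deriv W x‖) ∧
      (∀ x, ‖deriv W x‖ ≤ C₁ * ‖uPart (deriv W x)‖) ∧
      (∀ x (y : EuclideanSpace ℂ (Fin n)),
        2⁻¹ * (inner ℂ y (mcl ℂ (dirMatrix (fun u => a₀ u * jacobian (relaxedFlux F vstar) u)
          (uPart (W x)) (uPart (deriv W x))) y)).re
          - L * ‖uPart (deriv W x)‖ * (inner ℂ y (mcl ℂ (a₀ (uPart (W x)) *
            jacobian (relaxedFlux F vstar) (uPart (W x)) *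
            jacobian (relaxedFlux F vstar) (uPart (W x))) y)).re ≤
        -(θ * ‖uPart (deriv W x)‖ * ‖y‖ ^ 2)) ∧
      (∀ x, ‖W x - Wm‖ ≤ C₁ * ε) ∧
      ∃ ψ : ℝ → ℝ, (∀ x, HasDerivAt ψ ‖uPart (deriv W x)‖ x) ∧ ∀ x, |ψ x| ≤ C₁ * ε := by
  obtain ⟨δ, hδ, hδreg⟩ := hS.exists_small_source h𝒦 h𝒦𝒲 h𝒦𝒰
  have hQc : ContinuousOn (fun w => ‖source q w‖) 𝒦 :=
    (hS.contDiffOn_q.source.continuousOn.mono h𝒦𝒲).norm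
  set K₁ := {w ∈ 𝒦 | ‖source q w‖ ≤ δ} with hK₁
  have hK₁c : IsCompact K₁ := by
    have := h𝒦.inter_right (hQc.preimage_isClosed_of_isClosed h𝒦.isClosed (isClosed_Iic (a := δ)))
    convert this using 1
    ext w
    exact ⟨fun h => ⟨h.1, h.1, h.2⟩, fun h => ⟨h.1, h.2.2⟩⟩
  set Kc := (fun w : State n r => fstL ℝ w) '' 𝒦 with hKc
  have hKcc : IsCompact Kc := h𝒦.image (fstL ℝ).continuous
  have hKcU : Kc ⊆ 𝒰 := by
    rintro _ ⟨w, hw, rfl⟩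
    exact h𝒦𝒰 w hw
  have hEc : IsCompact (equilibrium vstar '' Kc) :=
    hKcc.image_of_continuousOn (hS.contDiffOn_equilibrium.continuousOn.mono hKcU)
  -- The projections to equilibrium need not belong to 𝒦, but the estimates compare W with them;
  -- hence the second piece.
  set K := K₁ ∪ equilibrium vstar '' Kc with hK
  have hKcomp : IsCompact K := hK₁c.union hEc
  have hKreg : K ⊆ regularStates q 𝒲 𝒰 := by
    rintro w (hw | ⟨u, hu, rfl⟩)
    · exact hδreg hw
    · exact hS.equilibrium_mem (hKcU hu)
  obtain ⟨CA, hCA, bA, -, -⟩ := hS.c1_jacobian_F.exists_bounds ℝ hS.isOpen_W h𝒦 h𝒦𝒲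
  obtain ⟨Cd, hCd⟩ := hS.exists_dist_equilibrium_le hKcomp hKreg
  obtain ⟨C₂, ε₂, hC₂, hε₂, hder⟩ := hS.exists_deriv_estimates hKcomp hKreg hC
    (show 0 ≤ |Cd| * CA by positivity)
  obtain ⟨L, θ, δ₂, hL, hθ, hδ₂, hgood⟩ := hf.exists_goodman_form hKcc hKcU
  obtain ⟨CJ, hCJ, bJ, -, -⟩ := hf.c1_J.exists_bounds ℝ hS.isOpen_U hKcc hKcU
  set Cα := C₂ + CJ * C with hCα
  have hCα0 : 0 < Cα := by positivity
  set Cψ := 2 * Cα / θ with hCψ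
  have hCψ0 : 0 < Cψ := by positivity
  set C₁ := |Cd| * CA + C₂ + Cψ + 2 * C₂ * Cψ with hC₁
  have hC₁0 : 0 < C₁ := by positivity
  -- In order after 1: the source is small enough for regularity, the estimates on W' apply, |α₀(ū)|
  -- ≤ δ₂, and the direction of ū' is within δ₂ of the oriented eigenvector up to sign.
  set ε₁ := min 1 (min (δ / (CA * C + 1)) (min ε₂ (min (δ₂ / Cα) (δ₂ / C)))) with hε₁
  refine ⟨K, L, θ, C₁, ε₁, hKcomp, hKreg, hL, hθ, hC₁0, by positivity, ?_⟩
  intro W Wm Wp ε hW hW𝒦 hb hε hεle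
  have e1 : ε ≤ 1 := hεle.trans (min_le_left _ _)
  have e2' : ε ≤ min (δ / (CA * C + 1)) (min ε₂ (min (δ₂ / Cα) (δ₂ / C))) :=
    hεle.trans (min_le_right _ _)
  have e2 : ε * (CA * C + 1) ≤ δ := (le_div_iff₀ (by positivity)).1 (e2'.trans (min_le_left _ _))
  have e3' := e2'.trans (min_le_right _ _)
  have e3 : ε ≤ ε₂ := e3'.trans (min_le_left _ _)
  have e4' := e3'.trans (min_le_right _ _)
  have e4 : ε * Cα ≤ δ₂ := (le_div_iff₀ hCα0).1 (e4'.trans (min_le_left _ _))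
  have e5 : ε * C ≤ δ₂ := (le_div_iff₀ hC).1 (e4'.trans (min_le_right _ _))
  have hsq : ε ^ 2 ≤ ε := by nlinarith
  have bQ : ∀ x, ‖source q (W x)‖ ≤ CA * ‖deriv W x‖ := fun x => by
    rw [← hW.mcl_jacobian_deriv hS (h𝒦𝒲 (hW𝒦 x))]
    exact ContinuousLinearMap.le_of_opNorm_le _ (bA _ (hW𝒦 x)) _
  have hWK₁ : ∀ x, W x ∈ K₁ := fun x => by
    refine ⟨hW𝒦 x, (bQ x).trans ?_⟩
    have h1 := mul_le_mul_of_nonneg_left ((hb.size x).trans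
      (mul_le_mul_of_nonneg_left hsq hC.le)) hCA
    linarith
  have hWK : ∀ x, W x ∈ K := fun x => Or.inl (hWK₁ x)
  have hUK : ∀ x, uPart (W x) ∈ Kc := fun x => ⟨W x, hW𝒦 x, rfl⟩
  have hEK : ∀ x, equilibrium vstar (uPart (W x)) ∈ K := fun x =>
    Or.inr ⟨_, hUK x, rfl⟩
  have hdist : ∀ x, ‖W x - equilibrium vstar (uPart (W x))‖ ≤ |Cd| * CA * ‖deriv W x‖ := fun x => by
    refine (hCd _ (hWK x)).trans ?_
    rw [mul_assoc]
    exact mul_le_mul (le_abs_self _) (bQ x) (norm_nonneg _) (abs_nonneg _)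
  have hd := hder W Wm Wp ε hW hWK hEK hdist hε e3 hb.size hb.second
  set U' : ℝ → EuclideanSpace ℝ (Fin n) := fun x => uPart (deriv W x) with hU'
  have hU'0 : ∀ x, 0 < ‖U' x‖ := fun x => norm_pos_iff.2 (hb.ne_zero x)
  have hr : ∀ x, ‖Real.sign (gnlCoeff α₀ r₀ (uPart (W x))) • r₀ (uPart (W x))‖ = 1 ∧
      mcl ℝ (jacobian (relaxedFlux F vstar) (uPart (W x)))
        (Real.sign (gnlCoeff α₀ r₀ (uPart (W x))) • r₀ (uPart (W x))) =
      α₀ (uPart (W x)) • Real.sign (gnlCoeff α₀ r₀ (uPart (W x))) • r₀ (uPart (W x)) := fun x => by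
    have := hf.sign_smul_mem_oriented hKcU (hUK x)
    exact ⟨by simpa using this.1.2, sub_eq_zero.1 this.2.1⟩
  -- The unit vector along ū' is both almost annihilated by J and almost an eigenvector for α₀, each
  -- up to O(ε).
  have bα : ∀ x, |α₀ (uPart (W x))| ≤ Cα * ε := fun x => by
    obtain ⟨hr1, hr2⟩ := hr x
    set ρ := Real.sign (gnlCoeff α₀ r₀ (uPart (W x))) • r₀ (uPart (W x)) with hρ
    have hdir := hb.direction x
    have h1 : ‖mcl ℝ (jacobian (relaxedFlux F vstar) (uPart (W x))) (‖U' x‖⁻¹ • U' x)‖ ≤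
        C₂ * ε := by
      rw [map_smul, norm_smul, norm_inv, norm_norm, inv_mul_le_iff₀ (hU'0 x), mul_comm ‖U' x‖]
      exact (hd x).2
    have h2 : ‖mcl ℝ (jacobian (relaxedFlux F vstar) (uPart (W x))) (‖U' x‖⁻¹ • U' x + ρ)‖ ≤
        CJ * (C * ε) :=
      (ContinuousLinearMap.le_of_opNorm_le _ (bJ _ (hUK x)) _).trans
        (mul_le_mul_of_nonneg_left hdir hCJ)
    have h3 : ‖mcl ℝ (jacobian (relaxedFlux F vstar) (uPart (W x))) ρ‖ = |α₀ (uPart (W x))| := by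
      rw [hr2, norm_smul, hr1, mul_one, Real.norm_eq_abs]
    rw [← h3]
    have h4 : ρ = (‖U' x‖⁻¹ • U' x + ρ) - ‖U' x‖⁻¹ • U' x := by abel
    rw [h4, map_sub]
    refine (norm_sub_le _ _).trans ((add_le_add h2 h1).trans (le_of_eq ?_))
    rw [hCα]; ring
  have hg : ∀ x, _ := fun x => hgood (uPart (W x)) (hUK x)
    ((bα x).trans (by linarith)) (‖U' x‖⁻¹ • U' x) ((hb.direction x).trans (by linarith))
  have hUd : ∀ x, HasDerivAt (fun x => uPart (W x)) (U' x) x := fun x =>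
    (fstL ℝ).hasFDerivAt.comp_hasDerivAt x (hW.hasDerivAt x)
  have hU'e : ∀ x, U' x = ‖U' x‖ • (‖U' x‖⁻¹ • U' x) := fun x => by
    rw [smul_smul, mul_inv_cancel₀ (hU'0 x).ne', one_smul]
  have hdW : Continuous (deriv W) := continuous_iff_continuousAt.2 fun x =>
    (hW.hasDerivAt_deriv x).continuousAt
  -- Compressivity: α₀(ū) decreases at rate at least θ|ū'| and is O(ε), so the arclength ψ of ū is
  -- O(ε) uniformly on the line.
  obtain ⟨ψ, hψ, bψ⟩ := exists_primitive_bounded (α := fun x => α₀ (uPart (W x)))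
    (α' := fun x => fderiv ℝ α₀ (uPart (W x)) (U' x)) (ν := fun x => ‖U' x‖) (b := Cα * ε) hθ
    (((fstL ℝ).continuous.comp hdW).norm) (fun x => norm_nonneg _)
    (fun x => (hf.differentiableAt (hKcU (hUK x))).hasFDerivAt.comp_hasDerivAt x (hUd x))
    (fun x => by
      have h1 := mul_le_mul_of_nonneg_left (hg x).1 (norm_nonneg (U' x))
      rw [← smul_eq_mul, ← map_smul, ← hU'e] at h1
      linarith) bα
  have bψ' : ∀ x, |ψ x| ≤ Cψ * ε := fun x => (bψ x).trans (le_of_eq (by rw [hCψ]; ring))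
  refine ⟨hWK, hEK, ?_, fun x => (hdist x).trans (mul_le_mul_of_nonneg_right ?_ (norm_nonneg _)),
    fun x => (hd x).1.trans (mul_le_mul_of_nonneg_right ?_ (norm_nonneg _)), fun x y => ?_,
    fun x => ?_, ψ, hψ, fun x => (bψ' x).trans (mul_le_mul_of_nonneg_right ?_ hε)⟩
  · exact Or.inl (hK₁c.isClosed.mem_of_tendsto hW.tendsto_atBot (Eventually.of_forall hWK₁))
  · rw [hC₁]; linarith [show 0 ≤ 2 * C₂ * Cψ by positivity]
  · rw [hC₁]; linarith [show 0 ≤ 2 * C₂ * Cψ by positivity, show 0 ≤ |Cd| * CA by positivity]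
  · have h1 := mul_le_mul_of_nonneg_left ((hg x).2 y) (norm_nonneg (U' x))
    have h2 : dirMatrix (fun u => a₀ u * jacobian (relaxedFlux F vstar) u) (uPart (W x)) (U' x) =
        ‖U' x‖ • dirMatrix (fun u => a₀ u * jacobian (relaxedFlux F vstar) u) (uPart (W x))
          (‖U' x‖⁻¹ • U' x) := by
      rw [← dirMatrix_smul, ← hU'e]
    change 2⁻¹ * (inner ℂ y (mcl ℂ (dirMatrix _ _ (U' x)) y)).re - L * ‖U' x‖ * _ ≤
      -(θ * ‖U' x‖ * ‖y‖ ^ 2)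
    rw [h2, mcl_smul, smul_apply, ← Complex.coe_smul, inner_smul_right, Complex.re_ofReal_mul]
    linarith
  -- |W'| is at most C₂ψ', so increments of W are bounded by those of ψ; the limit y → -∞ brings in
  -- the end state.
  · have h1 : ∀ y ≤ x, ‖W x - W y‖ ≤ C₁ * ε := fun y hy => by
      have h2 := norm_sub_le_of_deriv_le (f := W) (g := fun x => C₂ * ψ x) hW.hasDerivAt
        (fun x => (hψ x).const_mul C₂) (fun x => (hd x).1) hy
      have h3 := (abs_le.1 (bψ' x)).2
      have h4 := (abs_le.1 (bψ' y)).1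
      have h5 : C₂ * (ψ x - ψ y) ≤ C₂ * (2 * (Cψ * ε)) :=
        mul_le_mul_of_nonneg_left (by linarith) hC₂.le
      have h6 : 2 * C₂ * Cψ * ε ≤ C₁ * ε := by
        refine mul_le_mul_of_nonneg_right ?_ hε
        rw [hC₁]; linarith [show 0 ≤ |Cd| * CA by positivity]
      linarith
    exact le_of_tendsto (tendsto_const_nhds.sub hW.tendsto_atBot).norm
      ((eventually_le_atBot x).mono h1)
  · rw [hC₁]; linarith [show 0 ≤ 2 * C₂ * Cψ by positivity, show 0 ≤ |Cd| * CA by positivity]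

end Profile

/-! ### Uniform C¹ bounds for coefficients along a profile -/

section Coefficients

variable {X ι κ : Type*} [NormedAddCommGroup X] [NormedSpace ℝ X] [Fintype ι] [Fintype κ]
  [DecidableEq ι] [DecidableEq κ]

/-- `C` bounds `G`, its derivative and its Lipschitz constant on `K`. -/
structure C1BoundOn (G : X → Matrix κ ι ℝ) (K : Set X) (C : ℝ) : Prop where
  norm_le : ∀ w ∈ K, ‖mcl ℂ (G w)‖ ≤ C
  norm_dirMatrix_le : ∀ w ∈ K, ∀ e, ‖mcl ℂ (dirMatrix G w e)‖ ≤ C * ‖e‖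
  norm_sub_le : ∀ w ∈ K, ∀ w' ∈ K, ‖mcl ℂ (G w) - mcl ℂ (G w')‖ ≤ C * ‖w - w'‖

/-- Stated for all large constants, so that finitely many coefficients obtain a common bound by
intersecting events. -/
theorem C1MatrixOn.eventually_bound {G : X → Matrix κ ι ℝ} {s K : Set X} (hG : C1MatrixOn G s)
    (hs : IsOpen s) (hK : IsCompact K) (hKs : K ⊆ s) : ∀ᶠ C in atTop, C1BoundOn G K C := by
  obtain ⟨C₀, h0, h1, h2, h3⟩ := hG.exists_bounds ℂ hs hK hKs
  filter_upwards [eventually_ge_atTop C₀] with C hC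
  exact ⟨fun w hw => (h1 w hw).trans hC,
    fun w hw e => (h2 w hw e).trans (by gcongr),
    fun w hw w' hw' => (h3 w hw w' hw').trans (by gcongr)⟩

/-- The derivative along a curve of a matrix function corrected by a small multiple of another. -/
theorem C1MatrixOn.exists_hasDerivAt_sub_smul {G₀ G₁ : X → Matrix κ ι ℝ} {s K : Set X}
    (h0 : C1MatrixOn G₀ s) (h1 : C1MatrixOn G₁ s) (hs : IsOpen s) (hKs : K ⊆ s) {C Λ ρ : ℝ}
    (b0 : C1BoundOn G₀ K C) (b1 : C1BoundOn G₁ K C) {W : ℝ → X} {W' : X} {Ψ : ℝ → ℝ} {Ψ' x : ℝ}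
    (hW : HasDerivAt W W' x) (hx : W x ∈ K) (hΨ : HasDerivAt Ψ Ψ' x) (hρ : ‖W'‖ ≤ ρ)
    (hΛ : |Ψ x| ≤ Λ) (hΛ' : |Ψ'| ≤ Λ * ρ) :
    ∃ T' : EuclideanSpace ℂ ι →L[ℂ] EuclideanSpace ℂ κ,
      HasDerivAt (fun t => mcl ℂ (G₀ (W t)) - Ψ t • mcl ℂ (G₁ (W t))) T' x ∧
      ‖T'‖ ≤ (1 + 2 * Λ) * C * ρ := by
  refine ⟨_, (h0.hasDerivAt_mcl ℂ hs hW (hKs hx)).sub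
    (hΨ.smul (h1.hasDerivAt_mcl ℂ hs hW (hKs hx))), ?_⟩
  have hC : 0 ≤ C := (norm_nonneg _).trans (b0.norm_le _ hx)
  have hΛ0 : 0 ≤ Λ := (abs_nonneg _).trans hΛ
  have e0 : ‖mcl ℂ (dirMatrix G₀ (W x) W')‖ ≤ C * ρ :=
    (b0.norm_dirMatrix_le _ hx W').trans (by gcongr)
  have e1 : ‖Ψ x • mcl ℂ (dirMatrix G₁ (W x) W')‖ ≤ Λ * (C * ρ) := by
    rw [norm_smul, Real.norm_eq_abs]
    exact mul_le_mul hΛ ((b1.norm_dirMatrix_le _ hx W').trans (by gcongr)) (norm_nonneg _) hΛ0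
  have e2 : ‖Ψ' • mcl ℂ (G₁ (W x))‖ ≤ Λ * ρ * C := by
    rw [norm_smul, Real.norm_eq_abs]
    exact mul_le_mul hΛ' (b1.norm_le _ hx) (norm_nonneg _) ((abs_nonneg _).trans hΛ')
  refine (norm_sub_le _ _).trans ((add_le_add e0 ((norm_add_le _ _).trans (add_le_add e1 e2))).trans
    (le_of_eq ?_))
  ring

end Coefficients

/-! ### Regularity of eigenfunctions and the symmetrized energy estimate -/

variable {n r : ℕ} {F : State n r → State n r} {q : State n r → EuclideanSpace ℝ (Fin r)}
  {vstar : EuclideanSpace ℝ (Fin n) → EuclideanSpace ℝ (Fin r)}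
  {𝒲 : Set (State n r)} {𝒰 : Set (EuclideanSpace ℝ (Fin n))}

/-- An `H¹` eigenfunction has a continuous representative for which the eigenvalue equation holds
in the classical sense. -/
theorem SolvesEigenvalueEq.exists_continuous_ae_eq {W : ℝ → State n r} {z : ℂ}
    {w : ℝ → EuclideanSpace ℂ (Fin n ⊕ Fin r)} (h : SolvesEigenvalueEq F (source q) W z w)
    (hw : MemH1 w) (hS : RelaxationStructure F q vstar 𝒲 𝒰) (hW : Continuous W)
    (hx : ∀ x, W x ∈ 𝒲) :
    ∃ w' : ℝ → EuclideanSpace ℂ (Fin n ⊕ Fin r), Continuous w' ∧ w =ᵐ[volume] w' ∧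
      Integrable (fun x => ‖w' x‖ ^ 2) ∧
      ∀ x, HasDerivAt (fun t => mcl ℂ (jacobian F (W t)) (w' t))
        (mcl ℂ (jacobian (source q) (W x)) (w' x) - z • w' x) x := by
  obtain ⟨w', hc, hae⟩ := hw.exists_continuous_ae_eq
  have cF : Continuous fun x => mcl ℂ (jacobian F (W x)) :=
    (hS.c1_jacobian_F.contDiffOn_mcl ℂ).continuousOn.comp_continuous hW hx
  have cQ : Continuous fun x => mcl ℂ (jacobian (source q) (W x)) :=
    (hS.c1_jacobian_source.contDiffOn_mcl ℂ).continuousOn.comp_continuous hW hx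
  refine ⟨w', hc, hae, ?_, ?_⟩
  · exact (memLp_two_iff_integrable_sq_norm hc.aestronglyMeasurable).1 (hw.1.ae_eq hae)
  · refine HasWeakDeriv.hasDerivAt (HasWeakDeriv.congr_ae h ?_ ?_) (cF.clm_apply hc)
      ((cQ.clm_apply hc).sub (hc.const_smul z))
    · filter_upwards [hae] with x hx
      rw [hx]; rfl
    · filter_upwards [hae] with x hx
      rw [hx]; rfl

theorem DissipativeAt.re_inner_le {A₀ : State n r → Matrix (Fin n ⊕ Fin r) (Fin n ⊕ Fin r) ℝ}
    {c : ℝ} {w : State n r} (h : DissipativeAt q A₀ c w) (y : EuclideanSpace ℂ (Fin n ⊕ Fin r)) :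
    (inner ℂ y (mcl ℂ (A₀ w * jacobian (source q) w) y)).re ≤
      -c * ‖mcl ℂ (jacobian (source q) w) y‖ ^ 2 := by
  have h1 := h (reVec y)
  have h2 := h (imVec y)
  simp only [toEuclideanLin_eq_mcl] at h1 h2
  rw [re_inner_mcl, norm_sq_mcl]
  linarith

theorem abs_re_inner_clm_sub_le {E : Type*} [NormedAddCommGroup E] [InnerProductSpace ℂ E]
    {M M' : E →L[ℂ] E} {δ : ℝ} (h : ‖M - M'‖ ≤ δ) (y : E) :
    |(inner ℂ y (M y)).re - (inner ℂ y (M' y)).re| ≤ δ * ‖y‖ ^ 2 := by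
  have h1 := abs_re_inner_clm_le (M - M') y y le_rfl h le_rfl
  rw [_root_.sub_apply, inner_sub_right, Complex.sub_re] at h1
  exact h1.trans (le_of_eq (by ring))

/-- The basic energy estimate of the symmetrized system along a small profile. -/
theorem IsSymmetrizer.exists_energy_estimate
    {A₀ : State n r → Matrix (Fin n ⊕ Fin r) (Fin n ⊕ Fin r) ℝ} (hA : IsSymmetrizer F 𝒲 A₀)
    (hS : RelaxationStructure F q vstar 𝒲 𝒰) {K : Set (State n r)} (hK : IsCompact K)
    (hK𝒲 : K ⊆ 𝒲) {c : ℝ} (hc : 0 < c) :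
    ∃ C m : ℝ, 0 ≤ C ∧ 0 < m ∧ (∀ w ∈ K, ‖mcl ℂ (A₀ w * jacobian F w)‖ ≤ C) ∧
      ∀ (W : ℝ → State n r) (W' Wm : State n r)
        (w : ℝ → EuclideanSpace ℂ (Fin n ⊕ Fin r)) (z : ℂ) (x : ℝ), 0 ≤ z.re →
        HasDerivAt W W' x → (∀ t, W t ∈ K) → Wm ∈ K → DissipativeAt q A₀ c Wm → Continuous w →
        HasDerivAt (fun t => mcl ℂ (jacobian F (W t)) (w t))
          (mcl ℂ (jacobian (source q) (W x)) (w x) - z • w x) x →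
        ∃ p' : ℝ, HasDerivAt (fun t => 2⁻¹ *
            (inner ℂ (w t) (mcl ℂ (A₀ (W t) * jacobian F (W t)) (w t))).re) p' x ∧
          p' ≤ -(m * z.re * ‖w x‖ ^ 2) - c * ‖mcl ℂ (jacobian (source q) (W x)) (w x)‖ ^ 2 +
            C * (‖W'‖ + ‖W x - Wm‖) * ‖w x‖ ^ 2 := by
  have cA : C1MatrixOn A₀ 𝒲 := .of_smooth hA.smooth
  have cAF := cA.mul hS.c1_jacobian_F
  have cAQ := cA.mul hS.c1_jacobian_source
  obtain ⟨C, b1, b2, b3, b4, b5, hC⟩ :=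
    ((cA.eventually_bound hS.isOpen_W hK hK𝒲).and
    ((hS.c1_jacobian_F.eventually_bound hS.isOpen_W hK hK𝒲).and
    ((hS.c1_jacobian_source.eventually_bound hS.isOpen_W hK hK𝒲).and
    ((cAF.eventually_bound hS.isOpen_W hK hK𝒲).and
    ((cAQ.eventually_bound hS.isOpen_W hK hK𝒲).and (eventually_ge_atTop 1)))))).exists
  obtain ⟨m, hm, hpos⟩ := exists_forall_mul_norm_sq_le hK (M := A₀)
    (fun i j => (cA i j).continuousOn.mono hK𝒲) fun w hw => symPart_posDef (hA.posDef w (hK𝒲 hw))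
  have hC0 : 0 ≤ C := by linarith
  refine ⟨C * C + C + 2 * c * C * C, m, by positivity, hm,
    fun w hw => (b4.norm_le w hw).trans ?_, ?_⟩
  · nlinarith [mul_nonneg hC0 hC0, mul_nonneg (mul_nonneg hc.le hC0) hC0]
  intro W W' Wm w z x hz hW hWK hWm hdis hw hAw
  have hsym : ∀ t y y', inner ℂ (mcl ℂ (A₀ (W t) * jacobian F (W t)) y) y' =
      inner ℂ y (mcl ℂ (A₀ (W t) * jacobian F (W t)) y') := fun t y y' =>
    inner_mcl_of_isSymm ℂ (hA.symm _ (hK𝒲 (hWK t))) y y'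
  have dA := cA.hasDerivAt_mcl ℂ hS.isOpen_W hW (hK𝒲 (hWK x))
  have dAF := cAF.hasDerivAt_mcl ℂ hS.isOpen_W hW (hK𝒲 (hWK x))
  have dg := dA.complexCLM_apply hAw
  have e : (fun t => mcl ℂ (A₀ (W t)) (mcl ℂ (jacobian F (W t)) (w t))) =
      fun t => mcl ℂ (A₀ (W t) * jacobian F (W t)) (w t) := by
    funext t
    rw [mcl_mul]
    rfl
  rw [e] at dg
  -- Only Aw is known to be differentiable, and A may be singular; symmetry of A₀A is what makes the
  -- energy differentiable all the same.
  have dp := (hasDerivAt_re_inner_symmetric hsym hw.continuousAt dAF dg).const_mul (2⁻¹ : ℝ)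
  refine ⟨_, dp, ?_⟩
  generalize w x = y
  have i1 := (abs_le.1 (abs_re_inner_clm_le (mcl ℂ (dirMatrix A₀ (W x) W')) y
    (mcl ℂ (jacobian F (W x)) y) le_rfl (b1.norm_dirMatrix_le _ (hWK x) W')
    ((mcl ℂ (jacobian F (W x))).le_of_opNorm_le (b2.norm_le _ (hWK x)) y))).2
  have i2 := (abs_le.1 (abs_re_inner_clm_le
    (mcl ℂ (dirMatrix (fun w => A₀ w * jacobian F w) (W x) W')) y y le_rfl
    (b4.norm_dirMatrix_le _ (hWK x) W') le_rfl)).1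
  have i3 : m * z.re * ‖y‖ ^ 2 ≤ (inner ℂ y (mcl ℂ (A₀ (W x)) (z • y))).re := by
    have hs : (A₀ (W x)).IsSymm := by
      have := (hA.posDef _ (hK𝒲 (hWK x))).isHermitian
      rwa [Matrix.IsHermitian, Matrix.conjTranspose_eq_transpose_of_trivial] at this
    have him : (inner ℂ y (mcl ℂ (A₀ (W x)) y)).im = 0 := by
      have h := inner_mcl_of_isSymm ℂ hs y y
      rw [← inner_conj_symm, Complex.ext_iff] at h
      have := h.2
      rw [Complex.conj_im] at this
      linarith
    rw [map_smul, inner_smul_right, Complex.mul_re, him]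
    nlinarith [hpos _ (hWK x) y]
  -- Dissipativity is available only at the end state, so A₀dQ and dQ at W(x) are replaced by their
  -- values there at a cost proportional to the distance.
  have i4 := (abs_le.1 (abs_re_inner_clm_sub_le (b5.norm_sub_le _ (hWK x) _ hWm) y)).2
  have i5 := hdis.re_inner_le y
  have i6 : ‖mcl ℂ (jacobian (source q) (W x)) y‖ ^ 2 -
      ‖mcl ℂ (jacobian (source q) Wm) y‖ ^ 2 ≤ 2 * C * C * ‖W x - Wm‖ * ‖y‖ ^ 2 := by
    have h1 := (mcl ℂ (jacobian (source q) (W x))).le_of_opNorm_le (b3.norm_le _ (hWK x)) y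
    have h2 := (mcl ℂ (jacobian (source q) Wm)).le_of_opNorm_le (b3.norm_le _ hWm) y
    have h3 := (mcl ℂ (jacobian (source q) (W x)) -
      mcl ℂ (jacobian (source q) Wm)).le_of_opNorm_le (b3.norm_sub_le _ (hWK x) _ hWm) y
    rw [_root_.sub_apply] at h3
    have h4 := (norm_sub_norm_le _ _).trans h3
    calc _ = (‖mcl ℂ (jacobian (source q) (W x)) y‖ - ‖mcl ℂ (jacobian (source q) Wm) y‖) *
          (‖mcl ℂ (jacobian (source q) (W x)) y‖ + ‖mcl ℂ (jacobian (source q) Wm) y‖) := by ring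
      _ ≤ (C * ‖W x - Wm‖ * ‖y‖) * (C * ‖y‖ + C * ‖y‖) := by gcongr
      _ = _ := by ring
  have i7 := mul_le_mul_of_nonneg_left i6 hc.le
  have e2 : (inner ℂ y (mcl ℂ (A₀ (W x) * jacobian (source q) (W x)) y)).re =
      (inner ℂ y (mcl ℂ (A₀ (W x)) (mcl ℂ (jacobian (source q) (W x)) y))).re := by
    rw [mcl_mul]
    rfl
  rw [e2] at i4
  rw [inner_add_right, map_sub, inner_sub_right, Complex.add_re, Complex.sub_re]
  have j1 : 0 ≤ C * ‖W'‖ * ‖y‖ ^ 2 := by positivity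
  have j2 : 0 ≤ C * C * ‖W x - Wm‖ * ‖y‖ ^ 2 := by positivity
  have j3 : 0 ≤ c * C * C * ‖W'‖ * ‖y‖ ^ 2 := by positivity
  linarith [i1, i2, i3, i4, i5, i7]

/-! ### Coefficients of the equations in slow variables -/

variable {n r : ℕ} {F : State n r → State n r} {q : State n r → EuclideanSpace ℝ (Fin r)}
  {vstar : EuclideanSpace ℝ (Fin n) → EuclideanSpace ℝ (Fin r)}
  {𝒲 : Set (State n r)} {𝒰 : Set (EuclideanSpace ℝ (Fin n))}
  {a₀ k : EuclideanSpace ℝ (Fin n) → Matrix (Fin n) (Fin n) ℝ}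

theorem RelaxationStructure.c1_jacobian_relaxedFlux (hS : RelaxationStructure F q vstar 𝒲 𝒰) :
    C1MatrixOn (jacobian (relaxedFlux F vstar)) 𝒰 :=
  (hS.c1_reduced.comp hS.contDiffOn_equilibrium fun _ hu => hS.equilibrium_mem hu).congr
    fun _ hu => hS.jacobian_relaxedFlux hu

theorem ReducedSymmetrizer.symmetrizableField {α₀ : EuclideanSpace ℝ (Fin n) → ℝ}
    {r₀ : EuclideanSpace ℝ (Fin n) → EuclideanSpace ℝ (Fin n)} {c₀ : ℝ}
    (hB1 : ReducedSymmetrizer F q vstar 𝒰 a₀) (hS : RelaxationStructure F q vstar 𝒲 𝒰)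
    (hB3 : PrincipalField F vstar 𝒰 c₀ α₀ r₀) :
    SymmetrizableField 𝒰 (jacobian (relaxedFlux F vstar)) a₀ α₀ r₀ where
  isOpen := hS.isOpen_U
  c1_J := hS.c1_jacobian_relaxedFlux
  c1_a := .of_smooth hB1.smooth
  posDef := hB1.posDef
  symm := hB1.symm
  simple := hB3.simple
  unit := hB3.unit
  eigen := hB3.eigen
  gnl := hB3.genuinelyNonlinear

theorem C1MatrixOn.comp_uPart {ι κ : Type*} {A : EuclideanSpace ℝ (Fin n) → Matrix κ ι ℝ}
    (hA : C1MatrixOn A 𝒰) : C1MatrixOn (fun w => A (uPart w)) (regularStates q 𝒲 𝒰) :=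
  hA.comp (f := fun w : State n r => fstL ℝ w) (fstL ℝ).contDiff.contDiffOn fun _ hw => hw.2.1

variable (F q vstar a₀ k) in
/-- The leading part of the matrix whose definiteness gives the Kawashima-type estimate. -/
noncomputable def kawashimaMatrix (w : State n r) : Matrix (Fin n) (Fin n) ℝ :=
  k (uPart w) * reduced F q w - a₀ (uPart w) * coupling F q w *
    ((jacobian F w).toBlocks₂₁ - (jacobian F w).toBlocks₂₂ * slaving q w) -
    a₀ (uPart w) * coupling F q w * (slaving q w * reduced F q w)

variable (F q vstar a₀) in
/-- The correction of `kawashimaMatrix` due to the weight. -/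
noncomputable def kawashimaCorrection (w : State n r) : Matrix (Fin n) (Fin n) ℝ :=
  a₀ (uPart w) * jacobian (relaxedFlux F vstar) (uPart w) * coupling F q w *
    ((jacobian F w).toBlocks₂₁ - (jacobian F w).toBlocks₂₂ * slaving q w) +
    a₀ (uPart w) * jacobian (relaxedFlux F vstar) (uPart w) * coupling F q w *
      (slaving q w * reduced F q w)

/-- At equilibrium the reduced matrix is df*, and the coupling applied to c + q₂⁻¹q₁a is minus the
viscosity. The form produced by `energy_identity` is therefore the one assumed definite in B2. -/
theorem RelaxationStructure.kawashimaMatrix_equilibrium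
    (hS : RelaxationStructure F q vstar 𝒲 𝒰) {u : EuclideanSpace ℝ (Fin n)} (hu : u ∈ 𝒰) :
    kawashimaMatrix F q a₀ k (equilibrium vstar u) =
      k u * jacobian (relaxedFlux F vstar) u + a₀ u * viscosity F q vstar u := by
  have hu' : uPart (equilibrium vstar u) = u := rfl
  rw [kawashimaMatrix, hu', hS.jacobian_relaxedFlux hu, viscosity]
  simp only [reduced, coupling, slaving, relaxInv]
  simp only [Matrix.mul_assoc, Matrix.mul_neg, Matrix.mul_add, Matrix.mul_sub]
  abel

section

variable (F q vstar a₀ k)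

/-- Bounds on a set `K` of states for the coefficients of the linearized equations in slow
variables. -/
structure SlowBounds (K : Set (State n r)) (C m θ : ℝ) : Prop where
  flux : C1BoundOn (jacobian F) K C
  relax : C1BoundOn (jacobian (source q)) K C
  flux₂₁ : C1BoundOn (fun w => (jacobian F w).toBlocks₂₁) K C
  flux₂₂ : C1BoundOn (fun w => (jacobian F w).toBlocks₂₂) K C
  reduced : C1BoundOn (reduced F q) K C
  coupling : C1BoundOn (coupling F q) K C
  slaving : C1BoundOn (slaving q) K C
  relaxInv : C1BoundOn (relaxInv q) K C
  compensator : C1BoundOn (fun w => k (uPart w)) K C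
  symm₀ : C1BoundOn (fun w => a₀ (uPart w) * jacobian (relaxedFlux F vstar) (uPart w)) K C
  symm₁ : C1BoundOn (fun w => a₀ (uPart w) * jacobian (relaxedFlux F vstar) (uPart w) *
    jacobian (relaxedFlux F vstar) (uPart w)) K C
  coupling₀ : C1BoundOn (fun w => a₀ (uPart w) * _root_.coupling F q w) K C
  coupling₁ : C1BoundOn (fun w => a₀ (uPart w) * jacobian (relaxedFlux F vstar) (uPart w) *
    _root_.coupling F q w) K C
  slaved₀ : C1BoundOn (fun w => a₀ (uPart w) * _root_.coupling F q w * _root_.slaving q w) K C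
  slaved₁ : C1BoundOn (fun w => a₀ (uPart w) * jacobian (relaxedFlux F vstar) (uPart w) *
    _root_.coupling F q w * _root_.slaving q w) K C
  weight_pos : ∀ w ∈ K, ∀ y : EuclideanSpace ℂ (Fin n),
    m * ‖y‖ ^ 2 ≤ (inner ℂ y (mcl ℂ (a₀ (uPart w)) y)).re
  commutator : ∀ w ∈ K, equilibrium vstar (uPart w) ∈ K → ∀ Ψ : ℝ,
    ‖(mcl ℂ (a₀ (uPart w)) - Ψ • mcl ℂ (a₀ (uPart w) *
        jacobian (relaxedFlux F vstar) (uPart w))).comp (mcl ℂ (_root_.reduced F q w)) -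
      (mcl ℂ (a₀ (uPart w) * jacobian (relaxedFlux F vstar) (uPart w)) -
        Ψ • mcl ℂ (a₀ (uPart w) * jacobian (relaxedFlux F vstar) (uPart w) *
          jacobian (relaxedFlux F vstar) (uPart w)))‖ ≤
      (1 + |Ψ|) * C * (C * ‖w - equilibrium vstar (uPart w)‖)
  kawashima : ∀ w ∈ K, equilibrium vstar (uPart w) ∈ K → ∀ (Ψ : ℝ) (y : EuclideanSpace ℂ (Fin n)),
    θ * ‖y‖ ^ 2 - C * (‖w - equilibrium vstar (uPart w)‖ + |Ψ|) * ‖y‖ ^ 2 ≤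
      (inner ℂ y (((mcl ℂ (k (uPart w))).comp (mcl ℂ (_root_.reduced F q w)) -
        (mcl ℂ (a₀ (uPart w) * _root_.coupling F q w) - Ψ • mcl ℂ (a₀ (uPart w) *
          jacobian (relaxedFlux F vstar) (uPart w) * _root_.coupling F q w)).comp
          (mcl ℂ (jacobian F w).toBlocks₂₁ -
            (mcl ℂ (jacobian F w).toBlocks₂₂).comp (mcl ℂ (_root_.slaving q w))) -
        (mcl ℂ (a₀ (uPart w) * _root_.coupling F q w) - Ψ • mcl ℂ (a₀ (uPart w) *
          jacobian (relaxedFlux F vstar) (uPart w) * _root_.coupling F q w)).comp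
          ((mcl ℂ (_root_.slaving q w)).comp (mcl ℂ (_root_.reduced F q w)))) y)).re

end

/-- Besides bounds by compactness, two facts are needed. The commutator is N composed with the
difference of the reduced matrices at w and at its equilibrium projection, hence Lipschitz-small.
The Kawashima form differs from its definite value at equilibrium by a Lipschitz error and a term
linear in Ψ. -/
theorem RelaxationStructure.exists_slowBounds (hS : RelaxationStructure F q vstar 𝒲 𝒰)
    (hB1 : ReducedSymmetrizer F q vstar 𝒰 a₀) (hB2 : ReducedKawashima F q vstar 𝒰 a₀ k)
    {K : Set (State n r)} (hK : IsCompact K) (hKreg : K ⊆ regularStates q 𝒲 𝒰) :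
    ∃ C m θ : ℝ, 1 ≤ C ∧ 0 < m ∧ 0 < θ ∧ SlowBounds F q vstar a₀ k K C m θ := by
  have ho := hS.isOpen_regularStates
  have ca : C1MatrixOn (fun w => a₀ (uPart w)) (regularStates q 𝒲 𝒰) :=
    (C1MatrixOn.of_smooth hB1.smooth).comp_uPart
  have ck : C1MatrixOn (fun w => k (uPart w)) (regularStates q 𝒲 𝒰) :=
    (C1MatrixOn.of_smooth hB2.smooth).comp_uPart
  have cJ : C1MatrixOn (fun w => jacobian (relaxedFlux F vstar) (uPart w))
    (regularStates q 𝒲 𝒰) := hS.c1_jacobian_relaxedFlux.comp_uPart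
  have cF := hS.c1_jacobian_F.mono (regularStates_subset (q := q) (𝒰 := 𝒰))
  have cQ := hS.c1_jacobian_source.mono (regularStates_subset (q := q) (𝒰 := 𝒰))
  have c21 : C1MatrixOn (fun w => (jacobian F w).toBlocks₂₁) (regularStates q 𝒲 𝒰) :=
    fun _ _ => cF _ _
  have c22 : C1MatrixOn (fun w => (jacobian F w).toBlocks₂₂) (regularStates q 𝒲 𝒰) :=
    fun _ _ => cF _ _
  have cR := hS.c1_reduced
  have cB := hS.c1_coupling
  have cD := hS.c1_slaving
  have cP : C1MatrixOn (kawashimaMatrix F q a₀ k) (regularStates q 𝒲 𝒰) :=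
    ((ck.mul cR).sub ((ca.mul cB).mul (c21.sub (c22.mul cD)))).sub ((ca.mul cB).mul (cD.mul cR))
  have cP' : C1MatrixOn (kawashimaCorrection F q vstar a₀) (regularStates q 𝒲 𝒰) :=
    (((ca.mul cJ).mul cB).mul (c21.sub (c22.mul cD))).add (((ca.mul cJ).mul cB).mul (cD.mul cR))
  obtain ⟨m, hm, hpos⟩ := exists_forall_mul_norm_sq_le hK (M := fun w => a₀ (uPart w))
    (fun i j => (ca i j).continuousOn.mono hKreg)
    fun w hw => symPart_posDef (hB1.posDef _ (hKreg hw).2.1)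
  have hKu : IsCompact ((fun w : State n r => fstL ℝ w) '' K) := hK.image (fstL ℝ).continuous
  have hKu' : (fun w : State n r => fstL ℝ w) '' K ⊆ 𝒰 := by
    rintro _ ⟨w, hw, rfl⟩
    exact (hKreg hw).2.1
  have cPe : C1MatrixOn (fun u => kawashimaMatrix F q a₀ k (equilibrium vstar u)) 𝒰 :=
    cP.comp hS.contDiffOn_equilibrium fun _ hu => hS.equilibrium_mem hu
  obtain ⟨θ, hθ, hkaw⟩ := exists_forall_mul_norm_sq_le hKu
    (M := fun u => kawashimaMatrix F q a₀ k (equilibrium vstar u))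
    (fun i j => (cPe i j).continuousOn.mono hKu') fun u hu => by
      rw [hS.kawashimaMatrix_equilibrium (hKu' hu)]
      exact hB2.pos u (hKu' hu)
  obtain ⟨C, b1, b2, b3, b4, b5, b6, b7, b8, b9, b10, b11, b12, b13, b14, b15, b16, b17, b18, hC⟩ :=
    ((cF.eventually_bound ho hK hKreg).and <| (cQ.eventually_bound ho hK hKreg).and <|
    (c21.eventually_bound ho hK hKreg).and <| (c22.eventually_bound ho hK hKreg).and <|
    (cR.eventually_bound ho hK hKreg).and <| (cB.eventually_bound ho hK hKreg).and <|
    (cD.eventually_bound ho hK hKreg).and <| (hS.c1_relaxInv.eventually_bound ho hK hKreg).and <|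
    (ck.eventually_bound ho hK hKreg).and <| ((ca.mul cJ).eventually_bound ho hK hKreg).and <|
    (((ca.mul cJ).mul cJ).eventually_bound ho hK hKreg).and <|
    ((ca.mul cB).eventually_bound ho hK hKreg).and <|
    (((ca.mul cJ).mul cB).eventually_bound ho hK hKreg).and <|
    (((ca.mul cB).mul cD).eventually_bound ho hK hKreg).and <|
    ((((ca.mul cJ).mul cB).mul cD).eventually_bound ho hK hKreg).and <|
    (cP.eventually_bound ho hK hKreg).and <| (cP'.eventually_bound ho hK hKreg).and <|
    (ca.eventually_bound ho hK hKreg).and <| eventually_ge_atTop 1).exists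
  refine ⟨C, m, θ, hC, hm, hθ, b1, b2, b3, b4, b5, b6, b7, b8, b9, b10, b11, b12, b13, b14, b15,
    hpos, fun w hw hwe Ψ => ?_, fun w hw hwe Ψ y => ?_⟩
  · have hJ : jacobian (relaxedFlux F vstar) (uPart w) =
        reduced F q (equilibrium vstar (uPart w)) := hS.jacobian_relaxedFlux (hKreg hw).2.1
    have hN : ‖mcl ℂ (a₀ (uPart w)) - Ψ • mcl ℂ (a₀ (uPart w) *
        jacobian (relaxedFlux F vstar) (uPart w))‖ ≤ (1 + |Ψ|) * C := by
      refine (norm_sub_le _ _).trans ?_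
      rw [norm_smul, Real.norm_eq_abs]
      have := mul_le_mul_of_nonneg_left (b10.norm_le w hw) (abs_nonneg Ψ)
      linarith [b18.norm_le w hw]
    have e : (mcl ℂ (a₀ (uPart w)) - Ψ • mcl ℂ (a₀ (uPart w) *
        jacobian (relaxedFlux F vstar) (uPart w))).comp (mcl ℂ (reduced F q w)) -
      (mcl ℂ (a₀ (uPart w) * jacobian (relaxedFlux F vstar) (uPart w)) -
        Ψ • mcl ℂ (a₀ (uPart w) * jacobian (relaxedFlux F vstar) (uPart w) *
          jacobian (relaxedFlux F vstar) (uPart w))) =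
        (mcl ℂ (a₀ (uPart w)) - Ψ • mcl ℂ (a₀ (uPart w) *
        jacobian (relaxedFlux F vstar) (uPart w))).comp (mcl ℂ (reduced F q w) -
          mcl ℂ (reduced F q (equilibrium vstar (uPart w)))) := by
      rw [← hJ, ContinuousLinearMap.comp_sub, mcl_mul (𝕜 := ℂ) (a₀ (uPart w) * _),
        mcl_mul (𝕜 := ℂ) (a₀ (uPart w)), ContinuousLinearMap.sub_comp _ _
        (mcl ℂ (jacobian (relaxedFlux F vstar) (uPart w))), ContinuousLinearMap.smul_comp]
    rw [e]
    refine (ContinuousLinearMap.opNorm_comp_le _ _).trans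
      (mul_le_mul hN (b5.norm_sub_le w hw _ hwe) (norm_nonneg _) (by positivity))
  · have e : (mcl ℂ (k (uPart w))).comp (mcl ℂ (reduced F q w)) -
        (mcl ℂ (a₀ (uPart w) * coupling F q w) - Ψ • mcl ℂ (a₀ (uPart w) *
          jacobian (relaxedFlux F vstar) (uPart w) * coupling F q w)).comp
          (mcl ℂ (jacobian F w).toBlocks₂₁ -
            (mcl ℂ (jacobian F w).toBlocks₂₂).comp (mcl ℂ (slaving q w))) -
        (mcl ℂ (a₀ (uPart w) * coupling F q w) - Ψ • mcl ℂ (a₀ (uPart w) *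
          jacobian (relaxedFlux F vstar) (uPart w) * coupling F q w)).comp
          ((mcl ℂ (slaving q w)).comp (mcl ℂ (reduced F q w))) =
        mcl ℂ (kawashimaMatrix F q a₀ k w) + Ψ • mcl ℂ (kawashimaCorrection F q vstar a₀ w) := by
      simp only [kawashimaMatrix, kawashimaCorrection, mcl_add,
        mcl_mul ℂ (a₀ (uPart w) * coupling F q w), mcl_sub, mcl_mul ℂ (k (uPart w)),
        mcl_mul ℂ (a₀ (uPart w) * jacobian (relaxedFlux F vstar) (uPart w) * coupling F q w),
        mcl_mul ℂ (slaving q w), mcl_mul ℂ (jacobian F w).toBlocks₂₂,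
        ContinuousLinearMap.sub_comp, ContinuousLinearMap.smul_comp, smul_add]
      abel
    rw [e, _root_.add_apply, inner_add_right, Complex.add_re]
    have h1 := (abs_le.1 (abs_re_inner_clm_sub_le (b16.norm_sub_le w hw _ hwe) y)).1
    have h2 := hkaw _ ⟨w, hw, rfl⟩ y
    have h3 : ‖Ψ • mcl ℂ (kawashimaCorrection F q vstar a₀ w)‖ ≤ |Ψ| * C := by
      rw [norm_smul, Real.norm_eq_abs]
      exact mul_le_mul_of_nonneg_left (b17.norm_le w hw) (abs_nonneg Ψ)
    have h4 := (abs_le.1 (abs_re_inner_clm_le _ y y le_rfl h3 le_rfl)).1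
    rw [uPart_eq] at *
    linarith

theorem HasDerivAt.complexCLM_const {E G : Type*} [NormedAddCommGroup E] [NormedSpace ℂ E]
    [NormedAddCommGroup G] [NormedSpace ℂ G] {f : ℝ → E} {f' : E} {x : ℝ}
    (hf : HasDerivAt f f' x) (M : E →L[ℂ] G) : HasDerivAt (fun t => M (f t)) (M f') x :=
  (M.restrictScalars ℝ).hasFDerivAt.comp_hasDerivAt x hf

/-! ### Spectral stability: assembling the estimates -/

set_option maxHeartbeats 1000000 in
theorem mainTheorem1 {n r : ℕ}
    (F : State n r → State n r) (q : State n r → EuclideanSpace ℝ (Fin r))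
    (vstar : EuclideanSpace ℝ (Fin n) → EuclideanSpace ℝ (Fin r))
    (𝒲 : Set (State n r)) (𝒰 : Set (EuclideanSpace ℝ (Fin n)))
    (A₀ K : State n r → Matrix (Fin n ⊕ Fin r) (Fin n ⊕ Fin r) ℝ)
    (a₀ k : EuclideanSpace ℝ (Fin n) → Matrix (Fin n) (Fin n) ℝ)
    (α₀ : EuclideanSpace ℝ (Fin n) → ℝ)
    (r₀ : EuclideanSpace ℝ (Fin n) → EuclideanSpace ℝ (Fin n)) (c₀ : ℝ)
    (hS : RelaxationStructure F q vstar 𝒲 𝒰)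
    (hA1 : IsSymmetrizer F 𝒲 A₀)
    (hA2 : ShizutaKawashima F q 𝒲 A₀ K)
    (hB1 : ReducedSymmetrizer F q vstar 𝒰 a₀)
    (hB2 : ReducedKawashima F q vstar 𝒰 a₀ k)
    (hB3 : PrincipalField F vstar 𝒰 c₀ α₀ r₀)
    (c C : ℝ) (hc : 0 < c) (hC : 0 < C)
    (𝒦 : Set (State n r)) (h𝒦 : IsCompact 𝒦) (h𝒦𝒲 : 𝒦 ⊆ 𝒲) (h𝒦𝒰 : ∀ w ∈ 𝒦, uPart w ∈ 𝒰) :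
    ∃ ε₀ : ℝ, 0 < ε₀ ∧
      ∀ (W : ℝ → State n r) (um up : EuclideanSpace ℝ (Fin n)),
        IsProfile F q W (equilibrium vstar um) (equilibrium vstar up) →
        (∀ x, W x ∈ 𝒦) →
        DissipativeAt q A₀ c (equilibrium vstar um) →
        DissipativeAt q A₀ c (equilibrium vstar up) →
        ProfileBounds α₀ r₀ C ‖equilibrium vstar up - equilibrium vstar um‖ W →
        ‖equilibrium vstar up - equilibrium vstar um‖ < ε₀ →
        SpectrallyStable F (source q) W := by
  have hf := hB1.symmetrizableField hS hB3
  obtain ⟨K', L, θ₁, C₁, ε₁, hK', hKreg, hL, hθ₁, hC₁, hε₁, hprof⟩ :=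
    hS.exists_profile_estimates hf hC h𝒦 h𝒦𝒲 h𝒦𝒰
  obtain ⟨C₂, m₂, θ₂, hC₂, hm₂, hθ₂, hb⟩ := hS.exists_slowBounds hB1 hB2 hK' hKreg
  obtain ⟨C₃, m₃, hC₃, hm₃, hAF, hen⟩ := hA1.exists_energy_estimate hS hK'
    (hKreg.trans regularStates_subset) hc
  -- One constant for Ψ = 2Lψ and its derivative: C₁ serves |Ψ| ≤ Λε and the extra 1 serves |Ψ'| ≤
  -- Λ|W'|.
  set Λ := 2 * L * (C₁ + 1) with hΛ
  have hΛ0 : 0 < Λ := by positivity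
  obtain ⟨B, g1, g2, g3, g4, g5, g6, g7, g8, g9, g10, g11⟩ : ∃ B : ℝ, 1 ≤ B ∧ C ≤ B ∧ C₂ ≤ B ∧
      (1 + Λ) * C₂ ≤ B ∧ (1 + 2 * Λ) * C₂ ≤ B ∧ (1 + Λ) * C₂ * (C₂ * C₁) ≤ B ∧ Λ * C₂ ≤ B ∧
      C₂ * (C₁ * C + Λ) ≤ B ∧ 1 + 2 * C₂ ^ 2 ≤ B ∧ 1 + C₂ ^ 2 ≤ B ∧ C₃ * (C + C₁) ≤ B := by
    have h := fun t : ℝ => eventually_ge_atTop t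
    exact ((h _).and <| (h _).and <| (h _).and <| (h _).and <| (h _).and <| (h _).and <|
      (h _).and <| (h _).and <| (h _).and <| (h _).and (h _)).exists
  -- The correction -Ψa₀J may cost half of the definiteness of a₀. In θ, the division by C₁ is there
  -- because compression is measured by |ū'| while ρ is |W'| ≤ C₁|ū'|.
  set m := min (m₂ / 2) m₃ with hm
  set θ := min (θ₁ / C₁) θ₂ with hθ
  have hm0 : 0 < m := by positivity
  have hθ0 : 0 < θ := by positivity
  obtain ⟨ε₂, hε₂, hvan⟩ := energy_vanishing (E := EuclideanSpace ℂ (Fin n))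
    (G := EuclideanSpace ℂ (Fin r)) g1 hm0 hθ0 hc
  -- The last entry ensures |Ψ|‖a₀J‖ ≤ m₂/2, which keeps the weight N positive definite.
  refine ⟨min (min 1 ε₁) (min ε₂ (m₂ / (2 * (Λ * C₂)))), by positivity, ?_⟩
  intro W um up hW hWK hdis _ hbd hεlt z hz0 hzre w hwH1 hsolve
  set ε := ‖equilibrium vstar up - equilibrium vstar um‖ with hε
  have hε0 : 0 ≤ ε := norm_nonneg _
  obtain ⟨⟨hεa, hεb⟩, hεc, hεd⟩ : (ε < 1 ∧ ε < ε₁) ∧ ε < ε₂ ∧ ε < m₂ / (2 * (Λ * C₂)) := by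
    simpa only [lt_min_iff] using hεlt
  have hεm : Λ * ε * C₂ ≤ m₂ / 2 := by
    rw [lt_div_iff₀ (by positivity)] at hεd
    linarith
  obtain ⟨hWK', hEK, hmK, hdist, hslow, hgood, hWm, ψ, hψ, hψb⟩ :=
    hprof W _ _ ε hW hWK hbd hε0 hεb.le
  obtain ⟨w', hw'c, hae, hw'i, hw'⟩ := hsolve.exists_continuous_ae_eq hwH1 hS
    hW.contDiff.continuous fun x => h𝒦𝒲 (hWK x)
  -- By the slaving relation, u = 0 and s = 0 force v = 0.
  suffices h0 : ∀ x, fstL ℂ (w' x) = 0 ∧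
      sndL ℂ (mcl ℂ (jacobian (source q) (W x)) (w' x)) = 0 by
    refine hae.trans (Eventually.of_forall fun x => ?_)
    have hs := sndL_eq_of_regular ℂ (hKreg (hWK' x)) (w' x)
    rw [(h0 x).1, (h0 x).2, map_zero, map_zero, neg_zero, zero_add] at hs
    have := norm_sq_eq_fstL_sndL ℂ (w' x)
    rw [(h0 x).1, hs] at this
    simpa using this
  have hWd := hW.hasDerivAt
  have hUd : ∀ x, HasDerivAt (fun t => uPart (W t)) (uPart (deriv W x)) x := fun x =>
    (fstL ℝ).hasFDerivAt.comp_hasDerivAt x (hWd x)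
  have hUle : ∀ x, ‖uPart (deriv W x)‖ ≤ ‖deriv W x‖ := fun x => norm_fstL_le ℝ _
  have hρ : ∀ x, ‖deriv W x‖ ≤ C * ε := fun x => (hbd.size x).trans (by
    gcongr
    nlinarith)
  have hΨd : ∀ x, HasDerivAt (fun t => 2 * L * ψ t) (2 * L * ‖uPart (deriv W x)‖) x :=
    fun x => (hψ x).const_mul _
  have hΨ : ∀ x, |2 * L * ψ x| ≤ Λ * ε := fun x => by
    rw [abs_mul, abs_of_pos (by positivity : 0 < 2 * L), hΛ, mul_assoc (2 * L)]
    gcongr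
    nlinarith [hψb x]
  have hΨ1 : ∀ x, |2 * L * ψ x| ≤ Λ := fun x => (hΨ x).trans (by nlinarith)
  have hΨ' : ∀ x, |2 * L * ‖uPart (deriv W x)‖| ≤ Λ * ‖deriv W x‖ := fun x => by
    rw [abs_of_nonneg (by positivity), hΛ]
    refine mul_le_mul ?_ (hUle x) (norm_nonneg _) (by positivity)
    nlinarith [mul_pos hL hC₁]
  have hreg : ∀ x, W x ∈ regularStates q 𝒲 𝒰 := fun x => hKreg (hWK' x)
  have ho := hS.isOpen_regularStates
  have ca : C1MatrixOn (fun w => a₀ (uPart w)) (regularStates q 𝒲 𝒰) :=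
    (C1MatrixOn.of_smooth hB1.smooth).comp_uPart
  have ck : C1MatrixOn (fun w => k (uPart w)) (regularStates q 𝒲 𝒰) :=
    (C1MatrixOn.of_smooth hB2.smooth).comp_uPart
  have cJ : C1MatrixOn (fun w => jacobian (relaxedFlux F vstar) (uPart w))
    (regularStates q 𝒲 𝒰) := hS.c1_jacobian_relaxedFlux.comp_uPart
  have hasymm : ∀ u ∈ 𝒰, (a₀ u).IsSymm := fun u hu => by
    have := (hB1.posDef u hu).isHermitian
    rwa [Matrix.IsHermitian, Matrix.conjTranspose_eq_transpose_of_trivial] at this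
  have hsymm₁ : ∀ u ∈ 𝒰, (a₀ u * jacobian (relaxedFlux F vstar) u *
      jacobian (relaxedFlux F vstar) u).IsSymm := fun u hu => by
    have h := hB1.symm u hu
    have h' := h
    rw [Matrix.IsSymm, Matrix.transpose_mul, (hasymm u hu).eq] at h'
    rw [Matrix.IsSymm, Matrix.transpose_mul, h.eq, ← Matrix.mul_assoc, h']
  have hsub : ∀ {M M' : Matrix (Fin n) (Fin n) ℝ} (t : ℝ), M.IsSymm → M'.IsSymm →
      ∀ y y' : EuclideanSpace ℂ (Fin n), inner ℂ ((mcl ℂ M - t • mcl ℂ M') y) y' =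
        inner ℂ y ((mcl ℂ M - t • mcl ℂ M') y') := fun {M M'} t hM hM' y y' => by
    rw [← mcl_smul, ← mcl_sub]
    exact inner_mcl_of_isSymm ℂ (hM.sub (hM'.smul t)) y y'
  choose T' hT' bT' using fun x => (ca.mul hS.c1_coupling).exists_hasDerivAt_sub_smul
    ((ca.mul cJ).mul hS.c1_coupling) ho hKreg hb.coupling₀ hb.coupling₁ (hWd x) (hWK' x) (hΨd x)
    le_rfl (hΨ1 x) (hΨ' x)
  choose Y' hY' bY' using fun x =>
    ((ca.mul hS.c1_coupling).mul hS.c1_slaving).exists_hasDerivAt_sub_smul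
    (((ca.mul cJ).mul hS.c1_coupling).mul hS.c1_slaving) ho hKreg hb.slaved₀ hb.slaved₁ (hWd x)
    (hWK' x) (hΨd x) le_rfl (hΨ1 x) (hΨ' x)
  choose p' hp' bp' using fun x => hen W (deriv W x) _ w' z x hzre (hWd x) hWK' hmK hdis hw'c (hw' x)
  have hS' := fun x => (hf.c1_aJ.hasDerivAt_mcl ℂ hS.isOpen_U (hUd x) (hreg x).2.1).sub
    ((hΨd x).smul (((ca.mul cJ).mul cJ).hasDerivAt_mcl ℂ ho (hWd x) (hreg x)))
  have hk' := fun x => ck.hasDerivAt_mcl ℂ ho (hWd x) (hreg x)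
  have hAw : ∀ x, ‖mcl ℂ (jacobian F (W x)) (w' x)‖ ≤ C₂ * ‖w' x‖ := fun x =>
    (mcl ℂ (jacobian F (W x))).le_of_opNorm_le (hb.flux.norm_le _ (hWK' x)) _
  have hAwc : Continuous fun x => mcl ℂ (jacobian F (W x)) (w' x) :=
    continuous_iff_continuousAt.2 fun x => (hw' x).continuousAt
  have hQs : ∀ x, ‖mcl ℂ (jacobian (source q) (W x)) (w' x)‖ ^ 2 =
      ‖sndL ℂ (mcl ℂ (jacobian (source q) (W x)) (w' x))‖ ^ 2 := fun x => by
    rw [norm_sq_eq_fstL_sndL, fstL_mcl_jacobian_source]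
    simp
  have hint : ∀ {f : ℝ → ℝ} (t : ℝ), Continuous f → (∀ x, |f x| ≤ t * ‖w' x‖ ^ 2) →
      Integrable f := fun t hfc hft =>
    (hw'i.const_mul t).mono' hfc.aestronglyMeasurable (Eventually.of_forall hft)
  have hsubn : ∀ {E G : Type} [NormedAddCommGroup E] [NormedSpace ℂ E] [NormedAddCommGroup G]
      [NormedSpace ℂ G] {M M' : E →L[ℂ] G} (x : ℝ), ‖M‖ ≤ C₂ → ‖M'‖ ≤ C₂ →
      ‖M - (2 * L * ψ x) • M'‖ ≤ B := fun {_ _} _ _ _ _ {M M'} x hM hM' => by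
    refine (norm_sub_le _ _).trans (le_trans ?_ g4)
    rw [norm_smul, Real.norm_eq_abs, one_add_mul]
    exact add_le_add hM (mul_le_mul (hΨ1 x) hM' (norm_nonneg _) hΛ0.le)
  have hsmul : ∀ {M : EuclideanSpace ℂ (Fin n) →L[ℂ] EuclideanSpace ℂ (Fin n)} (t : ℝ)
      (y : EuclideanSpace ℂ (Fin n)), (inner ℂ y ((t • M) y)).re = t * (inner ℂ y (M y)).re :=
    fun t y => by
      rw [_root_.smul_apply, inner_smul_right_eq_smul, Complex.real_smul, Complex.re_ofReal_mul]
  have hsmall : ∀ {M : EuclideanSpace ℂ (Fin n) →L[ℂ] EuclideanSpace ℂ (Fin n)} (x : ℝ) {t : ℝ},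
      ‖M‖ ≤ t → ‖(2 * L * ψ x) • M‖ ≤ Λ * ε * t := fun x t hM => by
    rw [norm_smul, Real.norm_eq_abs]
    exact mul_le_mul (hΨ x) hM (norm_nonneg _) (by positivity)
  have hpc : Continuous fun x =>
      (inner ℂ (w' x) (mcl ℂ (A₀ (W x) * jacobian F (W x)) (w' x))).re := by
    have h : Continuous fun x => 2⁻¹ *
        (inner ℂ (w' x) (mcl ℂ (A₀ (W x) * jacobian F (W x)) (w' x))).re :=
      continuous_iff_continuousAt.2 fun x => (hp' x).continuousAt
    simpa using h.const_mul 2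
  -- The integrated variable is U = -z⁻¹(Aw)_u, which is where z ≠ 0 enters, and h is the relaxed
  -- part of Aw. Both are square integrable because w is.
  refine hvan ε z (fun x => ‖deriv W x‖)
    (fun x => z⁻¹ • -fstL ℂ (mcl ℂ (jacobian F (W x)) (w' x))) (fun x => fstL ℂ (w' x))
    (fun x => sndL ℂ (w' x)) (fun x => sndL ℂ (mcl ℂ (jacobian (source q) (W x)) (w' x)))
    (fun x => sndL ℂ (mcl ℂ (jacobian F (W x)) (w' x)))
    (fun x => mcl ℂ (reduced F q (W x)))
    (fun x => mcl ℂ (a₀ (uPart (W x))) - (2 * L * ψ x) • mcl ℂ (a₀ (uPart (W x)) *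
      jacobian (relaxedFlux F vstar) (uPart (W x))))
    (fun x => mcl ℂ (a₀ (uPart (W x)) * jacobian (relaxedFlux F vstar) (uPart (W x))) -
      (2 * L * ψ x) • mcl ℂ (a₀ (uPart (W x)) * jacobian (relaxedFlux F vstar) (uPart (W x)) *
        jacobian (relaxedFlux F vstar) (uPart (W x))))
    _ (fun x => mcl ℂ (k (uPart (W x)))) _ Y' (fun x => mcl ℂ (coupling F q (W x)))
    (fun x => mcl ℂ (a₀ (uPart (W x)) * coupling F q (W x)) -
      (2 * L * ψ x) • mcl ℂ (a₀ (uPart (W x)) * jacobian (relaxedFlux F vstar) (uPart (W x)) *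
        coupling F q (W x))) T'
    (fun x => mcl ℂ (jacobian F (W x)).toBlocks₂₁) (fun x => mcl ℂ (slaving q (W x)))
    (fun x => mcl ℂ (jacobian F (W x)).toBlocks₂₂) (fun x => mcl ℂ (relaxInv q (W x)))
    _ p' (fun x => ‖w' x‖) hε0 hεc.le hzre (fun x => norm_nonneg _)
    (fun x => (hρ x).trans (by gcongr)) ?_ ?_ hS' hT' ?_ hk' hp' ?_ ?_ ?_ ?_ ?_ ?_ ?_ ?_ ?_ ?_
    (fun x => (hb.reduced.norm_le _ (hWK' x)).trans g3)
    (fun x => (hb.coupling.norm_le _ (hWK' x)).trans g3) ?_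
    (fun x => (hb.compensator.norm_le _ (hWK' x)).trans g3) ?_
    (fun x => (hb.flux₂₁.norm_le _ (hWK' x)).trans g3)
    (fun x => (hb.flux₂₂.norm_le _ (hWK' x)).trans g3)
    (fun x => (hb.slaving.norm_le _ (hWK' x)).trans g3)
    (fun x => (hb.relaxInv.norm_le _ (hWK' x)).trans g3)
    (fun x => (hb.compensator.norm_dirMatrix_le _ (hWK' x) _).trans (by gcongr))
    (fun x => (bY' x).trans (by gcongr)) (fun x => (bT' x).trans (by gcongr))
    ?_ ?_ ?_ ?_ ?_ ?_ ?_
  · intro x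
    refine ((hw' x).complexCLM_const (fstL ℂ)).neg.const_smul z⁻¹ |>.congr_deriv ?_
    rw [map_sub, fstL_mcl_jacobian_source, zero_sub, map_smul, neg_neg, smul_smul,
      inv_mul_cancel₀ hz0, one_smul]
  · intro x
    refine ((hw' x).complexCLM_const (sndL ℂ)).congr_deriv ?_
    rw [map_sub, map_smul]
  · intro x
    have h := hY' x
    simp only [mcl_mul ℂ _ (slaving q _)] at h
    simpa only [ContinuousLinearMap.sub_comp, ContinuousLinearMap.smul_comp] using h
  · exact (integrable_re_inner_clm (fun x => hAF _ (hWK' x)) (hpc.congr fun x => rfl)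
      hw'i hw'i).const_mul _
  · refine hint (‖z⁻¹‖ ^ 2 * C₂ ^ 2) (by fun_prop) fun x => ?_
    rw [abs_of_nonneg (by positivity), norm_smul, norm_neg, mul_pow, mul_assoc, ← mul_pow C₂]
    gcongr
    exact (norm_fstL_le ℂ _).trans (hAw x)
  · refine hint (C₂ ^ 2) (by fun_prop) fun x => ?_
    rw [abs_of_nonneg (by positivity), ← mul_pow]
    gcongr
    exact (norm_sndL_le ℂ _).trans (hAw x)
  · intro x
    rw [smul_smul, mul_inv_cancel₀ hz0, one_smul, fstL_mcl_jacobian ℂ (hreg x)]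
    abel
  · intro x
    exact sndL_mcl ℂ _ _
  · intro x
    exact sndL_eq_of_regular ℂ (hreg x) _
  · intro x
    rw [mcl_mul ℂ (a₀ (uPart (W x))) (coupling F q (W x)),
      mcl_mul ℂ (a₀ (uPart (W x)) * _) (coupling F q (W x)), ContinuousLinearMap.sub_comp,
      ContinuousLinearMap.smul_comp]
  · exact fun x => hsub _ (hasymm _ (hreg x).2.1) (hB1.symm _ (hreg x).2.1)
  · exact fun x => hsub _ (hB1.symm _ (hreg x).2.1) (hsymm₁ _ (hreg x).2.1)
  · exact fun x => inner_mcl_of_skew ℂ (hB2.skew _ (hreg x).2.1)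
  · exact fun x => hsubn x (hb.coupling₀.norm_le _ (hWK' x)) (hb.coupling₁.norm_le _ (hWK' x))
  · exact fun x => hsubn x (hb.symm₀.norm_le _ (hWK' x)) (hb.symm₁.norm_le _ (hWK' x))
  · intro x
    refine (hb.commutator _ (hWK' x) (hEK x) _).trans ?_
    calc _ ≤ (1 + Λ) * C₂ * (C₂ * (C₁ * ‖deriv W x‖)) := by
          gcongr
          exacts [hΨ1 x, hdist x]
      _ = (1 + Λ) * C₂ * (C₂ * C₁) * ‖deriv W x‖ := by ring
      _ ≤ _ := by gcongr
  · intro x y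
    have h1 := hb.weight_pos _ (hWK' x) y
    have h2 := (abs_le.1 (abs_re_inner_clm_le _ y y le_rfl
      (hsmall x (hb.symm₀.norm_le _ (hWK' x))) le_rfl)).2
    rw [_root_.sub_apply, inner_sub_right, Complex.sub_re]
    have h3 : m * ‖y‖ ^ 2 ≤ m₂ / 2 * ‖y‖ ^ 2 := by
      gcongr
      exact min_le_left _ _
    have h4 := mul_le_mul_of_nonneg_right hεm (sq_nonneg ‖y‖)
    linarith
  -- Half of the derivative of S consists of the Goodman form, where the factor 2 in Ψ = 2Lψ cancels
  -- the ½, and of ½Ψ times the derivative of a₀JJ, which is O(ε|W'|).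
  · intro x y
    have h1 := hgood x y
    have h2 := (abs_le.1 (abs_re_inner_clm_le _ y y le_rfl
      (hsmall x (hb.symm₁.norm_dirMatrix_le _ (hWK' x) (deriv W x))) le_rfl)).1
    have h3 : θ * ‖deriv W x‖ * ‖y‖ ^ 2 ≤ θ₁ * ‖uPart (deriv W x)‖ * ‖y‖ ^ 2 := by
      gcongr ?_ * _
      calc θ * ‖deriv W x‖ ≤ θ₁ / C₁ * (C₁ * ‖uPart (deriv W x)‖) := by
            gcongr
            exacts [min_le_left _ _, hslow x]
        _ = _ := by field_simp
    have h4 : Λ * C₂ * (ε * ‖deriv W x‖ * ‖y‖ ^ 2) ≤ B * (ε * ‖deriv W x‖ * ‖y‖ ^ 2) := by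
      gcongr
    have h5 : 0 ≤ Λ * C₂ * (ε * ‖deriv W x‖ * ‖y‖ ^ 2) := by positivity
    rw [hsmul] at h2
    rw [_root_.sub_apply, _root_.add_apply, inner_sub_right, inner_add_right, Complex.sub_re,
      Complex.add_re, hsmul, hsmul]
    linarith
  · intro x y
    refine le_trans ?_ (hb.kawashima _ (hWK' x) (hEK x) (2 * L * ψ x) y)
    have h1 : C₂ * (‖W x - equilibrium vstar (uPart (W x))‖ + |2 * L * ψ x|) ≤ B * ε := by
      calc _ ≤ C₂ * (C₁ * (C * ε) + Λ * ε) := by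
            gcongr
            exacts [(hdist x).trans (by gcongr; exact hρ x), hΨ x]
        _ = C₂ * (C₁ * C + Λ) * ε := by ring
        _ ≤ _ := by gcongr
    have h2 := mul_le_mul_of_nonneg_right h1 (sq_nonneg ‖y‖)
    have h3 := mul_le_mul_of_nonneg_right (min_le_right (θ₁ / C₁) θ₂) (sq_nonneg ‖y‖)
    linarith
  · intro x
    have h1 := (mcl ℂ (slaving q (W x))).le_of_opNorm_le (hb.slaving.norm_le _ (hWK' x))
      (fstL ℂ (w' x))
    have h2 := (mcl ℂ (relaxInv q (W x))).le_of_opNorm_le (hb.relaxInv.norm_le _ (hWK' x))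
      (sndL ℂ (mcl ℂ (jacobian (source q) (W x)) (w' x)))
    have h3 : ‖sndL ℂ (w' x)‖ ≤ C₂ * ‖fstL ℂ (w' x)‖ +
        C₂ * ‖sndL ℂ (mcl ℂ (jacobian (source q) (W x)) (w' x))‖ := by
      rw [sndL_eq_of_regular ℂ (hreg x)]
      refine (norm_add_le _ _).trans (add_le_add ?_ h2)
      rwa [norm_neg]
    have h4 := pow_le_pow_left₀ (norm_nonneg _) h3 2
    rw [norm_sq_eq_fstL_sndL]
    refine le_trans ?_ (mul_le_mul_of_nonneg_right g9 (by positivity))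
    nlinarith [sq_nonneg (C₂ * ‖fstL ℂ (w' x)‖ -
      C₂ * ‖sndL ℂ (mcl ℂ (jacobian (source q) (W x)) (w' x))‖),
      sq_nonneg ‖sndL ℂ (mcl ℂ (jacobian (source q) (W x)) (w' x))‖]
  · intro x
    have h1 := (mcl ℂ (jacobian (source q) (W x))).le_of_opNorm_le
      (hb.relax.norm_le _ (hWK' x)) (w' x)
    have h2 := pow_le_pow_left₀ (norm_nonneg _) h1 2
    have h3 := pow_le_pow_left₀ (norm_nonneg _) (norm_fstL_le ℂ (w' x)) 2
    rw [← hQs]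
    refine le_trans ?_ (mul_le_mul_of_nonneg_right g10 (by positivity))
    rw [mul_pow] at h2
    linarith
  · intro x
    refine (bp' x).trans ?_
    rw [hQs]
    have h1 : C₃ * (‖deriv W x‖ + ‖W x - equilibrium vstar um‖) ≤ B * ε := by
      calc _ ≤ C₃ * (C * ε + C₁ * ε) := by
            gcongr
            exacts [hρ x, hWm x]
        _ = C₃ * (C + C₁) * ε := by ring
        _ ≤ _ := by gcongr
    have h2 : m * z.re * ‖w' x‖ ^ 2 ≤ m₃ * z.re * ‖w' x‖ ^ 2 := by
      gcongr
      exact min_le_right _ _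
    gcongr
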